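/- A \emph{conjunctive positive sentence} is a first-order sentence over the vocabulary $\{\le\}$ that is built from atoms $x\le y$ and $x=y$ using only conjunction $\wedge$ and the quantifiers $\forall$, $\exists$. The \emph{width} of a finite poset is the maximum size of an antichain in it. For a natural number $w$ put $\exp_w^0(x)=x$ and $\exp_w^{i+1}(x)=w^{\exp_w^{i}(x)}$. Instances $(P,\varphi)$, consisting of a nonempty finite poset $P$ and a conjunctive positive sentence $\varphi$, are given as strings over a fixed finite alphabet: $P$ by the $0$-$1$ matrix of its order relation with respect to an arbitrary listing of its elements, and $\varphi$ by its symbols, with variable indices in binary. $\|\varphi\|$ and $\|(P,\varphi)\|$ denote the lengths of the strings that represent $\varphi$ and $(P,\varphi)$. Running time is the number of steps of a random access machine (addition, cut-off subtraction, halving, indirect addressing, conditional jumps) under the uniform cost measure. \textbf{Theorem.} There is an algorithm that, given a nonempty finite poset $P$ and a conjunctive positive sentence $\varphi$, decides whether $P\models\varphi$ in time $$\exp_w^4(O(k))\cdot n^{O(1)},$$ where $w$ is the width of $P$, $k=\|\varphi\|$ and $n=\|(P,\varphi)\|$; that is, there are constants $C,c,d\in\mathbb{N}$ such that on every instance the algorithm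 halts with the correct answer after at most $C\cdot\exp_w^4(c\,k)\cdot n^{d}$ steps. Consequently, the problem parameterized by $\kappa=w+k$ is fixed-parameter tractable: there are an algorithm, a computable function $f\colon\mathbb{N}\to\mathbb{N}$ and a polynomial $p$ such that the algorithm decides every instance in at most $f(\kappa)\cdot p(n)$ steps. -/

import Mathlib

universe u

namespace PosetMC

/-! ## Conjunctive positive first-order logic over the vocabulary of posets -/

/-- Formulas of `FO(∀, ∃, ∧)` over the vocabulary `{≤}`: built from the atoms `x ≤ y` and `x = y`
(the variable symbols are `0, 1, 2, …`) with conjunction and the two quantifiers only. -/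
inductive CPFormula : Type
  | le (x y : ℕ) : CPFormula
  | eq (x y : ℕ) : CPFormula
  | and (φ ψ : CPFormula) : CPFormula
  | all (x : ℕ) (φ : CPFormula) : CPFormula
  | ex (x : ℕ) (φ : CPFormula) : CPFormula

/-- The free variables of a formula. -/
def CPFormula.freeVars : CPFormula → Finset ℕ
  | .le x y => {x, y}
  | .eq x y => {x, y}
  | .and φ ψ => φ.freeVars ∪ ψ.freeVars
  | .all x φ => φ.freeVars.erase x
  | .ex x φ => φ.freeVars.erase x

/-- A sentence is a formula without free variables. -/
def CPFormula.IsSentence (φ : CPFormula) : Prop := φ.freeVars = ∅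

/-- Satisfaction of a formula in `P` under an assignment `v` of the variables. -/
def CPFormula.Sat {P : Type u} [LE P] : CPFormula → (ℕ → P) → Prop
  | .le x y, v => v x ≤ v y
  | .eq x y, v => v x = v y
  | .and φ ψ, v => φ.Sat v ∧ ψ.Sat v
  | .all x φ, v => ∀ a : P, φ.Sat (Function.update v x a)
  | .ex x φ, v => ∃ a : P, φ.Sat (Function.update v x a)

/-- `P ⊨ φ`, for a sentence `φ` (whose truth value does not depend on the assignment). -/
def Models (P : Type u) [LE P] (φ : CPFormula) : Prop := ∀ v : ℕ → P, φ.Sat v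

/-- The width of a finite poset: the maximum size of an antichain. -/
noncomputable def width (P : Type u) [LE P] : ℕ :=
  sSup {n : ℕ | ∃ A : Finset P, IsAntichain (· ≤ ·) (A : Set P) ∧ A.card = n}

/-! ## Encoding of instances over a finite alphabet -/

/-- The input alphabet. -/
inductive Letter : Type
  | zero | one | sep | forallSym | existsSym | andSym | leSym | eqSym

/-- The letters as numbers, for the machine; the number `0` is left to mark the end of the input. -/
def Letter.code : Letter → ℕ
  | .zero => 1
  | .one => 2
  | .sep => 3
  | .forallSym => 4
  | .existsSym => 5
  | .andSym => 6
  | .leSym => 7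
  | .eqSym => 8

/-- A variable symbol is written as its index in binary (least significant bit first),
followed by a separator. -/
def encodeVar (x : ℕ) : List Letter :=
  x.bits.map (fun b => if b then Letter.one else Letter.zero) ++ [Letter.sep]

/-- A formula is written in prefix (Polish) notation. -/
def CPFormula.encode : CPFormula → List Letter
  | .le x y => Letter.leSym :: (encodeVar x ++ encodeVar y)
  | .eq x y => Letter.eqSym :: (encodeVar x ++ encodeVar y)
  | .and φ ψ => Letter.andSym :: (φ.encode ++ ψ.encode)
  | .all x φ => Letter.forallSym :: (encodeVar x ++ φ.encode)
  | .ex x φ => Letter.existsSym :: (encodeVar x ++ φ.encode)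

/-- `‖φ‖`, the size of (the encoding of) `φ`. -/
def CPFormula.size (φ : CPFormula) : ℕ := φ.encode.length

open Classical in
/-- A finite poset whose elements are listed by `e` is written as the 0-1 matrix of its order
relation, row by row, each row followed by a separator. -/
noncomputable def encodePoset {P : Type u} [LE P] {m : ℕ} (e : Fin m ≃ P) : List Letter :=
  (List.finRange m).flatMap fun i =>
    ((List.finRange m).map fun j => if e i ≤ e j then Letter.one else Letter.zero) ++ [Letter.sep]

/-- An instance of the model checking problem for finite posets and sentences of `FO(∀, ∃, ∧)`:
a nonempty finite poset, given by some listing of its elements, and a sentence. -/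
structure Instance : Type (u + 1) where
  carrier : Type u
  [order : PartialOrder carrier]
  [nonempty : Nonempty carrier]
  card : ℕ
  listing : Fin card ≃ carrier
  sentence : CPFormula
  isSentence : sentence.IsSentence

attribute [instance] Instance.order Instance.nonempty

namespace Instance

/-- The string over the input alphabet that represents the instance. -/
noncomputable def encode (I : Instance.{u}) : List Letter :=
  encodePoset I.listing ++ I.sentence.encode

/-- `‖(P, φ)‖`, the size of (the encoding of) the instance. -/
noncomputable def size (I : Instance.{u}) : ℕ := I.encode.length

/-- The instance is a yes-instance if its poset satisfies its sentence. -/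
def IsYes (I : Instance.{u}) : Prop := Models I.carrier I.sentence

end Instance

/-! ## Random access machines with uniform cost measure -/

/-- Instructions of a random access machine. There are registers `r 0, r 1, r 2, …` that hold
natural numbers, and a read-only input. The arithmetic is addition, cut-off subtraction and
halving. -/
inductive Instr : Type
  /-- `r i := a` -/
  | const (i a : ℕ) : Instr
  /-- `r i := r j` -/
  | copy (i j : ℕ) : Instr
  /-- `r i := r j + r k` -/
  | add (i j k : ℕ) : Instr
  /-- `r i := r j - r k`, and `0` if `r j < r k` -/
  | sub (i j k : ℕ) : Instr
  /-- `r i := ⌊r j / 2⌋` -/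
  | half (i j : ℕ) : Instr
  /-- `r i := r (r j)` -/
  | load (i j : ℕ) : Instr
  /-- `r (r i) := r j` -/
  | store (i j : ℕ) : Instr
  /-- `r i :=` the code of the input letter at position `r j` (counted from `0`), and `0` if the
  input has no such position -/
  | read (i j : ℕ) : Instr
  /-- go to line `l` -/
  | jump (l : ℕ) : Instr
  /-- go to line `l` if `r i = 0`, and to the next line otherwise -/
  | jumpZero (i l : ℕ) : Instr

/-- A configuration: the program counter and the contents of the registers. -/
structure Config : Type where
  pc : ℕ
  reg : ℕ → ℕ

/-- Write `a` to register `i` and go to the next line. -/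
def Config.write (c : Config) (i a : ℕ) : Config := ⟨c.pc + 1, Function.update c.reg i a⟩

/-- The effect of one instruction, on input `x`. -/
def Instr.exec (x : List Letter) (c : Config) : Instr → Config
  | .const i a => c.write i a
  | .copy i j => c.write i (c.reg j)
  | .add i j k => c.write i (c.reg j + c.reg k)
  | .sub i j k => c.write i (c.reg j - c.reg k)
  | .half i j => c.write i (c.reg j / 2)
  | .load i j => c.write i (c.reg (c.reg j))
  | .store i j => c.write (c.reg i) (c.reg j)
  | .read i j => c.write i ((x[c.reg j]?).elim 0 Letter.code)
  | .jump l => ⟨l, c.reg⟩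
  | .jumpZero i l => ⟨if c.reg i = 0 then l else c.pc + 1, c.reg⟩

/-- A program is a finite list of instructions; its lines are counted from `0`. -/
abbrev Program : Type := List Instr

namespace Program

/-- The configuration after `t` steps on input `x`. The machine starts at line `0` with all
registers `0`, and it halts (the configuration no longer changes) when the program counter
points to no line of the program. -/
def run (M : Program) (x : List Letter) : ℕ → Config
  | 0 => ⟨0, fun _ => 0⟩
  | t + 1 =>
    match M[(M.run x t).pc]? with
    | some ins => ins.exec x (M.run x t)
    | none => M.run x t

/-- On input `x`, the program halts after at most `T` steps, and then register `0` holds the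
truth value (`1` or `0`) of `Q`. -/
def DecidesWithin (M : Program) (x : List Letter) (Q : Prop) (T : ℕ) : Prop :=
  ∃ t ≤ T, M.length ≤ (M.run x t).pc ∧
    (Q → (M.run x t).reg 0 = 1) ∧ (¬ Q → (M.run x t).reg 0 = 0)

end Program

/-- `iterExp w i x` is `exp_w^i(x)`, where `exp_w^0(x) = x` and
`exp_w^(i+1)(x) = w ^ exp_w^i(x)`. -/
def iterExp (w : ℕ) : ℕ → ℕ → ℕ
  | 0, x => x
  | i + 1, x => w ^ iterExp w i x

/-- Model checking on finite posets, with parameterization `κ`, is fixed-parameter tractable: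
for a computable `f` and a polynomial `p`, some program decides every instance in time
`f (κ I) * p (‖I‖)`. -/
def IsFPT (κ : Instance.{u} → ℕ) : Prop :=
  ∃ (M : Program) (f : ℕ → ℕ) (p : Polynomial ℕ), Computable f ∧
    ∀ I : Instance.{u}, M.DecidesWithin I.encode I.IsYes (f (κ I) * p.eval I.size)

end PosetMC

/-!
Model checking of a sentence is a game: the elements for its quantifiers are chosen one after
another, the universal ones by an opponent, and in the end all atoms have to hold. As there is no
negation and no disjunction, a quantifier moves out of a conjunction, so that the sentence is the
game of *all* its quantifiers in the order in which they are written, and the matrix is just a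
relation on the quantifiers (`CPFormula.sat_iff_game`). This relation is replaced by its transitive
closure `ρ` (`holds_closure`).

*Trivial cases.* A poset with one element satisfies every sentence. On a larger poset the opponent
wins if some universal element is required to be below another universal one, or to equal
one chosen earlier (`not_game_of_viol`). Otherwise each existential element that is forced to equal
a universal one is represented by it, and if the poset has a least and a greatest element, the
sentence holds (`game_of_bot_top`). This covers width `1`.

*Existential choices.* Let `lvl P 0 = ∅`, and let `lvl P (t + 1)` consist of the elements that are
minimal among those with the same elements of `lvl P t` below them, or maximal among those with the
same elements of `lvl P t` above them. Each element can be lowered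
or raised to such an element without losing its relations to `lvl P t`. An existential element that
is above no universal one can be lowered, the others can be raised, and if the level for each index
is chosen by its height in `ρ`, all requirements survive: with `r` quantifiers, the existential
player needs the elements of `lvl P (r + 1)` only (`restrict_existential`).

*Universal choices.* Hence a universal element matters only through its relations to
`lvl P (r + 1)`, and one element for each pattern of relations suffices (`restrict_universal`).

*Counting.* In width `w`, the elements of a set `L` below (or above) a given element are determined
by an antichain, so that there are at most `(|L| + 1) ^ w` possibilities. This gives
`|lvl P t| < w ^ (3 * (w + 1) ^ t)` for `w ≥ 2` and at most
`(|lvl P (r + 1)| + 1) ^ (2 * w)` universal choices (`card_lvl_le`, `card_types_le`). The number of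
plays is at most the `r`-th power of this, which is below a tower of height `4`
(`pow_card_le_iterExp`).

*The algorithm* reads the input, computes `ρ` with Warshall's algorithm, the levels and the
patterns with exhaustive search, and the restricted game by backtracking, for as many steps as a
number that it computes beforehand (`budget`). It is written in a small language whose loops have a
number of rounds that is known on entry. Programs of this language are compiled to the machine
(`Ex.code_spec`, `Cmd.code_spec`), and their running time is at most a polynomial in the largest
number of rounds (`Cmd.exists_cost_le`).
-/

namespace PosetMC

/-! ### Executions of random access machines -/

/-- One step of a program. -/
def step (M : Program) (x : List Letter) (c : Config) : Config :=
  match M[c.pc]? with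
  | some ins => ins.exec x c
  | none => c

theorem run_eq_iterate (M : Program) (x : List Letter) (t : ℕ) :
    M.run x t = (step M x)^[t] ⟨0, fun _ => 0⟩ := by
  induction t with
  | zero => rfl
  | succ t ih => rw [Function.iterate_succ_apply', ← ih]; rfl

/-- The configuration `c'` is reached from `c` after at most `T` steps. -/
def ReachesIn (M : Program) (x : List Letter) (c c' : Config) (T : ℕ) : Prop :=
  ∃ t ≤ T, (step M x)^[t] c = c'

theorem ReachesIn.refl {M : Program} {x : List Letter} (c : Config) (T : ℕ) :
    ReachesIn M x c c T := ⟨0, Nat.zero_le _, rfl⟩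

theorem ReachesIn.of_eq {M : Program} {x : List Letter} {o o' : ℕ} {ρ : ℕ → ℕ} (h : o = o')
    (T : ℕ) : ReachesIn M x ⟨o, ρ⟩ ⟨o', ρ⟩ T := h ▸ .refl _ T

theorem ReachesIn.trans {M : Program} {x : List Letter} {c c' c'' : Config} {T T' S : ℕ}
    (h : ReachesIn M x c c' T) (h' : ReachesIn M x c' c'' T') (hS : T + T' ≤ S) :
    ReachesIn M x c c'' S := by
  obtain ⟨t, ht, rfl⟩ := h
  obtain ⟨t', ht', rfl⟩ := h'
  exact ⟨t' + t, by omega, by rw [Function.iterate_add_apply]⟩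

theorem ReachesIn.head {M : Program} {x : List Letter} {c c' : Config} {ins : Instr} {T S : ℕ}
    (hi : M[c.pc]? = some ins) (h : ReachesIn M x (ins.exec x c) c' T) (hS : T + 1 ≤ S) :
    ReachesIn M x c c' S := by
  refine ReachesIn.trans (T := 1) ⟨1, le_rfl, ?_⟩ h (by omega)
  simp [step, hi]

/-- The comparison at the head of a loop. -/
theorem ReachesIn.test {M : Program} {x : List Letter} {o t i j l w T S : ℕ} {ρ : ℕ → ℕ}
    {c' : Config} (h1 : M[o]? = some (.sub t i j)) (h2 : M[o + 1]? = some (.jumpZero t l))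
    (hw : ρ i - ρ j = w)
    (h : ReachesIn M x ⟨if w = 0 then l else o + 1 + 1, Function.update ρ t w⟩ c' T)
    (hS : T + 2 ≤ S) : ReachesIn M x ⟨o, ρ⟩ c' S := by
  subst hw
  refine .head h1 (.head h2 (T := T) ?_ le_rfl) (by omega)
  simpa [Instr.exec, Config.write] using h

/-- The program `M` contains the instructions `code` from line `o` on. -/
def CodeAt (M : Program) (o : ℕ) (code : List Instr) : Prop :=
  ∀ i ins, code[i]? = some ins → M[o + i]? = some ins

theorem codeAt_nil (M : Program) (o : ℕ) : CodeAt M o [] := by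
  intro i ins h; simp at h

theorem codeAt_cons {M : Program} {o : ℕ} {i : Instr} {c : List Instr} :
    CodeAt M o (i :: c) ↔ M[o]? = some i ∧ CodeAt M (o + 1) c := by
  constructor
  · intro h
    refine ⟨h 0 i rfl, fun j ins hj => ?_⟩
    have := h (j + 1) ins (by simpa using hj)
    rwa [show o + (j + 1) = o + 1 + j by omega] at this
  · rintro ⟨h0, h⟩ j ins hj
    cases j with
    | zero => simp at hj; simpa [← hj] using h0
    | succ j =>
      have := h j ins (by simpa using hj)
      rwa [show o + 1 + j = o + (j + 1) by omega] at this

theorem codeAt_append {M : Program} {c d : List Instr} : ∀ {o : ℕ},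
    CodeAt M o (c ++ d) ↔ CodeAt M o c ∧ CodeAt M (o + c.length) d := by
  induction c with
  | nil => intro o; simp [codeAt_nil]
  | cons i c ih =>
    intro o
    rw [List.cons_append, codeAt_cons, codeAt_cons, ih, and_assoc, List.length_cons,
      show o + 1 + c.length = o + (c.length + 1) by omega]

/-! ### A language of bounded loops -/

/-- The scalar variables of the algorithm.
* `len` is the length of the input, `size` that of the poset, `qs` the number of quantifiers, and
  `lv` the number of levels of candidates.
* For parsing: `scope` is the number plus one of the innermost quantifier around the current
  position (`0` if there is none), `sp` the height of the stack of scopes, `num` the value of the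
  binary digits read since the last separator, `pw` the weight of the next digit, `pend` the
  symbol whose variables are being read, `fst` the quantifier of the first variable of an atom,
  and `cur` the position of a search.
* `bad` and `triv` tell whether the instance is decided without playing, and `bud`, computed with
  the help of `bud'`, is the number of steps for the game.
* For backtracking: `mode` is the mode, `dep` the current quantifier, and `res` the value of the
  last game that has been evaluated, and finally the output. -/
inductive Var : Type
  | len | size | qs | lv | scope | sp | num | pw | pend | fst | cur | bud | bud' | bad | triv
  | mode | dep | res
  deriving DecidableEq

/-- The arrays of the algorithm.
* `rowM` and `rowN` are tables of the multiples of `size + 1` and of `len`, the lengths of the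
  rows of the matrix in the input and of the matrix `reach`; the machine has no multiplication.
* `kind`, `name` and `parent` describe the quantifiers: whether it is universal, its variable,
  and the value of `scope` outside of it. The array `stack` holds the scopes of the second parts
  of the open conjunctions.
* `reach` is the matrix of the relation on the quantifiers, and `rep` the representatives.
* `cand` (with the auxiliary array `cand'`) and `reps` are the sets of candidates for the
  existential and for the universal quantifiers.
* `val` holds the values chosen for the quantifiers, and `acc` the intermediate results. -/
inductive Arr : Type
  | rowM | rowN | kind | name | parent | stack | reach | rep | cand | cand' | reps | val | acc
  deriving DecidableEq

/-- The number of a scalar variable. -/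
def Var.idx : Var → ℕ
  | len => 0 | size => 1 | qs => 2 | lv => 3 | scope => 4 | sp => 5 | num => 6 | pw => 7
  | pend => 8 | fst => 9 | cur => 10 | bud => 11 | bud' => 12 | bad => 13 | triv => 14
  | mode => 15 | dep => 16 | res => 17

/-- The number of an array. -/
def Arr.idx : Arr → ℕ
  | rowM => 0 | rowN => 1 | kind => 2 | name => 3 | parent => 4 | stack => 5 | reach => 6
  | rep => 7 | cand => 8 | cand' => 9 | reps => 10 | val => 11 | acc => 12

theorem Var.idx_inj {i j : Var} (h : i.idx = j.idx) : i = j := by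
  cases i <;> cases j <;> first | rfl | cases h

theorem Arr.idx_inj {b c : Arr} (h : b.idx = c.idx) : b = c := by
  cases b <;> cases c <;> first | rfl | cases h

theorem Arr.idx_lt (b : Arr) : b.idx < 13 := by
  cases b <;> decide

/-- The states of the programs of the language: scalar variables and arrays. -/
@[ext] structure State : Type where
  v : Var → ℕ
  a : Arr → ℕ → ℕ

/-- Assignment to a scalar variable. -/
def State.setv (s : State) (i : Var) (w : ℕ) : State := { s with v := Function.update s.v i w }

/-- Assignment to a cell of an array. -/
def State.seta (s : State) (b : Arr) (i w : ℕ) : State :=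
  { s with a := Function.update s.a b (Function.update (s.a b) i w) }

/-- Expressions: numerals, loop counters (as de Bruijn indices), scalar variables, array cells,
input letters, sums, cut-off differences, and the truth value of a bounded universal
quantification, where the bound is the value of a scalar variable. -/
inductive Ex : Type
  | num (k : ℕ)
  | bv (i : ℕ)
  | sv (i : Var)
  | arr (b : Arr) (e : Ex)
  | inp (e : Ex)
  | add (e f : Ex)
  | sub (e f : Ex)
  | all (i : Var) (e : Ex)

/-- The letter code of the input at a position, and `0` beyond the end of the input. -/
def letterAt (x : List Letter) (i : ℕ) : ℕ := (x[i]?).elim 0 Letter.code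

/-- The value of an expression; `β` lists the values of the enclosing counters, innermost first. -/
def Ex.eval (x : List Letter) (s : State) : Ex → List ℕ → ℕ
  | .num k, _ => k
  | .bv i, β => β.getD i 0
  | .sv i, _ => s.v i
  | .arr b e, β => s.a b (e.eval x s β)
  | .inp e, β => letterAt x (e.eval x s β)
  | .add e f, β => e.eval x s β + f.eval x s β
  | .sub e f, β => e.eval x s β - f.eval x s β
  | .all i e, β => if ∀ j < s.v i, e.eval x s (j :: β) ≠ 0 then 1 else 0

/-- Commands: the empty command, assignments, composition, branching (to the first branch if the
condition is not `0`), and loops, whose number of rounds is the value of a scalar variable. -/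
inductive Cmd : Type
  | skip
  | setv (i : Var) (e : Ex)
  | seta (b : Arr) (e f : Ex)
  | seq (c d : Cmd)
  | ite (e : Ex) (c d : Cmd)
  | loop (i : Var) (c : Cmd)

/-- `iter f n s = f (n - 1) (⋯ (f 1 (f 0 s)))`. -/
def iter {α : Type*} (f : ℕ → α → α) : ℕ → α → α
  | 0, s => s
  | n + 1, s => f n (iter f n s)

/-- The effect of a command. -/
def Cmd.den (x : List Letter) : Cmd → List ℕ → State → State
  | .skip, _, s => s
  | .setv i e, β, s => s.setv i (e.eval x s β)
  | .seta b e f, β, s => s.seta b (e.eval x s β) (f.eval x s β)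
  | .seq c d, β, s => d.den x β (c.den x β s)
  | .ite e c d, β, s => if e.eval x s β ≠ 0 then c.den x β s else d.den x β s
  | .loop i c, β, s => iter (fun j s => c.den x (j :: β) s) (s.v i) s

/-- The variables that bound quantifications. -/
def Ex.bnd : Ex → List Var
  | .num _ | .bv _ | .sv _ => []
  | .arr _ e | .inp e => e.bnd
  | .add e f | .sub e f => e.bnd ++ f.bnd
  | .all i e => i :: e.bnd

/-- The variables that bound loops and quantifications. -/
def Cmd.bnd : Cmd → List Var
  | .skip => []
  | .setv _ e => e.bnd
  | .seta _ e f => e.bnd ++ f.bnd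
  | .seq c d => c.bnd ++ d.bnd
  | .ite e c d => e.bnd ++ (c.bnd ++ d.bnd)
  | .loop i c => i :: c.bnd

/-- The scalar variables that a command assigns to. -/
def Cmd.modv : Cmd → List Var
  | .skip => []
  | .setv i _ => [i]
  | .seta _ _ _ => []
  | .seq c d | .ite _ c d => c.modv ++ d.modv
  | .loop _ c => c.modv

/-- The arrays that a command assigns to. -/
def Cmd.moda : Cmd → List Arr
  | .skip => []
  | .setv _ _ => []
  | .seta b _ _ => [b]
  | .seq c d | .ite _ c d => c.moda ++ d.moda
  | .loop _ c => c.moda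

theorem iter_induction {α : Type*} {f : ℕ → α → α} {n : ℕ} {s : α} (I : ℕ → α → Prop)
    (h0 : I 0 s) (hs : ∀ j s, j < n → I j s → I (j + 1) (f j s)) : I n (iter f n s) := by
  have : ∀ m ≤ n, I m (iter f m s) := by
    intro m
    induction m with
    | zero => intro _; exact h0
    | succ m ih => intro hm; exact hs m _ (by omega) (ih (by omega))
  exact this n le_rfl

theorem Cmd.den_v (x : List Letter) {i : Var} (c : Cmd) (h : i ∉ c.modv) :
    ∀ (β : List ℕ) (s : State), (c.den x β s).v i = s.v i := by
  induction c with
  | skip => intro β s; rfl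
  | setv k e =>
    intro β s
    simp only [modv, List.mem_singleton] at h
    simp [den, State.setv, Function.update_of_ne h]
  | seta b e f => intro β s; rfl
  | seq c d ihc ihd =>
    intro β s
    simp only [modv, List.mem_append, not_or] at h
    simp only [den]; rw [ihd h.2, ihc h.1]
  | ite e c d ihc ihd =>
    intro β s
    simp only [modv, List.mem_append, not_or] at h
    simp only [den]; split
    · exact ihc h.1 _ _
    · exact ihd h.2 _ _
  | loop k c ih =>
    intro β s
    simp only [den]
    refine iter_induction (fun _ (s' : State) => s'.v i = s.v i) rfl ?_
    intro j s' _ hs'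
    rw [ih h, hs']

theorem Cmd.den_a (x : List Letter) {b : Arr} (c : Cmd) (h : b ∉ c.moda) :
    ∀ (β : List ℕ) (s : State), (c.den x β s).a b = s.a b := by
  induction c with
  | skip => intro β s; rfl
  | setv k e => intro β s; rfl
  | seta b' e f =>
    intro β s
    simp only [moda, List.mem_singleton] at h
    simp [den, State.seta, Function.update_of_ne h]
  | seq c d ihc ihd =>
    intro β s
    simp only [moda, List.mem_append, not_or] at h
    simp only [den]; rw [ihd h.2, ihc h.1]
  | ite e c d ihc ihd =>
    intro β s
    simp only [moda, List.mem_append, not_or] at h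
    simp only [den]; split
    · exact ihc h.1 _ _
    · exact ihd h.2 _ _
  | loop k c ih =>
    intro β s
    simp only [den]
    refine iter_induction (fun _ (s' : State) => s'.a b = s.a b) rfl ?_
    intro j s' _ hs'
    rw [ih h, hs']

/-! ### Compilation -/

/-- The register of the `d`-th intermediate value of an expression. -/
def tmp (d : ℕ) : ℕ := 16 * d
/-- The register of the counter at nesting depth `l`. -/
def ctr (l : ℕ) : ℕ := 16 * l + 1
/-- The register of a scalar variable. -/
def sreg (i : Var) : ℕ := 16 * i.idx + 2
/-- The register of an array cell. -/
def areg (b : Arr) (i : ℕ) : ℕ := 16 * i + (3 + b.idx)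

/-- Code that replaces the index in `tmp d` by the register of that cell of the array `b`. -/
def addrCode (b : Arr) (d : ℕ) : List Instr :=
  [.add (tmp d) (tmp d) (tmp d), .add (tmp d) (tmp d) (tmp d), .add (tmp d) (tmp d) (tmp d),
    .add (tmp d) (tmp d) (tmp d), .const (tmp (d + 1)) (3 + b.idx),
    .add (tmp d) (tmp d) (tmp (d + 1))]

/-- The number of instructions of `Ex.code`. -/
def Ex.len : Ex → ℕ
  | .num _ | .bv _ | .sv _ => 1
  | .arr _ e => e.len + 7
  | .inp e => e.len + 1
  | .add e f | .sub e f => e.len + (f.len + 1)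
  | .all _ e => 4 + (e.len + 5)

/-- Code that writes the value of an expression to `tmp d`. It begins at line `o`, it is nested in
`l` loops, and it uses no intermediate values below `d`. -/
def Ex.code : Ex → (d l o : ℕ) → List Instr
  | .num k, d, _, _ => [.const (tmp d) k]
  | .bv i, d, l, _ => [if i < l then .copy (tmp d) (ctr (l - 1 - i)) else .const (tmp d) 0]
  | .sv i, d, _, _ => [.copy (tmp d) (sreg i)]
  | .arr b e, d, l, o => e.code d l o ++ (addrCode b d ++ [.load (tmp d) (tmp d)])
  | .inp e, d, l, o => e.code d l o ++ [.read (tmp d) (tmp d)]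
  | .add e f, d, l, o =>
    e.code d l o ++ (f.code (d + 1) l (o + e.len) ++ [.add (tmp d) (tmp d) (tmp (d + 1))])
  | .sub e f, d, l, o =>
    e.code d l o ++ (f.code (d + 1) l (o + e.len) ++ [.sub (tmp d) (tmp d) (tmp (d + 1))])
  | .all i e, d, l, o =>
    [.const (tmp d) 1, .const (ctr l) 0, .sub (tmp (d + 1)) (sreg i) (ctr l),
      .jumpZero (tmp (d + 1)) (o + (4 + (e.len + 5)))] ++ (e.code (d + 1) (l + 1) (o + 4) ++
    [.const (tmp (d + 2)) 1, .sub (tmp (d + 1)) (tmp (d + 2)) (tmp (d + 1)),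
      .sub (tmp d) (tmp d) (tmp (d + 1)), .add (ctr l) (ctr l) (tmp (d + 2)), .jump (o + 2)])

theorem Ex.length_code (e : Ex) : ∀ d l o, (e.code d l o).length = e.len := by
  induction e <;> intro d l o <;> simp [code, len, addrCode, *]; omega

/-- A bound for the time to evaluate an expression, if the bounds of its quantifications are at
most `N`. -/
def Ex.cost (N : ℕ) : Ex → ℕ
  | .num _ | .bv _ | .sv _ => 1
  | .arr _ e => e.cost N + 7
  | .inp e => e.cost N + 1
  | .add e f | .sub e f => e.cost N + (f.cost N + 1)
  | .all _ e => N * (e.cost N + 7) + 4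

/-- The registers `ρ` represent the state `s` and the counters `β`. -/
structure Rep (s : State) (β : List ℕ) (ρ : ℕ → ℕ) : Prop where
  sv : ∀ i, ρ (sreg i) = s.v i
  ar : ∀ b i, ρ (areg b i) = s.a b i
  ct : ∀ i < β.length, ρ (ctr (β.length - 1 - i)) = β.getD i 0

/-- The registers `ρ` and `ρ'` differ only in intermediate values from `d` on and in counters from
depth `l` on. -/
def Same (d l : ℕ) (ρ ρ' : ℕ → ℕ) : Prop :=
  ∀ i, ¬ (i % 16 = 0 ∧ 16 * d ≤ i) → ¬ (i % 16 = 1 ∧ 16 * l + 1 ≤ i) → ρ' i = ρ i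

theorem Same.refl (d l : ℕ) (ρ : ℕ → ℕ) : Same d l ρ ρ := fun _ _ _ => rfl

theorem Same.trans {d l d' l' : ℕ} {ρ ρ' ρ'' : ℕ → ℕ} (h : Same d l ρ ρ') (h' : Same d' l' ρ' ρ'')
    (hd : d ≤ d') (hl : l ≤ l') : Same d l ρ ρ'' := by
  intro i h1 h2
  rw [h' i (by omega) (by omega), h i h1 h2]

theorem Same.update_tmp {d l d' w : ℕ} {ρ ρ' : ℕ → ℕ} (h : Same d l ρ ρ') (hd : d ≤ d') :
    Same d l ρ (Function.update ρ' (tmp d') w) := by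
  intro i h1 h2
  rw [Function.update_of_ne (by unfold tmp; omega), h i h1 h2]

theorem Same.update_ctr {d l l' w : ℕ} {ρ ρ' : ℕ → ℕ} (h : Same d l ρ ρ') (hl : l ≤ l') :
    Same d l ρ (Function.update ρ' (ctr l') w) := by
  intro i h1 h2
  rw [Function.update_of_ne (by unfold ctr; omega), h i h1 h2]

theorem Same.tmp {d l k : ℕ} {ρ ρ' : ℕ → ℕ} (h : Same d l ρ ρ') (hk : k < d) :
    ρ' (tmp k) = ρ (tmp k) := by
  apply h <;> (unfold PosetMC.tmp; omega)

theorem Same.ctr {d l k : ℕ} {ρ ρ' : ℕ → ℕ} (h : Same d l ρ ρ') (hk : k < l) :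
    ρ' (ctr k) = ρ (ctr k) := by
  apply h <;> (unfold PosetMC.ctr; omega)

theorem Same.sreg {d l : ℕ} {k : Var} {ρ ρ' : ℕ → ℕ} (h : Same d l ρ ρ') :
    ρ' (sreg k) = ρ (sreg k) := by
  apply h <;> (unfold PosetMC.sreg; omega)

theorem Same.rep {d : ℕ} {s : State} {β : List ℕ} {ρ ρ' : ℕ → ℕ}
    (h : Same d β.length ρ ρ') (hR : Rep s β ρ) : Rep s β ρ' where
  sv i := by rw [h.sreg, hR.sv]
  ar b i := by
    have := b.idx_lt
    rw [h _ (by unfold areg; omega) (by unfold areg; omega), hR.ar]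
  ct i hi := by rw [h.ctr (by omega), hR.ct i hi]

theorem Rep.cons {s : State} {β : List ℕ} {ρ : ℕ → ℕ} (h : Rep s β ρ) {j : ℕ}
    (hj : ρ (ctr β.length) = j) : Rep s (j :: β) ρ where
  sv := h.sv
  ar := h.ar
  ct i hi := by
    cases i with
    | zero => simpa using hj
    | succ i =>
      simp only [List.length_cons] at hi ⊢
      rw [show β.length + 1 - 1 - (i + 1) = β.length - 1 - i by omega, h.ct i (by omega)]
      simp

theorem tmp_inj {d d' : ℕ} : tmp d = tmp d' ↔ d = d' := by unfold tmp; omega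
theorem tmp_ne_ctr {d d' : ℕ} : tmp d ≠ ctr d' := by unfold tmp ctr; omega
theorem ctr_ne_tmp {d d' : ℕ} : ctr d ≠ tmp d' := by unfold tmp ctr; omega
theorem tmp_ne_sreg {d : ℕ} {d' : Var} : tmp d ≠ sreg d' := by unfold tmp sreg; omega
theorem sreg_ne_tmp {d : Var} {d' : ℕ} : sreg d ≠ tmp d' := by unfold tmp sreg; omega
theorem ctr_ne_sreg {d : ℕ} {d' : Var} : ctr d ≠ sreg d' := by unfold ctr sreg; omega

theorem addrCode_spec {M : Program} {x : List Letter} {b : Arr} {d o l : ℕ} {ρ : ℕ → ℕ}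
    (hc : CodeAt M o (addrCode b d)) :
    ∃ ρ', ReachesIn M x ⟨o, ρ⟩ ⟨o + 6, ρ'⟩ 6 ∧ ρ' (tmp d) = areg b (ρ (tmp d)) ∧
      Same d l ρ ρ' := by
  simp only [addrCode, codeAt_cons] at hc
  obtain ⟨h1, h2, h3, h4, h5, h6, -⟩ := hc
  refine ⟨_, .head h1 (.head h2 (.head h3 (.head h4 (.head h5 (.head h6 (.refl _ 0) le_rfl)
    le_rfl) le_rfl) le_rfl) le_rfl) le_rfl, ?_, ?_⟩
  · simp [Instr.exec, Config.write, tmp_inj, areg]; omega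
  · simp only [Instr.exec, Config.write]
    exact (((((Same.refl _ _ _).update_tmp le_rfl).update_tmp le_rfl).update_tmp
      le_rfl).update_tmp le_rfl).update_tmp (Nat.le_succ d) |>.update_tmp le_rfl

theorem Ex.code_spec {M : Program} {x : List Letter} {s : State} {N : ℕ} (e : Ex) :
    ∀ {d o : ℕ} {β : List ℕ} {ρ : ℕ → ℕ}, CodeAt M o (e.code d β.length o) → Rep s β ρ →
      (∀ i ∈ e.bnd, s.v i ≤ N) →
      ∃ ρ', ReachesIn M x ⟨o, ρ⟩ ⟨o + e.len, ρ'⟩ (e.cost N) ∧ ρ' (tmp d) = e.eval x s β ∧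
        Same d β.length ρ ρ' := by
  induction e with
  | num k =>
    intro d o β ρ hc hR hN
    simp only [code, codeAt_cons] at hc
    exact ⟨_, .head hc.1 (.refl _ 0) le_rfl, by simp [eval],
      (Same.refl _ _ _).update_tmp le_rfl⟩
  | bv i =>
    intro d o β ρ hc hR hN
    simp only [code, codeAt_cons] at hc
    refine ⟨Function.update ρ (tmp d) (β.getD i 0), .head hc.1 ?_ le_rfl, by simp [eval],
      (Same.refl _ _ _).update_tmp le_rfl⟩
    have : β.getD i 0 = if i < β.length then ρ (ctr (β.length - 1 - i)) else 0 := by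
      split
      · rw [hR.ct i ‹_›]
      · simp only [List.getD_eq_getElem?_getD]; rw [List.getElem?_eq_none (by omega)]; rfl
    rw [this]
    split <;> exact .refl _ 0
  | sv i =>
    intro d o β ρ hc hR hN
    simp only [code, codeAt_cons] at hc
    exact ⟨_, .head hc.1 (.refl _ 0) le_rfl, by simp [eval, hR.sv],
      (Same.refl _ _ _).update_tmp le_rfl⟩
  | arr b e ih =>
    intro d o β ρ hc hR hN
    simp only [code, codeAt_append, Ex.length_code] at hc
    obtain ⟨hc1, hc2, hc3⟩ := hc
    obtain ⟨ρ1, r1, v1, s1⟩ := ih hc1 hR hN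
    obtain ⟨ρ2, r2, v2, s2⟩ := addrCode_spec (x := x) (l := β.length) (ρ := ρ1) hc2
    simp only [addrCode, List.length_cons, List.length_nil, codeAt_cons] at hc3
    have s12 := s1.trans s2 le_rfl le_rfl
    refine ⟨_, r1.trans (r2.trans (.head hc3.1 (.refl _ 0) le_rfl) le_rfl) le_rfl, ?_,
      s12.update_tmp le_rfl⟩
    simp [eval, v2, v1, (s12.rep hR).ar]
  | inp e ih =>
    intro d o β ρ hc hR hN
    simp only [code, codeAt_append, Ex.length_code, codeAt_cons] at hc
    obtain ⟨hc1, hc2, -⟩ := hc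
    obtain ⟨ρ1, r1, v1, s1⟩ := ih hc1 hR hN
    refine ⟨_, r1.trans (.head hc2 (.refl _ 0) le_rfl) le_rfl, ?_, s1.update_tmp le_rfl⟩
    simp [eval, v1, letterAt]
  | add e f ihe ihf =>
    intro d o β ρ hc hR hN
    simp only [code, codeAt_append, Ex.length_code, codeAt_cons] at hc
    obtain ⟨hc1, hc2, hc3, -⟩ := hc
    simp only [bnd, List.mem_append] at hN
    obtain ⟨ρ1, r1, v1, s1⟩ := ihe hc1 hR fun i hi => hN i (.inl hi)
    obtain ⟨ρ2, r2, v2, s2⟩ := ihf hc2 (s1.rep hR) fun i hi => hN i (.inr hi)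
    refine ⟨_, r1.trans (r2.trans (.head hc3 (.of_eq (by simp only [len]; omega) 0) le_rfl)
      le_rfl) le_rfl, ?_,
      (s1.trans s2 (Nat.le_succ d) le_rfl).update_tmp le_rfl⟩
    simp [eval, v2, ← v1, s2.tmp (Nat.lt_succ_self d)]
  | sub e f ihe ihf =>
    intro d o β ρ hc hR hN
    simp only [code, codeAt_append, Ex.length_code, codeAt_cons] at hc
    obtain ⟨hc1, hc2, hc3, -⟩ := hc
    simp only [bnd, List.mem_append] at hN
    obtain ⟨ρ1, r1, v1, s1⟩ := ihe hc1 hR fun i hi => hN i (.inl hi)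
    obtain ⟨ρ2, r2, v2, s2⟩ := ihf hc2 (s1.rep hR) fun i hi => hN i (.inr hi)
    refine ⟨_, r1.trans (r2.trans (.head hc3 (.of_eq (by simp only [len]; omega) 0) le_rfl)
      le_rfl) le_rfl, ?_,
      (s1.trans s2 (Nat.le_succ d) le_rfl).update_tmp le_rfl⟩
    simp [eval, v2, ← v1, s2.tmp (Nat.lt_succ_self d)]
  | all i e ih =>
    intro d o β ρ hc hR hN
    simp only [code, codeAt_append, Ex.length_code, codeAt_cons, List.length_cons,
      List.length_nil] at hc
    obtain ⟨⟨h1, h2, h3, h4, -⟩, h5, h6, h7, h8, h9, h10, -⟩ := hc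
    simp only [bnd, List.mem_cons, forall_eq_or_imp] at hN
    -- the loop, entered when `j` values of the counter are done and `k` are left
    have loop : ∀ (k j : ℕ) (ρ' : ℕ → ℕ), j + k = s.v i → Same d β.length ρ ρ' →
        ρ' (ctr β.length) = j →
        ρ' (tmp d) = (if ∀ a < j, e.eval x s (a :: β) ≠ 0 then 1 else 0) →
        ∃ ρ'', ReachesIn M x ⟨o + 2, ρ'⟩ ⟨o + (4 + (e.len + 5)), ρ''⟩
          (k * (e.cost N + 7) + 2) ∧
          ρ'' (tmp d) = (if ∀ a < s.v i, e.eval x s (a :: β) ≠ 0 then 1 else 0) ∧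
          Same d β.length ρ ρ'' := by
      intro k
      induction k with
      | zero =>
        intro j ρ' hj hS hct hv
        obtain rfl : j = s.v i := by omega
        exact ⟨Function.update ρ' (tmp (d + 1)) 0, .test h3 h4
          (by rw [hS.sreg, hct, hR.sv, Nat.sub_self]) (.of_eq (if_pos rfl) 0) (by omega),
          by simp [tmp_inj, hv], hS.update_tmp (Nat.le_succ d)⟩
      | succ k ihk =>
        intro j ρ' hj hS hct hv
        have hS1 : Same d β.length ρ (Function.update ρ' (tmp (d + 1)) (k + 1)) :=
          hS.update_tmp (Nat.le_succ d)
        obtain ⟨ρ1, r1, v1, s1⟩ := ih (β := j :: β) h5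
          ((hS1.rep hR).cons (by simpa [ctr_ne_tmp] using hct)) hN.2
        have hct1 : ρ1 (ctr β.length) = j := by
          rw [s1.ctr (by simp)]; simpa [ctr_ne_tmp] using hct
        have hv1 := s1.tmp (Nat.lt_succ_self d)
        simp only [Function.update_of_ne (tmp_inj.not.2 (Nat.succ_ne_self d).symm)] at hv1
        obtain ⟨ρ2, r2, v2, s2⟩ := ihk (j + 1)
          (Function.update (Function.update (Function.update (Function.update ρ1
            (tmp (d + 2)) 1) (tmp (d + 1)) (1 - ρ1 (tmp (d + 1))))
            (tmp d) (ρ1 (tmp d) - (1 - ρ1 (tmp (d + 1))))) (ctr β.length) (j + 1)) (by omega)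
          (((((hS1.trans s1 (Nat.le_succ d) (by simp)).update_tmp (by omega)).update_tmp
            (by omega)).update_tmp le_rfl).update_ctr le_rfl) (by simp) (by
            simp only [Function.update_of_ne tmp_ne_ctr, Function.update_self, hv1, hv, v1,
              Nat.lt_succ_iff_lt_or_eq, or_imp, forall_and, forall_eq]
            split_ifs <;> simp_all; omega)
        refine ⟨ρ2, .test h3 h4 (w := k + 1) (by rw [hS.sreg, hct, hR.sv]; omega)
          (T := e.cost N + (k * (e.cost N + 7) + 2 + 5)) ?_ (by rw [Nat.succ_mul]; omega), v2, s2⟩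
        rw [if_neg (Nat.succ_ne_zero k)]
        refine r1.trans (.head h6 (.head h7 (.head h8 (.head h9 (.head h10 ?_ le_rfl) le_rfl)
          le_rfl) le_rfl) le_rfl) (T' := k * (e.cost N + 7) + 2 + 5) (by omega)
        simpa [Instr.exec, Config.write, tmp_inj, tmp_ne_ctr, ctr_ne_tmp, hct1] using r2
    obtain ⟨ρ', r, v, S⟩ := loop (s.v i) 0
      (Function.update (Function.update ρ (tmp d) 1) (ctr β.length) 0) (by omega)
      (((Same.refl _ _ _).update_tmp le_rfl).update_ctr le_rfl) (by simp)
      (by simp [tmp_ne_ctr])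
    refine ⟨ρ', .head h1 (.head h2 r le_rfl) ?_, v, S⟩
    have := Nat.mul_le_mul_right (e.cost N + 7) hN.1
    simp only [cost]; omega

/-- The number of instructions of `Cmd.code`. -/
def Cmd.len : Cmd → ℕ
  | .skip => 0
  | .setv _ e => e.len + 1
  | .seta _ e f => e.len + (6 + (f.len + 1))
  | .seq c d => c.len + d.len
  | .ite e c d => e.len + (1 + (c.len + (1 + d.len)))
  | .loop _ c => 3 + (c.len + 3)

/-- Code for a command that is nested in `l` loops, beginning at line `o`. -/
def Cmd.code : Cmd → (l o : ℕ) → List Instr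
  | .skip, _, _ => []
  | .setv i e, l, o => e.code 0 l o ++ [.copy (sreg i) (tmp 0)]
  | .seta b e f, l, o =>
    e.code 0 l o ++ (addrCode b 0 ++ (f.code 1 l (o + e.len + 6) ++ [.store (tmp 0) (tmp 1)]))
  | .seq c d, l, o => c.code l o ++ d.code l (o + c.len)
  | .ite e c d, l, o =>
    e.code 0 l o ++ ([.jumpZero (tmp 0) (o + e.len + 1 + c.len + 1)] ++
      (c.code l (o + e.len + 1) ++ ([.jump (o + e.len + 1 + c.len + 1 + d.len)] ++
        d.code l (o + e.len + 1 + c.len + 1))))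
  | .loop i c, l, o =>
    [.const (ctr l) 0, .sub (tmp 0) (sreg i) (ctr l), .jumpZero (tmp 0) (o + (3 + (c.len + 3)))] ++
      (c.code (l + 1) (o + 3) ++
        [.const (tmp 0) 1, .add (ctr l) (ctr l) (tmp 0), .jump (o + 1)])

theorem Cmd.length_code (c : Cmd) : ∀ l o, (c.code l o).length = c.len := by
  induction c <;> intro l o <;> simp [code, len, addrCode, Ex.length_code, *] <;> omega

/-- A bound for the time to execute a command, if the bounds of its loops and quantifications are at
most `N`. -/
def Cmd.cost (N : ℕ) : Cmd → ℕ
  | .skip => 0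
  | .setv _ e => e.cost N + 1
  | .seta _ e f => e.cost N + (6 + (f.cost N + 1))
  | .seq c d => c.cost N + d.cost N
  | .ite e c d => e.cost N + (1 + (c.cost N + (1 + d.cost N)))
  | .loop _ c => N * (c.cost N + 5) + 3

theorem Ex.exists_cost_le (e : Ex) : ∃ K D : ℕ, ∀ N, e.cost N ≤ K * (N + 1) ^ D := by
  induction e with
  | num | bv | sv => exact ⟨1, 0, fun N => by simp [cost]⟩
  | arr b e ih | inp e ih =>
    obtain ⟨K, D, h⟩ := ih
    refine ⟨K + 7, D, fun N => ?_⟩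
    have := Nat.one_le_pow D (N + 1) (Nat.succ_pos N)
    have := h N
    simp only [cost]; nlinarith
  | add e f ihe ihf | sub e f ihe ihf =>
    obtain ⟨K, D, h⟩ := ihe
    obtain ⟨K', D', h'⟩ := ihf
    refine ⟨K + K' + 1, D + D', fun N => ?_⟩
    have h1 := Nat.one_le_pow D (N + 1) (Nat.succ_pos N)
    have h2 := Nat.one_le_pow D' (N + 1) (Nat.succ_pos N)
    have h3 := (h N).trans (Nat.mul_le_mul_left K (Nat.le_mul_of_pos_right ((N + 1) ^ D) h2))
    have h4 := (h' N).trans (Nat.mul_le_mul_left K' (Nat.le_mul_of_pos_left ((N + 1) ^ D') h1))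
    have h5 := Nat.mul_pos h1 h2
    simp only [cost, pow_add, add_mul, one_mul]; omega
  | all i e ih =>
    obtain ⟨K, D, h⟩ := ih
    refine ⟨K + 11, D + 1, fun N => ?_⟩
    have h1 := Nat.one_le_pow D (N + 1) (Nat.succ_pos N)
    have h2 := Nat.mul_le_mul_left N (h N)
    simp only [cost, pow_succ]; nlinarith

theorem Cmd.exists_cost_le (c : Cmd) : ∃ K D : ℕ, ∀ N, c.cost N ≤ K * (N + 1) ^ D := by
  induction c with
  | skip => exact ⟨0, 0, fun N => by simp [cost]⟩
  | setv i e =>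
    obtain ⟨K, D, h⟩ := e.exists_cost_le
    refine ⟨K + 1, D, fun N => ?_⟩
    have := Nat.one_le_pow D (N + 1) (Nat.succ_pos N)
    have := h N
    simp only [cost]; nlinarith
  | seta b e f =>
    obtain ⟨K, D, h⟩ := e.exists_cost_le
    obtain ⟨K', D', h'⟩ := f.exists_cost_le
    refine ⟨K + K' + 7, D + D', fun N => ?_⟩
    have h1 := Nat.one_le_pow D (N + 1) (Nat.succ_pos N)
    have h2 := Nat.one_le_pow D' (N + 1) (Nat.succ_pos N)
    have h3 := (h N).trans (Nat.mul_le_mul_left K (Nat.le_mul_of_pos_right ((N + 1) ^ D) h2))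
    have h4 := (h' N).trans (Nat.mul_le_mul_left K' (Nat.le_mul_of_pos_left ((N + 1) ^ D') h1))
    have h5 := Nat.mul_pos h1 h2
    simp only [cost, pow_add, add_mul]; omega
  | seq c d ihc ihd =>
    obtain ⟨K, D, h⟩ := ihc
    obtain ⟨K', D', h'⟩ := ihd
    refine ⟨K + K', D + D', fun N => ?_⟩
    have h1 := Nat.one_le_pow D (N + 1) (Nat.succ_pos N)
    have h2 := Nat.one_le_pow D' (N + 1) (Nat.succ_pos N)
    have h3 := (h N).trans (Nat.mul_le_mul_left K (Nat.le_mul_of_pos_right ((N + 1) ^ D) h2))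
    have h4 := (h' N).trans (Nat.mul_le_mul_left K' (Nat.le_mul_of_pos_left ((N + 1) ^ D') h1))
    simp only [cost, pow_add, add_mul]; omega
  | ite e c d ihc ihd =>
    obtain ⟨K, D, h⟩ := ihc
    obtain ⟨K', D', h'⟩ := ihd
    obtain ⟨K'', D'', h''⟩ := e.exists_cost_le
    refine ⟨K'' + K + K' + 2, D + D' + D'', fun N => ?_⟩
    have h1 := Nat.one_le_pow D (N + 1) (Nat.succ_pos N)
    have h2 := Nat.one_le_pow D' (N + 1) (Nat.succ_pos N)
    have h2' := Nat.one_le_pow D'' (N + 1) (Nat.succ_pos N)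
    have e1 : (N + 1) ^ D ≤ (N + 1) ^ (D + D' + D'') :=
      Nat.pow_le_pow_right (Nat.succ_pos N) (by omega)
    have e2 : (N + 1) ^ D' ≤ (N + 1) ^ (D + D' + D'') :=
      Nat.pow_le_pow_right (Nat.succ_pos N) (by omega)
    have e3 : (N + 1) ^ D'' ≤ (N + 1) ^ (D + D' + D'') :=
      Nat.pow_le_pow_right (Nat.succ_pos N) (by omega)
    have h3 := (h N).trans (Nat.mul_le_mul_left K e1)
    have h4 := (h' N).trans (Nat.mul_le_mul_left K' e2)
    have h5 := (h'' N).trans (Nat.mul_le_mul_left K'' e3)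
    simp only [cost, add_mul]; omega
  | loop i c ih =>
    obtain ⟨K, D, h⟩ := ih
    refine ⟨K + 8, D + 1, fun N => ?_⟩
    have h1 := Nat.one_le_pow D (N + 1) (Nat.succ_pos N)
    have h2 := Nat.mul_le_mul_left N (h N)
    simp only [cost, pow_succ]; nlinarith

theorem sreg_inj {i i' : Var} : sreg i = sreg i' ↔ i = i' :=
  ⟨fun h => Var.idx_inj (by unfold sreg at h; omega), fun h => h ▸ rfl⟩

theorem areg_ne_sreg {b : Arr} {i : ℕ} {i' : Var} : areg b i ≠ sreg i' := by
  have := b.idx_lt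
  unfold areg sreg; omega

theorem areg_ne_ctr {b : Arr} {i d : ℕ} : areg b i ≠ ctr d := by
  have := b.idx_lt
  unfold areg ctr; omega

theorem areg_inj {b b' : Arr} {i i' : ℕ} : areg b i = areg b' i' ↔ b = b' ∧ i = i' := by
  have := b.idx_lt
  have := b'.idx_lt
  refine ⟨fun h => ?_, fun h => h.1 ▸ h.2 ▸ rfl⟩
  unfold areg at h
  exact ⟨Arr.idx_inj (by omega), by omega⟩

theorem Rep.setv {s : State} {β : List ℕ} {ρ : ℕ → ℕ} (h : Rep s β ρ) (i : Var) (w : ℕ) :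
    Rep (s.setv i w) β (Function.update ρ (sreg i) w) where
  sv j := by
    by_cases hj : j = i
    · simp [hj, State.setv]
    · simp [State.setv, hj, sreg_inj, h.sv]
  ar b j := by simp [State.setv, areg_ne_sreg, h.ar]
  ct j hj := by rw [Function.update_of_ne ctr_ne_sreg, h.ct j hj]

theorem Rep.seta {s : State} {β : List ℕ} {ρ : ℕ → ℕ} (h : Rep s β ρ) (b : Arr) (i w : ℕ) :
    Rep (s.seta b i w) β (Function.update ρ (areg b i) w) where
  sv j := by simp [State.seta, areg_ne_sreg.symm, h.sv]
  ar b' j := by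
    by_cases hb : b' = b
    · subst hb
      by_cases hj : j = i
      · simp [hj, State.seta]
      · simp [State.seta, hj, areg_inj, h.ar]
    · simp [State.seta, hb, areg_inj, h.ar]
  ct j hj := by rw [Function.update_of_ne areg_ne_ctr.symm, h.ct j hj]

theorem Rep.of_cons {s : State} {β : List ℕ} {ρ : ℕ → ℕ} {j : ℕ} (h : Rep s (j :: β) ρ) :
    Rep s β ρ where
  sv := h.sv
  ar := h.ar
  ct i hi := by
    have := h.ct (i + 1) (by simpa using hi)
    simp only [List.length_cons, List.getD_cons_succ] at this
    rwa [show β.length + 1 - 1 - (i + 1) = β.length - 1 - i by omega] at this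

theorem Rep.ctr_eq {s : State} {β : List ℕ} {ρ : ℕ → ℕ} {j : ℕ} (h : Rep s (j :: β) ρ) :
    ρ (ctr β.length) = j := by
  simpa using h.ct 0 (by simp)

theorem Rep.update_tmp {s : State} {β : List ℕ} {ρ : ℕ → ℕ} (h : Rep s β ρ) (d w : ℕ) :
    Rep s β (Function.update ρ (tmp d) w) :=
  ((Same.refl d β.length ρ).update_tmp le_rfl).rep h

theorem Rep.update_ctr {s : State} {β : List ℕ} {ρ : ℕ → ℕ} (h : Rep s β ρ) (w : ℕ) :
    Rep s β (Function.update ρ (ctr β.length) w) :=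
  ((Same.refl 0 β.length ρ).update_ctr le_rfl).rep h

/-- The code of a command computes its effect, within the time bound `Cmd.cost`, provided that the
command does not assign to the variables that bound its loops. -/
theorem Cmd.code_spec {M : Program} {x : List Letter} {N : ℕ} (c : Cmd) :
    ∀ {o : ℕ} {β : List ℕ} {ρ : ℕ → ℕ} {s : State}, CodeAt M o (c.code β.length o) → Rep s β ρ →
      (∀ i ∈ c.bnd, i ∉ c.modv) → (∀ i ∈ c.bnd, s.v i ≤ N) →
      ∃ ρ', ReachesIn M x ⟨o, ρ⟩ ⟨o + c.len, ρ'⟩ (c.cost N) ∧ Rep (c.den x β s) β ρ' := by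
  induction c with
  | skip => intro o β ρ s _ hR _ _; exact ⟨ρ, .refl _ _, hR⟩
  | setv i e =>
    intro o β ρ s hc hR hm hN
    simp only [code, codeAt_append, Ex.length_code, codeAt_cons] at hc
    obtain ⟨hc1, hc2, -⟩ := hc
    obtain ⟨ρ1, r1, v1, s1⟩ := e.code_spec hc1 hR hN
    refine ⟨_, r1.trans (.head hc2 (.refl _ 0) le_rfl) le_rfl, ?_⟩
    have := (s1.rep hR).setv i (e.eval x s β)
    simpa only [den, v1] using this
  | seta b e f =>
    intro o β ρ s hc hR hm hN
    simp only [code, codeAt_append, Ex.length_code, codeAt_cons] at hc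
    obtain ⟨hc1, hc2, hc3, hc4, -⟩ := hc
    simp only [bnd, List.mem_append] at hN
    obtain ⟨ρ1, r1, v1, s1⟩ := e.code_spec hc1 hR fun i hi => hN i (.inl hi)
    obtain ⟨ρ2, r2, v2, s2⟩ := addrCode_spec (x := x) (l := β.length) (ρ := ρ1) hc2
    have s12 := s1.trans s2 le_rfl le_rfl
    obtain ⟨ρ3, r3, v3, s3⟩ := f.code_spec hc3 (s12.rep hR) fun i hi => hN i (.inr hi)
    refine ⟨_, r1.trans (r2.trans (r3.trans (.head hc4 (.of_eq ?_ 0) le_rfl)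
      le_rfl) le_rfl) le_rfl, ?_⟩
    · simp only [len, addrCode, List.length_cons, List.length_nil]; omega
    · have := ((s12.trans s3 (Nat.zero_le 1) le_rfl).rep hR).seta b (e.eval x s β) (f.eval x s β)
      simpa only [den, s3.tmp Nat.zero_lt_one, v2, v1, v3] using this
  | seq c d ihc ihd =>
    intro o β ρ s hc hR hm hN
    simp only [code, codeAt_append, Cmd.length_code] at hc
    obtain ⟨hc1, hc2⟩ := hc
    simp only [bnd, modv, List.mem_append, not_or] at hN hm
    obtain ⟨ρ1, r1, R1⟩ := ihc hc1 hR (fun i hi => (hm i (.inl hi)).1) fun i hi => hN i (.inl hi)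
    obtain ⟨ρ2, r2, R2⟩ := ihd hc2 R1 (fun i hi => (hm i (.inr hi)).2) fun i hi => by
      rw [Cmd.den_v x c (hm i (.inr hi)).1]; exact hN i (.inr hi)
    exact ⟨ρ2, r1.trans (r2.trans (.of_eq (by simp only [len]; omega) 0) le_rfl) le_rfl, R2⟩
  | ite e c d ihc ihd =>
    intro o β ρ s hc hR hm hN
    simp only [code, codeAt_append, Cmd.length_code, Ex.length_code, codeAt_cons,
      List.length_cons, List.length_nil, Nat.zero_add] at hc
    obtain ⟨hc1, ⟨hc2, -⟩, hc3, ⟨hc4, -⟩, hc5⟩ := hc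
    simp only [bnd, modv, List.mem_append, not_or] at hN hm
    obtain ⟨ρ1, r1, v1, s1⟩ := e.code_spec hc1 hR fun i hi => hN i (.inl hi)
    by_cases he : e.eval x s β = 0
    · obtain ⟨ρ2, r2, R2⟩ := ihd hc5 (s1.rep hR) (fun i hi => (hm i (.inr (.inr hi))).2)
        fun i hi => hN i (.inr (.inr hi))
      refine ⟨ρ2, r1.trans (.head hc2 (T := d.cost N) ?_ (by omega)) (T' := d.cost N + 1)
        (by simp only [cost]; omega), ?_⟩
      · simp only [Instr.exec, v1, he, if_true]
        exact r2.trans (.of_eq (by simp only [len]; omega) 0) le_rfl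
      · simpa [den, he] using R2
    · obtain ⟨ρ2, r2, R2⟩ := ihc hc3 (s1.rep hR) (fun i hi => (hm i (.inr (.inl hi))).1)
        fun i hi => hN i (.inr (.inl hi))
      refine ⟨ρ2, r1.trans (.head hc2 (T := c.cost N + 1) ?_ (by omega)) (T' := c.cost N + 2)
        (by simp only [cost]; omega), ?_⟩
      · simp only [Instr.exec, v1, he, if_false]
        exact r2.trans (.head hc4 (.of_eq (by simp only [len]; omega) 0) le_rfl) le_rfl
      · simpa [den, he] using R2
  | loop i c ih =>
    intro o β ρ s hc hR hm hN
    simp only [code, codeAt_append, Cmd.length_code, codeAt_cons, List.length_cons,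
      List.length_nil] at hc
    obtain ⟨⟨h1, h2, h3, -⟩, h4, h5, h6, h7, -⟩ := hc
    simp only [bnd, modv, List.mem_cons, forall_eq_or_imp] at hN hm
    -- the loop, entered when `j` rounds are done and `k` are left
    have loop : ∀ (k j : ℕ) (ρ' : ℕ → ℕ), j + k = s.v i →
        Rep (iter (fun j s => c.den x (j :: β) s) j s) (j :: β) ρ' →
        ∃ ρ'', ReachesIn M x ⟨o + 1, ρ'⟩ ⟨o + (3 + (c.len + 3)), ρ''⟩
          (k * (c.cost N + 5) + 2) ∧
          Rep (iter (fun j s => c.den x (j :: β) s) (s.v i) s) β ρ'' := by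
      intro k
      induction k with
      | zero =>
        intro j ρ' hj hR'
        obtain rfl : j = s.v i := by omega
        have hv : (iter (fun j s => c.den x (j :: β) s) (s.v i) s).v i = s.v i :=
          Cmd.den_v x (.loop i c) hm.1 β s
        exact ⟨_, .test h2 h3 (w := 0) (by rw [hR'.ctr_eq, hR'.sv, hv, Nat.sub_self])
          (.of_eq (if_pos rfl) 0) (by omega), hR'.of_cons.update_tmp _ _⟩
      | succ k ihk =>
        intro j ρ' hj hR'
        have hv : ∀ i ∉ c.modv, (iter (fun j s => c.den x (j :: β) s) j s).v i = s.v i :=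
          fun i hi => iter_induction (fun _ (s' : State) => s'.v i = s.v i) rfl
            fun j s' _ hs' => by rw [Cmd.den_v x c hi, hs']
        obtain ⟨ρ1, r1, R1⟩ := ih (β := j :: β) h4 (hR'.update_tmp 0 (k + 1)) hm.2 fun i hi => by
          rw [hv i (hm.2 i hi)]; exact hN.2 i hi
        obtain ⟨ρ2, r2, R2⟩ := ihk (j + 1)
          (Function.update (Function.update ρ1 (tmp 0) 1) (ctr β.length) (j + 1)) (by omega)
          (((R1.of_cons.update_tmp _ _).update_ctr _).cons (by simp))
        refine ⟨ρ2, .test h2 h3 (w := k + 1) (by rw [hR'.ctr_eq, hR'.sv, hv i hm.1]; omega)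
          (T := c.cost N + (k * (c.cost N + 5) + 2 + 3)) ?_ (by rw [Nat.succ_mul]; omega), R2⟩
        rw [if_neg (Nat.succ_ne_zero k)]
        refine r1.trans (.head h5 (.head h6 (.head h7 ?_ le_rfl) le_rfl) le_rfl)
          (T' := k * (c.cost N + 5) + 2 + 3) (by omega)
        simpa [Instr.exec, Config.write, tmp_ne_ctr, ctr_ne_tmp, R1.ctr_eq] using r2
    obtain ⟨ρ', r, R⟩ := loop (s.v i) 0 (Function.update ρ (ctr β.length) 0) (by omega)
      ((hR.update_ctr 0).cons (by simp))
    refine ⟨ρ', .head h1 r ?_, R⟩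
    have := Nat.mul_le_mul_right (c.cost N + 5) hN.1
    simp only [cost]; omega

/-! ### Truth values of expressions -/

namespace Ex

/-- Negation of truth values; every number but `0` counts as true. -/
def not (e : Ex) : Ex := .sub (.num 1) e
/-- Conjunction of truth values. -/
def and (e f : Ex) : Ex := (e.not.add f.not).not
/-- Disjunction of truth values. -/
def or (e f : Ex) : Ex := e.add f
/-- The comparison `e < f`. -/
def lt (e f : Ex) : Ex := .sub f e
/-- The comparison `e = f`. -/
def eq (e f : Ex) : Ex := ((e.lt f).add (f.lt e)).not
/-- Bounded existential quantification. -/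
def ex (i : Var) (e : Ex) : Ex := (Ex.all i e.not).not

/-- An expression is true if its value is not `0`. -/
def True (x : List Letter) (s : State) (β : List ℕ) (e : Ex) : Prop := e.eval x s β ≠ 0

variable {x : List Letter} {s : State} {β : List ℕ} {e f : Ex}

@[simp] theorem true_not : e.not.True x s β ↔ ¬ e.True x s β := by
  simp [True, not, eval]; omega

@[simp] theorem true_or : (e.or f).True x s β ↔ e.True x s β ∨ f.True x s β := by
  simp [True, or, eval]; omega

@[simp] theorem true_and : (e.and f).True x s β ↔ e.True x s β ∧ f.True x s β := by
  simp [True, and, not, eval]; omega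

@[simp] theorem true_lt : (e.lt f).True x s β ↔ e.eval x s β < f.eval x s β := by
  simp [True, lt, eval]; omega

@[simp] theorem true_eq : (e.eq f).True x s β ↔ e.eval x s β = f.eval x s β := by
  simp [True, eq, not, lt, eval]; omega

@[simp] theorem true_all {i : Var} :
    (e.all i).True x s β ↔ ∀ j < s.v i, e.True x s (j :: β) := by
  simp [True, eval]

@[simp] theorem true_ex {i : Var} :
    (e.ex i).True x s β ↔ ∃ j < s.v i, e.True x s (j :: β) := by
  simp [ex]

end Ex

open Function (update update_self update_of_ne)

/-! ### Games of quantifiers -/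

/-- The game in which the elements `g i`, `g (i + 1)`, …, `g (i + j - 1)` are chosen one after
another, those with `kind` from `AU` by an opponent and the others from `AE`, in order to
achieve `M`. -/
def Game {P : Type*} (AU AE : Set P) (kind : ℕ → Prop) (M : (ℕ → P) → Prop) :
    ℕ → ℕ → (ℕ → P) → Prop
  | 0, _, g => M g
  | j + 1, i, g =>
    (kind i → ∀ a ∈ AU, Game AU AE kind M j (i + 1) (update g i a)) ∧
    (¬ kind i → ∃ a ∈ AE, Game AU AE kind M j (i + 1) (update g i a))

section Game

variable {P Q : Type*} {AU AE : Set P} {AU' AE' : Set Q} {kind : ℕ → Prop}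
  {M N : (ℕ → P) → Prop} {M' : (ℕ → Q) → Prop}

/-- A relation between the plays of two games that both players can maintain transfers a winning
strategy. -/
theorem Game.transfer {r : ℕ} (I : ℕ → (ℕ → P) → (ℕ → Q) → Prop)
    (hU : ∀ i g g', i < r → kind i → I i g g' →
      ∀ a' ∈ AU', ∃ a ∈ AU, I (i + 1) (update g i a) (update g' i a'))
    (hE : ∀ i g g', i < r → ¬ kind i → I i g g' →
      ∀ a ∈ AE, ∃ a' ∈ AE', I (i + 1) (update g i a) (update g' i a'))
    (hM : ∀ g g', I r g g' → M g → M' g') :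
    ∀ (j i : ℕ) (g : ℕ → P) (g' : ℕ → Q), i + j = r → I i g g' →
      Game AU AE kind M j i g → Game AU' AE' kind M' j i g' := by
  intro j
  induction j with
  | zero =>
    intro i g g' hi hI h
    obtain rfl : i = r := hi
    exact hM g g' hI h
  | succ j ih =>
    intro i g g' hi hI h
    refine ⟨fun hk a' ha' => ?_, fun hk => ?_⟩
    · obtain ⟨a, ha, hI'⟩ := hU i g g' (by omega) hk hI a' ha'
      exact ih _ _ _ (by omega) hI' (h.1 hk a ha)
    · obtain ⟨a, ha, hG⟩ := h.2 hk
      obtain ⟨a', ha', hI'⟩ := hE i g g' (by omega) hk hI a ha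
      exact ⟨a', ha', ih _ _ _ (by omega) hI' hG⟩

theorem Game.congr_on (S : Set ℕ) (hM : ∀ g g', (∀ t ∈ S, g t = g' t) → M g → M g') :
    ∀ (j i : ℕ) (g g' : ℕ → P), (∀ t ∈ S, g t = g' t) →
      Game AU AE kind M j i g → Game AU AE kind M j i g' := by
  intro j i g g' h
  refine Game.transfer (r := i + j) (fun _ g g' => ∀ t ∈ S, g t = g' t) ?_ ?_ hM j i g g' rfl h
  · intro i g g' _ _ h a ha
    refine ⟨a, ha, fun t ht => ?_⟩
    by_cases hti : t = i <;> simp [hti, h t ht, update]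
  · intro i g g' _ _ h a ha
    refine ⟨a, ha, fun t ht => ?_⟩
    by_cases hti : t = i <;> simp [hti, h t ht, update]

theorem game_congr (h : ∀ g, M g ↔ N g) (j i : ℕ) (g : ℕ → P) :
    Game AU AE kind M j i g ↔ Game AU AE kind N j i g := by
  rw [funext fun g => propext (h g)]

theorem game_append (j j' : ℕ) : ∀ (i : ℕ) (g : ℕ → P),
    Game AU AE kind M (j + j') i g ↔
      Game AU AE kind (fun g => Game AU AE kind M j' (i + j) g) j i g := by
  induction j with
  | zero => intro i g; simp [Game]
  | succ j ih =>
    intro i g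
    rw [show j + 1 + j' = (j + j') + 1 by omega]
    simp only [Game, ih, show i + 1 + j = i + (j + 1) by omega]

/-- A condition that does not depend on the choices moves out of the game. -/
theorem game_and [Nonempty P] (j : ℕ) : ∀ (i : ℕ) (g : ℕ → P),
    (∀ g t a, i ≤ t → t < i + j → (N (update g t a) ↔ N g)) →
    (Game .univ .univ kind (fun g => M g ∧ N g) j i g ↔
      Game .univ .univ kind M j i g ∧ N g) := by
  induction j with
  | zero => intro i g _; rfl
  | succ j ih =>
    intro i g h
    have h' : ∀ a, Game .univ .univ kind (fun g => M g ∧ N g) j (i + 1) (update g i a) ↔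
        Game .univ .univ kind M j (i + 1) (update g i a) ∧ N g := fun a => by
      rw [ih (i + 1) _ fun g t a h1 h2 => h g t a (by omega) (by omega),
        h g i a le_rfl (by omega)]
    by_cases hk : kind i <;> simp [Game, hk, h', forall_and]

theorem game_true [Nonempty P] (j : ℕ) : ∀ (i : ℕ) (g : ℕ → P),
    Game .univ .univ kind (fun _ => True) j i g := by
  induction j with
  | zero => intros; trivial
  | succ j ih =>
    intro i g
    exact ⟨fun _ a _ => ih _ _, fun _ => ⟨Classical.arbitrary P, trivial, ih _ _⟩⟩

/-- In a won game, the opponent may play any sequence of elements. -/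
theorem Game.exists_play (c : ℕ → P) (j : ℕ) : ∀ (i : ℕ) (g : ℕ → P),
    Game .univ AE kind M j i g →
    ∃ g', M g' ∧ (∀ t < i, g' t = g t) ∧ ∀ t, i ≤ t → t < i + j → kind t → g' t = c t := by
  induction j with
  | zero => intro i g h; exact ⟨g, h, fun _ _ => rfl, fun t h1 h2 => by omega⟩
  | succ j ih =>
    intro i g h
    obtain ⟨a, hG, ha⟩ : ∃ a, Game .univ AE kind M j (i + 1) (update g i a) ∧
        (kind i → a = c i) := by
      by_cases hk : kind i
      · exact ⟨c i, h.1 hk _ trivial, fun _ => rfl⟩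
      · obtain ⟨a, -, hG⟩ := h.2 hk
        exact ⟨a, hG, fun h => absurd h hk⟩
    obtain ⟨g', hM, h1, h2⟩ := ih _ _ hG
    refine ⟨g', hM, fun t ht => ?_, fun t ht1 ht2 hk => ?_⟩
    · rw [h1 t (by omega), update_of_ne (by omega)]
    · rcases Nat.eq_or_lt_of_le ht1 with rfl | h
      · rw [h1 i (by omega), update_self, ha hk]
      · exact h2 t h (by omega) hk

/-- In a won game, the opponent may play anything at index `y`, after the earlier choices are
fixed. -/
theorem Game.exists_prefix {y : ℕ} (hy : kind y) (j : ℕ) : ∀ (i : ℕ) (g : ℕ → P),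
    [Nonempty P] → i ≤ y → y < i + j → Game .univ AE kind M j i g →
    ∃ g₀ : ℕ → P, ∀ a, ∃ g', M g' ∧ (∀ t < y, g' t = g₀ t) ∧ g' y = a := by
  induction j with
  | zero => intro i g _ h1 h2; omega
  | succ j ih =>
    intro i g _ h1 h2 h
    rcases Nat.eq_or_lt_of_le h1 with rfl | h1
    · refine ⟨g, fun a => ?_⟩
      obtain ⟨g', hM, h3, h4⟩ := Game.exists_play (fun _ => a) (j + 1) i g h
      exact ⟨g', hM, h3, h4 i le_rfl h2 hy⟩
    · by_cases hk : kind i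
      · exact ih _ _ h1 (by omega) (h.1 hk (Classical.arbitrary P) trivial)
      · obtain ⟨a, -, hG⟩ := h.2 hk
        exact ih _ _ h1 (by omega) hG

end Game

/-! ### Sentences as games -/

namespace CPFormula

/-- The number of quantifiers. -/
def nq : CPFormula → ℕ
  | .le _ _ | .eq _ _ => 0
  | .and φ ψ => φ.nq + ψ.nq
  | .all _ φ | .ex _ φ => φ.nq + 1

/-- When the quantifiers of the formula are numbered from `d` on in the order in which they
are written, `kind` holds for the universal ones and fails for the existential ones. -/
def Kinds (kind : ℕ → Prop) : CPFormula → ℕ → Prop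
  | .le _ _, _ | .eq _ _, _ => True
  | .and φ ψ, d => φ.Kinds kind d ∧ ψ.Kinds kind (d + φ.nq)
  | .all _ φ, d => kind d ∧ φ.Kinds kind (d + 1)
  | .ex _ φ, d => ¬ kind d ∧ φ.Kinds kind (d + 1)

/-- `φ.Edge env d a b`: some atom of `φ` requires the element of quantifier `a` to be below that of
quantifier `b`. The quantifiers of `φ` are numbered from `d` on, and `env x` is the number of the
quantifier outside of `φ` that binds `x`. -/
def Edge : CPFormula → (ℕ → ℕ) → ℕ → ℕ → ℕ → Prop
  | .le x y, env, _, a, b => a = env x ∧ b = env y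
  | .eq x y, env, _, a, b => (a = env x ∧ b = env y) ∨ (a = env y ∧ b = env x)
  | .and φ ψ, env, d, a, b => φ.Edge env d a b ∨ ψ.Edge env (d + φ.nq) a b
  | .all x φ, env, d, a, b | .ex x φ, env, d, a, b => φ.Edge (update env x d) (d + 1) a b

theorem edge_range (φ : CPFormula) : ∀ {env : ℕ → ℕ} {d a b : ℕ}, φ.Edge env d a b →
    ((∃ x ∈ φ.freeVars, a = env x) ∨ (d ≤ a ∧ a < d + φ.nq)) ∧
    ((∃ x ∈ φ.freeVars, b = env x) ∨ (d ≤ b ∧ b < d + φ.nq)) := by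
  induction φ with
  | le x y => rintro env d a b ⟨rfl, rfl⟩; simp [freeVars]
  | eq x y => rintro env d a b (⟨rfl, rfl⟩ | ⟨rfl, rfl⟩) <;> simp [freeVars]
  | and φ ψ ihφ ihψ =>
    rintro env d a b (h | h)
    · obtain ⟨h1, h2⟩ := ihφ h
      refine ⟨h1.imp ?_ ?_, h2.imp ?_ ?_⟩ <;> simp only [freeVars, nq, Finset.mem_union]
      on_goal 1 => exact fun ⟨x, hx, h⟩ => ⟨x, .inl hx, h⟩
      on_goal 2 => exact fun ⟨x, hx, h⟩ => ⟨x, .inl hx, h⟩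
      all_goals omega
    · obtain ⟨h1, h2⟩ := ihψ h
      refine ⟨h1.imp ?_ ?_, h2.imp ?_ ?_⟩ <;> simp only [freeVars, nq, Finset.mem_union]
      on_goal 1 => exact fun ⟨x, hx, h⟩ => ⟨x, .inr hx, h⟩
      on_goal 2 => exact fun ⟨x, hx, h⟩ => ⟨x, .inr hx, h⟩
      all_goals omega
  | all x φ ih | ex x φ ih =>
    intro env d a b h
    obtain ⟨h1, h2⟩ := ih h
    have aux : ∀ a, (∃ y ∈ φ.freeVars, a = update env x d y) ∨ (d + 1 ≤ a ∧ a < d + 1 + φ.nq) →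
        (∃ y ∈ φ.freeVars.erase x, a = env y) ∨ (d ≤ a ∧ a < d + (φ.nq + 1)) := by
      rintro a (⟨y, hy, rfl⟩ | h)
      · by_cases hxy : y = x
        · subst hxy; right; simp
        · left; exact ⟨y, Finset.mem_erase.2 ⟨hxy, hy⟩, by simp [hxy]⟩
      · right; omega
    exact ⟨aux a h1, aux b h2⟩

theorem sat_congr {P : Type*} [LE P] (φ : CPFormula) : ∀ {v v' : ℕ → P},
    (∀ x ∈ φ.freeVars, v x = v' x) → (φ.Sat v ↔ φ.Sat v') := by
  induction φ with
  | le x y => intro v v' h; simp only [Sat, h x (by simp [freeVars]), h y (by simp [freeVars])]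
  | eq x y => intro v v' h; simp only [Sat, h x (by simp [freeVars]), h y (by simp [freeVars])]
  | and φ ψ ihφ ihψ =>
    intro v v' h
    simp only [Sat]
    rw [ihφ fun x hx => h x (by simp [freeVars, hx]), ihψ fun x hx => h x (by simp [freeVars, hx])]
  | all x φ ih | ex x φ ih =>
    intro v v' h
    have : ∀ a, φ.Sat (update v x a) ↔ φ.Sat (update v' x a) := fun a => ih fun y hy => by
      by_cases hxy : y = x
      · simp [hxy]
      · simp [hxy, h y (Finset.mem_erase.2 ⟨hxy, hy⟩)]
    simp only [Sat, this]

/-- The relation `E` is respected by the chosen elements. -/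
def _root_.PosetMC.Holds {P : Type*} [LE P] (E : ℕ → ℕ → Prop) (g : ℕ → P) : Prop :=
  ∀ a b, E a b → g a ≤ g b

/-- A formula is a game in which all its quantifiers are played in the order in which they are
written: a quantifier moves out of a conjunction, since its variable may be renamed. -/
theorem sat_iff_game {P : Type*} [PartialOrder P] [Nonempty P] {kind : ℕ → Prop}
    (φ : CPFormula) : ∀ {env : ℕ → ℕ} {d : ℕ} (g : ℕ → P), (∀ x ∈ φ.freeVars, env x < d) →
      φ.Kinds kind d → (φ.Sat (fun x => g (env x)) ↔
        Game .univ .univ kind (Holds (φ.Edge env d)) φ.nq d g) := by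
  induction φ with
  | le x y =>
    intro env d g _ _
    simp only [Sat, nq, Game, Holds, Edge]
    exact ⟨fun h a b ⟨ha, hb⟩ => ha ▸ hb ▸ h, fun h => h _ _ ⟨rfl, rfl⟩⟩
  | eq x y =>
    intro env d g _ _
    simp only [Sat, nq, Game, Holds, Edge]
    constructor
    · rintro h a b (⟨rfl, rfl⟩ | ⟨rfl, rfl⟩)
      exacts [h.le, h.ge]
    · exact fun h => le_antisymm (h _ _ (.inl ⟨rfl, rfl⟩)) (h _ _ (.inr ⟨rfl, rfl⟩))
  | and φ ψ ihφ ihψ =>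
    intro env d g henv hk
    simp only [freeVars, Finset.mem_union] at henv
    have hφ : ∀ x ∈ φ.freeVars, env x < d := fun x hx => henv x (.inl hx)
    have hψ : ∀ x ∈ ψ.freeVars, env x < d := fun x hx => henv x (.inr hx)
    simp only [Sat, nq]
    rw [ihφ g hφ hk.1, ihψ (d := d + φ.nq) g (fun x hx => (hψ x hx).trans_le (Nat.le_add_right _ _))
      hk.2, game_append]
    have hH : ∀ g : ℕ → P, Holds ((φ.and ψ).Edge env d) g ↔
        Holds (ψ.Edge env (d + φ.nq)) g ∧ Holds (φ.Edge env d) g := fun g => by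
      simp only [Holds, Edge, or_imp, forall_and]; exact and_comm
    simp only [game_congr hH]
    have h1 : ∀ g : ℕ → P, Game .univ .univ kind (fun g => Holds (ψ.Edge env (d + φ.nq)) g ∧
        Holds (φ.Edge env d) g) ψ.nq (d + φ.nq) g ↔ Holds (φ.Edge env d) g ∧
        Game .univ .univ kind (Holds (ψ.Edge env (d + φ.nq))) ψ.nq (d + φ.nq) g := fun g => by
      rw [game_and, and_comm]
      intro g t a ht _
      refine forall_congr' fun i => forall_congr' fun j => imp_congr_right fun hE => ?_
      have hr : ∀ i, (∃ x ∈ φ.freeVars, i = env x) ∨ (d ≤ i ∧ i < d + φ.nq) → i ≠ t := by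
        rintro i (⟨x, hx, rfl⟩ | h)
        · have := hφ x hx; omega
        · omega
      obtain ⟨hi, hj⟩ := edge_range φ hE
      rw [update_of_ne (hr i hi), update_of_ne (hr j hj)]
    rw [game_congr h1, game_and]
    have key : ∀ g g' : ℕ → P, (∀ t ∈ {t | t < d ∨ d + φ.nq ≤ t}, g t = g' t) →
        Holds (ψ.Edge env (d + φ.nq)) g → Holds (ψ.Edge env (d + φ.nq)) g' := by
      intro g g' h H i j hE
      have hr : ∀ i, (∃ x ∈ ψ.freeVars, i = env x) ∨ (d + φ.nq ≤ i ∧ i < d + φ.nq + ψ.nq) →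
          i ∈ {t | t < d ∨ d + φ.nq ≤ t} := by
        rintro i (⟨x, hx, rfl⟩ | h)
        exacts [.inl (hψ x hx), .inr h.1]
      obtain ⟨hi, hj⟩ := edge_range ψ hE
      rw [← h i (hr i hi), ← h j (hr j hj)]
      exact H i j hE
    intro g t a h1 h2
    refine ⟨?_, ?_⟩ <;> refine Game.congr_on {t | t < d ∨ d + φ.nq ≤ t} key _ _ _ _ fun s hs => ?_
    all_goals
      have : s ≠ t := by have : s < d ∨ d + φ.nq ≤ s := hs; omega
      simp [this]
  | all x φ ih | ex x φ ih =>
    intro env d g henv hk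
    have hlt : ∀ y ∈ φ.freeVars, update env x d y < d + 1 := fun y hy => by
      by_cases hxy : y = x
      · simp [hxy]
      · simpa [hxy] using (henv y (Finset.mem_erase.2 ⟨hxy, hy⟩)).le
    have : ∀ a, φ.Sat (update (fun x => g (env x)) x a) ↔
        φ.Sat (fun y => update g d a (update env x d y)) := fun a => sat_congr φ fun y hy => by
      by_cases hxy : y = x
      · simp [hxy]
      · simp [hxy, (henv y (Finset.mem_erase.2 ⟨hxy, hy⟩)).ne]
    simp only [Sat, this, nq, Game, hk.1, not_true, not_false_eq_true, forall_const,
      Set.mem_univ, true_and, and_true, IsEmpty.forall_iff, Edge,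
      fun a => ih (update g d a) hlt hk.2]

end CPFormula

/-! ### Small sets of candidates -/

/-- Increasing sets of elements: the next set consists of the elements that are minimal or maximal
among the elements with the same relations to the present set on the one side. -/
def lvl (P : Type*) [PartialOrder P] : ℕ → Set P
  | 0 => ∅
  | t + 1 => {p | (∀ q < p, ∃ s ∈ lvl P t, s ≤ p ∧ ¬ s ≤ q) ∨
      (∀ q, p < q → ∃ s ∈ lvl P t, p ≤ s ∧ ¬ q ≤ s)}

section Level

variable {P : Type*} [PartialOrder P]

theorem lvl_mono : Monotone (lvl P) :=
  monotone_nat_of_le_succ fun _ p hp => .inl fun _ hq => ⟨p, hp, le_rfl, hq.not_ge⟩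

theorem exists_le_mem_lvl [Finite P] (t : ℕ) (p : P) :
    ∃ q ∈ lvl P (t + 1), q ≤ p ∧ ∀ s ∈ lvl P t, s ≤ p → s ≤ q := by
  obtain ⟨q, ⟨h1, h2⟩, hmin⟩ := (wellFounded_lt (α := P)).has_min
    {q | q ≤ p ∧ ∀ s ∈ lvl P t, s ≤ p → s ≤ q} ⟨p, le_rfl, fun _ _ h => h⟩
  refine ⟨q, .inl fun q' hq' => ?_, h1, h2⟩
  by_contra! hc
  exact hmin q' ⟨hq'.le.trans h1, fun s hs hsp => hc s hs (h2 s hs hsp)⟩ hq'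

theorem exists_ge_mem_lvl [Finite P] (t : ℕ) (p : P) :
    ∃ q ∈ lvl P (t + 1), p ≤ q ∧ ∀ s ∈ lvl P t, p ≤ s → q ≤ s := by
  obtain ⟨q, ⟨h1, h2⟩, hmin⟩ := (wellFounded_gt (α := P)).has_min
    {q | p ≤ q ∧ ∀ s ∈ lvl P t, p ≤ s → q ≤ s} ⟨p, le_rfl, fun _ _ h => h⟩
  refine ⟨q, .inr fun q' hq' => ?_, h1, h2⟩
  by_contra! hc
  exact hmin q' ⟨h1.trans hq'.le, fun s hs hsp => hc s hs (h2 s hs hsp)⟩ hq'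

end Level

/-! ### Games on posets -/

/-- The obstruction to winning on any poset with at least two elements: the element `y` of the
opponent is related to another one of the opponent, or equal to an earlier one. -/
def Viol (kind : ℕ → Prop) (ρ : ℕ → ℕ → Prop) : Prop :=
  ∃ y z, y ≠ z ∧ kind y ∧ ρ y z ∧ (kind z ∨ (z < y ∧ ρ z y))

/-- The map `rep` sends an index that is forced to equal a universal one to that one, and all others
to themselves. -/
def IsRep (kind : ℕ → Prop) (ρ : ℕ → ℕ → Prop) (r : ℕ) (rep : ℕ → ℕ) : Prop :=
  ∀ i < r, (rep i = i ∧ ∀ y, kind y → ρ i y → ρ y i → y = i) ∨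
    (kind (rep i) ∧ ρ i (rep i) ∧ ρ (rep i) i)

section PosetGame

variable {P : Type*} [PartialOrder P] {kind : ℕ → Prop} {ρ : ℕ → ℕ → Prop} {r : ℕ} {rep : ℕ → ℕ}

theorem holds_closure {E : ℕ → ℕ → Prop} (h1 : ∀ a b, E a b → ρ a b)
    (h2 : ∀ a b, ρ a b → Relation.TransGen E a b) (g : ℕ → P) : Holds E g ↔ Holds ρ g := by
  refine ⟨fun h a b hab => ?_, fun h a b hab => h a b (h1 a b hab)⟩
  induction h2 a b hab with
  | single h' => exact h _ _ h'
  | @tail b c hb hc ih => exact (Relation.TransGen.rec (motive := fun b _ => g a ≤ g b)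
      (fun h' => h _ _ h') (fun _ h' ih => ih.trans (h _ _ h')) hb).trans (h _ _ hc)

theorem not_game_of_viol [Nontrivial P] (hlt : ∀ a b, ρ a b → a < r ∧ b < r)
    (hv : Viol kind ρ) (g : ℕ → P) : ¬ Game .univ .univ kind (Holds ρ) r 0 g := by
  intro h
  obtain ⟨y, z, hyz, hy, hρ, hz⟩ := hv
  have hyr := (hlt y z hρ).1
  have hzr := (hlt y z hρ).2
  rcases hz with hz | ⟨hzy, hρ'⟩
  · obtain ⟨p, q, hpq⟩ : ∃ p q : P, ¬ p ≤ q := by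
      obtain ⟨p, q, hpq⟩ := exists_pair_ne P
      by_cases hle : p ≤ q
      · exact ⟨q, p, fun hle' => hpq (le_antisymm hle hle')⟩
      · exact ⟨p, q, hle⟩
    obtain ⟨g', hM, -, hc⟩ := Game.exists_play (fun t => if t = y then p else q) r 0 g h
    have := hM y z hρ
    rw [hc y (Nat.zero_le _) (by omega) hy, hc z (Nat.zero_le _) (by omega) hz] at this
    simp only [if_true, hyz.symm, if_false] at this
    exact hpq this
  · obtain ⟨p, q, hpq⟩ := exists_pair_ne P
    obtain ⟨g₀, hg₀⟩ := Game.exists_prefix hy r 0 g (Nat.zero_le _) (by omega) h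
    have key : ∀ a, a = g₀ z := fun a => by
      obtain ⟨g', hM, h1, rfl⟩ := hg₀ a
      rw [← h1 z hzy]
      exact le_antisymm (hM y z hρ) (hM z y hρ')
    exact hpq ((key p).trans (key q).symm)

theorem rep_lt (hlt : ∀ a b, ρ a b → a < r ∧ b < r) (hrep : IsRep kind ρ r rep) {i : ℕ}
    (hi : i < r) : rep i < r := by
  rcases hrep i hi with h | ⟨-, h2, -⟩
  · rw [h.1]; exact hi
  · exact (hlt _ _ h2).2

theorem rel_rep (htr : ∀ a b c, ρ a b → ρ b c → ρ a c) (hlt : ∀ a b, ρ a b → a < r ∧ b < r)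
    (hrep : IsRep kind ρ r rep) {a b : ℕ} (h : ρ a b) : ρ (rep a) (rep b) := by
  have h1 : ρ (rep a) b := by
    rcases hrep a (hlt _ _ h).1 with h' | ⟨-, -, h'⟩
    · rwa [h'.1]
    · exact htr _ _ _ h' h
  rcases hrep b (hlt _ _ h).2 with h' | ⟨-, h', -⟩
  · rwa [h'.1]
  · exact htr _ _ _ h1 h'

section Rep

variable (htr : ∀ a b c, ρ a b → ρ b c → ρ a c) (hlt : ∀ a b, ρ a b → a < r ∧ b < r)
  (hv : ¬ Viol kind ρ) (hrep : IsRep kind ρ r rep)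

include hv

theorem eq_of_kind_of_rel {y z : ℕ} (hy : kind y) (hz : kind z) (h : ρ y z) : y = z := by
  by_contra hne
  exact hv ⟨y, z, hne, hy, h, .inl hz⟩

theorem kind_lt_of_rel {y i : ℕ} (hy : kind y) (hi : ¬ kind i) (h : ρ y i) (h' : ρ i y) :
    y < i := by
  have : y ≠ i := by rintro rfl; exact hi hy
  by_contra hle
  exact hv ⟨y, i, this, hy, h, .inr ⟨by omega, h'⟩⟩

include hrep

theorem rep_eq_of_kind {i : ℕ} (hi : i < r) (hk : kind i) : rep i = i := by
  rcases hrep i hi with h | ⟨h1, h2, -⟩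
  · exact h.1
  · exact (eq_of_kind_of_rel hv hk h1 h2).symm

theorem rep_cases {i : ℕ} (hi : i < r) (hk : ¬ kind i) (hne : rep i ≠ i) :
    kind (rep i) ∧ rep i < i ∧ ρ i (rep i) ∧ ρ (rep i) i := by
  rcases hrep i hi with h | ⟨h1, h2, h3⟩
  · exact absurd h.1 hne
  · exact ⟨h1, kind_lt_of_rel hv h1 hk h3 h2, h2, h3⟩

include hlt

theorem rep_rep {i : ℕ} (hi : i < r) : rep (rep i) = rep i := by
  rcases hrep i hi with h | ⟨h1, h2, -⟩
  · rw [h.1, h.1]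
  · exact rep_eq_of_kind hv hrep (hlt _ _ h2).2 h1

include htr

/-- An index that is its own representative, existential, and below a universal one is above no
universal one. -/
theorem not_up_of_rel_kind {a b : ℕ} (ha : rep a = a) (hka : ¬ kind a) (hb : kind b) (h : ρ a b) :
    ¬ ∃ y, kind y ∧ ρ y a := by
  rintro ⟨y, hy, hya⟩
  obtain rfl := eq_of_kind_of_rel hv hy hb (htr _ _ _ hya h)
  rcases hrep a (hlt _ _ h).1 with h' | ⟨h1, -, -⟩
  · exact hka (h'.2 y hy h hya ▸ hy)
  · exact hka (ha ▸ h1)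

/-- With a least and a greatest element, it suffices to copy the forced values, and to choose the
greatest element above elements of the opponent and the least element otherwise. -/
theorem game_of_bot_top [Nonempty P] {bot top : P} (hbot : ∀ p, bot ≤ p) (htop : ∀ p, p ≤ top)
    (g : ℕ → P) : Game .univ .univ kind (Holds ρ) r 0 g := by
  classical
  refine Game.transfer (r := r) (fun i (_ : ℕ → P) g' => ∀ t < i, ¬ kind t → g' t =
    if rep t ≠ t then g' (rep t) else if ∃ y, kind y ∧ ρ y t then top else bot) ?_ ?_ ?_ r 0 g g
    (Nat.zero_add r) (fun t ht => absurd ht (Nat.not_lt_zero t)) (game_true r 0 g)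
  · intro i g g' hi hk hI a _
    refine ⟨a, trivial, fun t ht hkt => ?_⟩
    have hti : t ≠ i := by rintro rfl; exact hkt hk
    have := hI t (by omega) hkt
    by_cases hr : rep t = t
    · simp only [hr, ne_eq, not_true, if_false] at this ⊢
      rw [update_of_ne hti, this]
    · have h := rep_cases hv hrep (by omega) hkt hr
      simp only [hr, ne_eq, not_false_eq_true, if_true] at this ⊢
      rw [update_of_ne hti, update_of_ne (by omega), this]
  · intro i g g' hi hk hI a _
    refine ⟨if rep i ≠ i then g' (rep i) else if ∃ y, kind y ∧ ρ y i then top else bot, trivial,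
      fun t ht hkt => ?_⟩
    by_cases hr : rep t = t
    · by_cases hti : t = i
      · subst hti; simp [hr]
      · have := hI t (by omega) hkt
        simp only [hr, ne_eq, not_true, if_false] at this ⊢
        rw [update_of_ne hti, this]
    · have h := rep_cases hv hrep (by omega) hkt hr
      by_cases hti : t = i
      · subst hti; simp [hr]
      · have := hI t (by omega) hkt
        simp only [hr, ne_eq, not_false_eq_true, if_true] at this ⊢
        rw [update_of_ne hti, update_of_ne (by omega), this]
  · intro _ g hI _ a b hab
    have hga : ∀ a < r, g a = g (rep a) := fun a ha => by
      by_cases hr : rep a = a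
      · rw [hr]
      · rw [hI a ha fun hk => hr (rep_eq_of_kind hv hrep ha hk), if_pos hr]
    rw [hga a (hlt _ _ hab).1, hga b (hlt _ _ hab).2]
    have hρ := rel_rep htr hlt hrep hab
    have hra := rep_rep hlt hv hrep (hlt _ _ hab).1
    have hrb := rep_rep hlt hv hrep (hlt _ _ hab).2
    generalize rep a = a at hρ hra
    generalize rep b = b at hρ hrb
    have hgr : ∀ a < r, rep a = a → ¬ kind a →
        g a = if ∃ y, kind y ∧ ρ y a then top else bot := fun a ha hr hk => by
      rw [hI a ha hk, if_neg (not_not.2 hr)]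
    by_cases hka : kind a
    · by_cases hkb : kind b
      · rw [eq_of_kind_of_rel hv hka hkb hρ]
      · rw [hgr b (hlt _ _ hρ).2 hrb hkb, if_pos ⟨a, hka, hρ⟩]
        exact htop _
    · rw [hgr a (hlt _ _ hρ).1 hra hka]
      split_ifs with hu
      · by_cases hkb : kind b
        · exact absurd hu (not_up_of_rel_kind htr hlt hv hrep hra hka hkb hρ)
        · obtain ⟨y, hy, hya⟩ := hu
          rw [hgr b (hlt _ _ hρ).2 hrb hkb, if_pos ⟨y, hy, htr _ _ _ hya hρ⟩]
      · exact hbot _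

/-- The existential player can restrict the choices to a level of small sets: a choice that is not
forced to be above an element of the opponent is lowered to an element with the same relations
to lower levels, and the other choices are raised. The level that is
used for an index is the number of indices strictly below it (or above it). -/
theorem restrict_existential [Finite P] {R : Set P} {g : ℕ → P}
    (h : Game .univ .univ kind (Holds ρ) r 0 g) :
    Game R (lvl P (r + 1)) kind (fun g => ∀ a b, ρ a b → g (rep a) ≤ g (rep b)) r 0 g := by
  classical
  choose dn hdn using exists_le_mem_lvl (P := P)
  choose up hup using exists_ge_mem_lvl (P := P)
  let below : ℕ → Finset ℕ := fun i => (Finset.range r).filter fun j => ρ j i ∧ ¬ ρ i j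
  let above : ℕ → Finset ℕ := fun i => (Finset.range r).filter fun j => ρ i j ∧ ¬ ρ j i
  have hbr : ∀ i, (below i).card ≤ r := fun i =>
    (Finset.card_filter_le _ _).trans (Finset.card_range r).le
  have har : ∀ i, (above i).card ≤ r := fun i =>
    (Finset.card_filter_le _ _).trans (Finset.card_range r).le
  have hb : ∀ {a b}, ρ a b → below a ⊆ below b := fun {a b} hab j hj => by
    simp only [below, Finset.mem_filter] at hj ⊢
    exact ⟨hj.1, htr _ _ _ hj.2.1 hab, fun hbj => hj.2.2 (htr _ _ _ hab hbj)⟩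
  have ha : ∀ {a b}, ρ a b → above b ⊆ above a := fun {a b} hab j hj => by
    simp only [above, Finset.mem_filter] at hj ⊢
    exact ⟨hj.1, htr _ _ _ hab hj.2.1, fun hja => hj.2.2 (htr _ _ _ hja hab)⟩
  have hb' : ∀ {a b}, ρ a b → ¬ ρ b a → (below a).card < (below b).card := fun {a b} hab hba =>
    Finset.card_lt_card ⟨hb hab, fun hs => by
      have : a ∈ below a := hs (by simp [below, (hlt _ _ hab).1, hab, hba])
      simp only [below, Finset.mem_filter] at this
      exact this.2.2 this.2.1⟩
  have ha' : ∀ {a b}, ρ a b → ¬ ρ b a → (above b).card < (above a).card := fun {a b} hab hba =>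
    Finset.card_lt_card ⟨ha hab, fun hs => by
      have : b ∈ above b := hs (by simp [above, (hlt _ _ hab).2, hab, hba])
      simp only [above, Finset.mem_filter] at this
      exact this.2.2 this.2.1⟩
  let π : ℕ → P → P := fun i p =>
    if ∃ y, kind y ∧ ρ y i then up (above i).card p else dn (below i).card p
  have hπ : ∀ i p, π i p ∈ lvl P (r + 1) := fun i p => by
    by_cases hu : ∃ y, kind y ∧ ρ y i
    · simpa only [π, if_pos hu] using lvl_mono (Nat.succ_le_succ (har i)) (hup _ p).1
    · simpa only [π, if_neg hu] using lvl_mono (Nat.succ_le_succ (hbr i)) (hdn _ p).1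
  refine Game.transfer (r := r) (fun i g g' => ∀ t < i, g' t = if kind t then g t else π t (g t))
    ?_ ?_ ?_ r 0 g g (Nat.zero_add r) (fun t ht => absurd ht (Nat.not_lt_zero t)) h
  · intro i g g' hi hk hI a _
    refine ⟨a, trivial, fun t ht => ?_⟩
    by_cases hti : t = i
    · subst hti; simp [hk]
    · simp only [update_of_ne hti]; exact hI t (by omega)
  · intro i g g' hi hk hI a _
    refine ⟨π i a, hπ i a, fun t ht => ?_⟩
    by_cases hti : t = i
    · subst hti; simp [hk]
    · simp only [update_of_ne hti]; exact hI t (by omega)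
  · intro g g' hI hM a b hab
    have hρ := rel_rep htr hlt hrep hab
    have hra := rep_rep hlt hv hrep (hlt _ _ hab).1
    generalize rep a = a at hρ hra
    generalize rep b = b at hρ
    have hle := hM a b hρ
    rw [hI a (hlt _ _ hρ).1, hI b (hlt _ _ hρ).2]
    by_cases hka : kind a <;> by_cases hkb : kind b
    · rw [if_pos hka, if_pos hkb]; exact hle
    · rw [if_pos hka, if_neg hkb]
      simp only [π, if_pos (⟨a, hka, hρ⟩ : ∃ y, kind y ∧ ρ y b)]
      exact hle.trans (hup _ _).2.1
    · rw [if_neg hka, if_pos hkb]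
      simp only [π, if_neg (not_up_of_rel_kind htr hlt hv hrep hra hka hkb hρ)]
      exact (hdn _ _).2.1.trans hle
    · rw [if_neg hka, if_neg hkb]
      by_cases hba : ρ b a
      -- the choices at `a` and `b` are equal, and changed in the same way
      · have hg : g a = g b := le_antisymm hle (hM b a hba)
        have h1 : below a = below b := (hb hρ).antisymm (hb hba)
        have h2 : above a = above b := (ha hba).antisymm (ha hρ)
        have h3 : (∃ y, kind y ∧ ρ y a) ↔ ∃ y, kind y ∧ ρ y b :=
          ⟨fun ⟨y, hy, h⟩ => ⟨y, hy, htr _ _ _ h hρ⟩, fun ⟨y, hy, h⟩ => ⟨y, hy, htr _ _ _ h hba⟩⟩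
        simp only [π, hg, h1, h2, h3, le_refl]
      · by_cases hua : ∃ y, kind y ∧ ρ y a
        · have hub : ∃ y, kind y ∧ ρ y b := hua.imp fun y hy => ⟨hy.1, htr _ _ _ hy.2 hρ⟩
          simp only [π, if_pos hua, if_pos hub]
          exact (hup _ _).2.2 _ (lvl_mono (Nat.succ_le_of_lt (ha' hρ hba)) (hup _ _).1)
            (hle.trans (hup _ _).2.1)
        · by_cases hub : ∃ y, kind y ∧ ρ y b
          · simp only [π, if_neg hua, if_pos hub]
            exact (hdn _ _).2.1.trans (hle.trans (hup _ _).2.1)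
          · simp only [π, if_neg hua, if_neg hub]
            exact (hdn _ _).2.2 _ (lvl_mono (Nat.succ_le_of_lt (hb' hρ hba)) (hdn _ _).1)
              ((hdn _ _).2.1.trans hle)

/-- If the existential player only uses elements of `B`, then the choices of the opponent matter
only through their relations to `B`. -/
theorem restrict_universal {R B : Set P}
    (hR : ∀ p, ∃ q ∈ R, ∀ s ∈ B, (s ≤ q ↔ s ≤ p) ∧ (q ≤ s ↔ p ≤ s)) {g : ℕ → P}
    (h : Game R B kind (fun g => ∀ a b, ρ a b → g (rep a) ≤ g (rep b)) r 0 g) :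
    Game .univ .univ kind (Holds ρ) r 0 g := by
  refine Game.transfer (r := r) (fun i g g' => ∀ t < i,
    (kind t → ∀ s ∈ B, (s ≤ g t ↔ s ≤ g' t) ∧ (g t ≤ s ↔ g' t ≤ s)) ∧
    (¬ kind t → (rep t = t → g' t = g t ∧ g t ∈ B) ∧ (rep t ≠ t → g' t = g' (rep t))))
    ?_ ?_ ?_ r 0 g g (Nat.zero_add r) (fun t ht => absurd ht (Nat.not_lt_zero t)) h
  · intro i g g' hi hk hI a _
    obtain ⟨q, hq, hs⟩ := hR a
    refine ⟨q, hq, fun t ht => ⟨fun hkt => ?_, fun hkt => ?_⟩⟩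
    · by_cases hti : t = i
      · subst hti; simpa using hs
      · simp only [update_of_ne hti]; exact (hI t (by omega)).1 hkt
    · have hti : t ≠ i := by rintro rfl; exact hkt hk
      have := (hI t (by omega)).2 hkt
      simp only [update_of_ne hti]
      refine ⟨this.1, fun hr => ?_⟩
      have h := rep_cases hv hrep (by omega) hkt hr
      rw [update_of_ne (by omega), this.2 hr]
  · intro i g g' hi hk hI a ha
    refine ⟨if rep i = i then a else g' (rep i), trivial, fun t ht => ⟨fun hkt => ?_,
      fun hkt => ⟨fun hr => ?_, fun hr => ?_⟩⟩⟩
    · have hti : t ≠ i := by rintro rfl; exact hk hkt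
      simp only [update_of_ne hti]; exact (hI t (by omega)).1 hkt
    · by_cases hti : t = i
      · subst hti; simp [hr, ha]
      · simp only [update_of_ne hti]; exact ((hI t (by omega)).2 hkt).1 hr
    · have h := rep_cases hv hrep (by omega) hkt hr
      rw [update_of_ne (show rep t ≠ i by omega)]
      by_cases hti : t = i
      · subst hti; simp [hr]
      · rw [update_of_ne hti]; exact ((hI t (by omega)).2 hkt).2 hr
  · intro g g' hI hM a b hab
    have hga : ∀ a < r, g' a = g' (rep a) := fun a ha => by
      by_cases hr : rep a = a
      · rw [hr]
      · exact ((hI a ha).2 fun hk => hr (rep_eq_of_kind hv hrep ha hk)).2 hr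
    rw [hga a (hlt _ _ hab).1, hga b (hlt _ _ hab).2]
    have hle := hM a b hab
    have hρ := rel_rep htr hlt hrep hab
    have hra := rep_rep hlt hv hrep (hlt _ _ hab).1
    have hrb := rep_rep hlt hv hrep (hlt _ _ hab).2
    generalize rep a = a at hρ hra hle
    generalize rep b = b at hρ hrb hle
    have hIa := hI a (hlt _ _ hρ).1
    have hIb := hI b (hlt _ _ hρ).2
    by_cases hka : kind a <;> by_cases hkb : kind b
    · rw [eq_of_kind_of_rel hv hka hkb hρ]
    · obtain ⟨h1, h2⟩ := (hIb.2 hkb).1 hrb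
      rw [h1]; exact ((hIa.1 hka _ h2).2).1 hle
    · obtain ⟨h1, h2⟩ := (hIa.2 hka).1 hra
      rw [h1]; exact ((hIb.1 hkb _ h2).1).1 hle
    · rw [((hIa.2 hka).1 hra).1, ((hIb.2 hkb).1 hrb).1]; exact hle

end Rep
end PosetGame

/-! ### The number of candidates -/

section Card

variable {P : Type*}

theorem card_le_width [Finite P] [LE P] {A : Finset P}
    (hA : IsAntichain (· ≤ ·) (A : Set P)) : A.card ≤ width P := by
  have := Fintype.ofFinite P
  refine le_csSup ⟨Fintype.card P, ?_⟩ ⟨A, hA, rfl⟩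
  rintro n ⟨A, -, rfl⟩
  exact A.card_le_univ

/-- A set of `n` elements has at most `(n + 1) ^ w` subsets with at most `w` elements. -/
theorem card_smallSubsets_le [DecidableEq P] (L : Finset P) (w : ℕ) :
    (L.powerset.filter fun A => A.card ≤ w).card ≤ (L.card + 1) ^ w := by
  have hc : (Fintype.piFinset fun _ : Fin w => L.insertNone).card = (L.card + 1) ^ w := by
    simp
  rw [← hc]
  refine Finset.card_le_card_of_injOn (fun A i => A.toList[(i : ℕ)]?) ?_ ?_
  · intro A hA
    simp only [Finset.coe_filter, Finset.mem_powerset, Set.mem_ofPred_eq] at hA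
    simp only [Finset.mem_coe, Fintype.mem_piFinset, Finset.mem_insertNone]
    intro i p hp
    exact hA.1 (Finset.mem_toList.1 (List.mem_of_getElem? hp))
  · intro A hA B hB hAB
    simp only [Finset.coe_filter, Finset.mem_powerset, Set.mem_ofPred_eq] at hA hB
    have : A.toList = B.toList := List.ext_getElem? fun i => by
      by_cases hi : i < w
      · exact congrFun hAB ⟨i, hi⟩
      · rw [List.getElem?_eq_none (by rw [Finset.length_toList]; omega),
          List.getElem?_eq_none (by rw [Finset.length_toList]; omega)]
    rw [← A.toList_toFinset, this, B.toList_toFinset]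

section Max

variable [PartialOrder P]

open Classical in
/-- The maximal elements of `L` below `p`. -/
noncomputable def maxBelow (L : Finset P) (p : P) : Finset P :=
  L.filter fun s => Maximal (fun s => s ∈ L ∧ s ≤ p) s

theorem maxBelow_antichain (L : Finset P) (p : P) :
    IsAntichain (· ≤ ·) (maxBelow L p : Set P) := by
  intro s hs s' hs' hne hle
  simp only [maxBelow, Finset.coe_filter, Set.mem_ofPred_eq] at hs hs'
  exact hne (hs.2.eq_of_le hs'.2.prop hle)

/-- The elements of `L` below `p` are determined by the maximal ones. -/
theorem le_of_maxBelow_eq [Finite P] {L : Finset P} {p q s : P} (h : maxBelow L p = maxBelow L q)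
    (hs : s ∈ L) (hsp : s ≤ p) : s ≤ q := by
  classical
  obtain ⟨b, hb, hmax⟩ := (Set.toFinite {s | s ∈ L ∧ s ≤ p}).exists_le_maximal ⟨hs, hsp⟩
  have : b ∈ maxBelow L p := by
    simp only [maxBelow, Finset.mem_filter]
    exact ⟨hmax.prop.1, hmax⟩
  rw [h] at this
  simp only [maxBelow, Finset.mem_filter] at this
  exact hb.trans this.2.prop.2

theorem maxBelow_subset (L : Finset P) (p : P) : maxBelow L p ⊆ L := by
  classical exact Finset.filter_subset _ _

/-- The minimal elements of `L` above `p`. -/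
noncomputable def minAbove (L : Finset P) (p : P) : Finset P := maxBelow (P := Pᵒᵈ) L p

theorem minAbove_antichain (L : Finset P) (p : P) :
    IsAntichain (· ≤ ·) (minAbove L p : Set P) :=
  fun _ hs _ hs' hne hle => maxBelow_antichain (P := Pᵒᵈ) L p hs' hs hne.symm hle

theorem minAbove_subset (L : Finset P) (p : P) : minAbove L p ⊆ L :=
  maxBelow_subset (P := Pᵒᵈ) L p

theorem ge_of_minAbove_eq [Finite P] {L : Finset P} {p q s : P} (h : minAbove L p = minAbove L q)
    (hs : s ∈ L) (hsp : p ≤ s) : q ≤ s :=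
  le_of_maxBelow_eq (P := Pᵒᵈ) h hs hsp

/-- Elements with the same relations to `L` downwards that all are minimal form an antichain. -/
theorem card_minimal_le [Finite P] {w : ℕ}
    (hw : ∀ A : Finset P, IsAntichain (· ≤ ·) (A : Set P) → A.card ≤ w) (L D : Finset P)
    (hD : ∀ p ∈ D, ∀ q < p, ∃ s ∈ L, s ≤ p ∧ ¬ s ≤ q) : D.card ≤ w * (L.card + 1) ^ w := by
  classical
  refine (Finset.card_le_mul_card_image_of_maps_to (f := maxBelow L) (fun p _ =>
    Finset.mem_filter.2 ⟨Finset.mem_powerset.2 (maxBelow_subset L p),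
      hw _ (maxBelow_antichain L p)⟩) w ?_).trans
    (Nat.mul_le_mul_left w (card_smallSubsets_le L w))
  intro A _
  refine hw _ fun p hp q hq hne hle => ?_
  simp only [Finset.coe_filter, Set.mem_ofPred_eq] at hp hq
  obtain ⟨s, hs, h1, h2⟩ := hD q hq.1 p (lt_of_le_of_ne hle hne)
  exact h2 (le_of_maxBelow_eq (hq.2.trans hp.2.symm) hs h1)

theorem card_maximal_le [Finite P] {w : ℕ}
    (hw : ∀ A : Finset P, IsAntichain (· ≤ ·) (A : Set P) → A.card ≤ w) (L D : Finset P)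
    (hD : ∀ p ∈ D, ∀ q, p < q → ∃ s ∈ L, p ≤ s ∧ ¬ q ≤ s) : D.card ≤ w * (L.card + 1) ^ w :=
  card_minimal_le (P := Pᵒᵈ)
    (fun A hA => hw A fun _ hp _ hq hne hle => hA hq hp hne.symm hle) L D hD

end Max

theorem card_lvl_succ_le [PartialOrder P] [Finite P] (t : ℕ) :
    (lvl P (t + 1)).ncard ≤ 2 * width P * ((lvl P t).ncard + 1) ^ width P := by
  classical
  have := Fintype.ofFinite P
  have hw : ∀ A : Finset P, IsAntichain (· ≤ ·) (A : Set P) → A.card ≤ width P :=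
    fun A => card_le_width
  have h1 := card_minimal_le hw (lvl P t).toFinset
    ({p | ∀ q < p, ∃ s ∈ lvl P t, s ≤ p ∧ ¬ s ≤ q} : Set P).toFinset
    fun p hp q hq => by simpa using (Set.mem_toFinset.1 hp) q hq
  have h2 := card_maximal_le hw (lvl P t).toFinset
    ({p | ∀ q, p < q → ∃ s ∈ lvl P t, p ≤ s ∧ ¬ q ≤ s} : Set P).toFinset
    fun p hp q hq => by simpa using (Set.mem_toFinset.1 hp) q hq
  have h3 : lvl P (t + 1) = {p | ∀ q < p, ∃ s ∈ lvl P t, s ≤ p ∧ ¬ s ≤ q} ∪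
      {p | ∀ q, p < q → ∃ s ∈ lvl P t, p ≤ s ∧ ¬ q ≤ s} := rfl
  rw [h3]
  refine (Set.ncard_union_le _ _).trans ?_
  simp only [Set.ncard_eq_toFinset_card']
  calc _ ≤ _ := Nat.add_le_add h1 h2
    _ = _ := by rw [← two_mul, mul_assoc]

/-- A set of elements that differ in their relations to `B` is small. -/
theorem card_types_le [PartialOrder P] [Finite P] {R B : Set P}
    (hR : ∀ p ∈ R, ∀ q ∈ R, (∀ s ∈ B, (s ≤ p ↔ s ≤ q) ∧ (p ≤ s ↔ q ≤ s)) → p = q) :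
    R.ncard ≤ (B.ncard + 1) ^ (2 * width P) := by
  classical
  have := Fintype.ofFinite P
  have hw : ∀ A : Finset P, IsAntichain (· ≤ ·) (A : Set P) → A.card ≤ width P :=
    fun A => card_le_width
  simp only [Set.ncard_eq_toFinset_card']
  set F := B.toFinset.powerset.filter fun A => A.card ≤ width P
  have hF : F.card ≤ (B.toFinset.card + 1) ^ width P := card_smallSubsets_le B.toFinset _
  have h1 : R.toFinset.card ≤ (F ×ˢ F).card := by
    refine Finset.card_le_card_of_injOn
      (fun p => (maxBelow B.toFinset p, minAbove B.toFinset p)) ?_ ?_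
    · intro p _
      exact Finset.mem_product.2 ⟨
        Finset.mem_filter.2 ⟨Finset.mem_powerset.2 (maxBelow_subset _ p),
          hw _ (maxBelow_antichain _ p)⟩,
        Finset.mem_filter.2 ⟨Finset.mem_powerset.2 (minAbove_subset _ p),
          hw _ (minAbove_antichain _ p)⟩⟩
    · intro p hp q hq hpq
      simp only [Prod.mk.injEq] at hpq
      refine hR p (by simpa using hp) q (by simpa using hq) fun s hs => ?_
      have hs' := Set.mem_toFinset.2 hs
      exact ⟨⟨le_of_maxBelow_eq hpq.1 hs', le_of_maxBelow_eq hpq.1.symm hs'⟩,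
        ⟨ge_of_minAbove_eq hpq.2 hs', ge_of_minAbove_eq hpq.2.symm hs'⟩⟩
  rw [Finset.card_product] at h1
  calc _ ≤ _ := h1
    _ ≤ _ := Nat.mul_le_mul hF hF
    _ = _ := by rw [← pow_add, two_mul]

theorem card_lvl_le [PartialOrder P] [Finite P] (hw : 2 ≤ width P) (t : ℕ) :
    (lvl P t).ncard + 1 ≤ width P ^ (3 * (width P + 1) ^ t) := by
  set w := width P
  have h3 : 3 * w ≤ w ^ 3 := by
    have := Nat.mul_le_mul hw hw
    calc 3 * w ≤ w * w * w := Nat.mul_le_mul_right w (by omega)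
      _ = w ^ 3 := by ring
  induction t with
  | zero => simpa [lvl] using Nat.one_le_pow 3 w (by omega)
  | succ t ih =>
    have h1 : _ ≤ 2 * w * ((lvl P t).ncard + 1) ^ w := card_lvl_succ_le (P := P) t
    have h2 := Nat.pow_le_pow_left ih w
    have h4 := Nat.one_le_pow w ((lvl P t).ncard + 1) (Nat.succ_pos _)
    calc (lvl P (t + 1)).ncard + 1 ≤ 2 * w * ((lvl P t).ncard + 1) ^ w + 1 := by omega
      _ ≤ 3 * w * ((lvl P t).ncard + 1) ^ w := by nlinarith
      _ ≤ w ^ 3 * (w ^ (3 * (w + 1) ^ t)) ^ w := Nat.mul_le_mul h3 h2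
      _ = w ^ (3 + 3 * (w + 1) ^ t * w) := by rw [← pow_mul, ← pow_add]
      _ ≤ w ^ (3 * (w + 1) ^ (t + 1)) := by
        refine Nat.pow_le_pow_right (by omega) ?_
        have := Nat.one_le_pow t (w + 1) (Nat.succ_pos _)
        rw [pow_succ]; nlinarith

theorem le_or_le_of_width_le_one [PartialOrder P] [Finite P] (hw : width P ≤ 1) (p q : P) :
    p ≤ q ∨ q ≤ p := by
  classical
  by_contra! h
  have hne : p ≠ q := by rintro rfl; exact h.1 le_rfl
  have hA : IsAntichain (· ≤ ·) (({p, q} : Finset P) : Set P) := by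
    simp only [Finset.coe_pair]
    intro a ha b hb hab
    simp only [Set.mem_insert_iff, Set.mem_singleton_iff] at ha hb
    rcases ha with rfl | rfl <;> rcases hb with rfl | rfl
    exacts [absurd rfl hab, h.1, h.2, absurd rfl hab]
  have := card_le_width hA
  rw [Finset.card_pair hne] at this
  omega

theorem one_le_width [PartialOrder P] [Finite P] [Nonempty P] : 1 ≤ width P := by
  obtain ⟨p⟩ := ‹Nonempty P›
  have := card_le_width (A := {p}) (by simp)
  simpa using this

/-- A poset without least or without greatest element has width at least `2`. -/
theorem exists_bot_top_of_width_le_one [PartialOrder P] [Finite P] [Nonempty P]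
    (hw : width P ≤ 1) : (∃ bot : P, ∀ p, bot ≤ p) ∧ ∃ top : P, ∀ p, p ≤ top := by
  obtain ⟨b, hb⟩ := (wellFounded_lt (α := P)).has_min .univ Set.univ_nonempty
  obtain ⟨t, ht⟩ := (wellFounded_gt (α := P)).has_min .univ Set.univ_nonempty
  refine ⟨⟨b, fun p => ?_⟩, ⟨t, fun p => ?_⟩⟩
  · rcases le_or_le_of_width_le_one hw b p with h | h
    · exact h
    · exact (eq_of_le_of_not_lt h (hb.2 p trivial)).ge
  · rcases le_or_le_of_width_le_one hw p t with h | h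
    · exact h
    · exact (eq_of_le_of_not_lt h (ht.2 p trivial)).ge

end Card

/-! ### The algorithm -/

namespace Cmd

/-- Branching without alternative. -/
def when (e : Ex) (c : Cmd) : Cmd := .ite e c .skip

/-- Composition of a list of commands. -/
def block : List Cmd → Cmd
  | [] => .skip
  | [c] => c
  | c :: d :: l => .seq c (block (d :: l))

end Cmd

namespace Algo

open Cmd Ex Var

/-- The order relation of the input poset, read off the matrix. -/
def leEx (p q : Ex) : Ex := (Ex.inp (.add (.arr .rowM p) q)).eq (.num 2)

/-- The relation on the quantifiers. -/
def reachEx (i j : Ex) : Ex := .arr .reach (.add (.arr .rowN i) j)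

/-- The size of the poset: the position of the first separator. -/
def sizeCmd : Cmd :=
  .loop len (.when (.all len (.or (.lt (.bv 1) (.bv 0)) (.not (.eq (.inp (.bv 0)) (.num 3)))))
    (.setv size (.add (.sv size) (.num 1))))

/-- The positions of the rows of the matrix in the input, and of the rows of the matrix `reach`. -/
def rowsCmd : Cmd :=
  .loop len (.seq
    (.seta .rowM (.add (.bv 0) (.num 1)) (.add (.arr .rowM (.bv 0)) (.add (.sv size) (.num 1))))
    (.seta .rowN (.add (.bv 0) (.num 1)) (.add (.arr .rowN (.bv 0)) (.sv len))))

/-- The condition that the search for the quantifier of a variable continues. -/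
def searchEx : Ex :=
  .and (.sv cur) (.not (.eq (.arr .name (.sub (.sv cur) (.num 1))) (.sv num)))

/-- The search for the quantifier that binds a variable: it leaves its number plus one in `cur`. -/
def searchCmd : Cmd :=
  .seq (.setv cur (.sv scope)) (.loop len (.when searchEx
    (.setv cur (.arr .parent (.sub (.sv cur) (.num 1))))))

/-- A new quantifier is recorded, with its kind, its variable and the scope outside of it, and it
becomes the innermost one. -/
def quantCmd : Cmd := block [
  .seta .kind (.sv qs) (.sub (.num 1) (.sv pend)),
  .seta .name (.sv qs) (.sv num),
  .seta .parent (.sv qs) (.sv scope),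
  .setv qs (.add (.sv qs) (.num 1)),
  .setv scope (.sv qs)]

/-- The end of an atom: its edges are recorded, two of them for an equality, and the parser goes on
with the second part of the innermost open conjunction, the scope of which is on the stack. -/
def atomCmd : Cmd := block [
  .seta .reach (.add (.arr .rowN (.sv fst)) (.sub (.sv cur) (.num 1))) (.num 1),
  .when (.eq (.sv pend) (.num 5))
    (.seta .reach (.add (.arr .rowN (.sub (.sv cur) (.num 1))) (.sv fst)) (.num 1)),
  .setv sp (.sub (.sv sp) (.num 1)),
  .setv scope (.arr .stack (.sv sp))]

/-- The end of a variable. The pending symbol `pend` is `0` and `1` for the quantifiers, `2` and `3`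
before the first variable of an atom, and `4` and `5` before the second one. -/
def sepCmd : Cmd := block [
  .ite (.lt (.sv pend) (.num 2)) quantCmd
    (.seq searchCmd (.ite (.lt (.sv pend) (.num 4))
      (.seq (.setv fst (.sub (.sv cur) (.num 1))) (.setv pend (.add (.sv pend) (.num 2))))
      atomCmd)),
  .setv num (.num 0),
  .setv pw (.num 1)]

/-- The effect of one letter of the sentence. -/
def letterCmd : Cmd :=
  .ite (.eq (.inp (.bv 0)) (.num 1)) (.setv pw (.add (.sv pw) (.sv pw))) <|
  .ite (.eq (.inp (.bv 0)) (.num 2))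
    (.seq (.setv num (.add (.sv num) (.sv pw))) (.setv pw (.add (.sv pw) (.sv pw)))) <|
  .ite (.eq (.inp (.bv 0)) (.num 3)) sepCmd <|
  .ite (.eq (.inp (.bv 0)) (.num 4)) (.setv pend (.num 0)) <|
  .ite (.eq (.inp (.bv 0)) (.num 5)) (.setv pend (.num 1)) <|
  .ite (.eq (.inp (.bv 0)) (.num 6))
    (.seq (.seta .stack (.sv sp) (.sv scope)) (.setv sp (.add (.sv sp) (.num 1)))) <|
  .ite (.eq (.inp (.bv 0)) (.num 7)) (.setv pend (.num 2)) (.setv pend (.num 3))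

/-- The letters after the matrix, those of the sentence, are read. -/
def parseCmd : Cmd :=
  .seq (.setv pw (.num 1)) (.loop len (.ite (.lt (.bv 0) (.arr .rowM (.sv size))) .skip letterCmd))

/-- The innermost command of Warshall's algorithm, for the pair of `bv 1` and `bv 0`, and the
intermediate index `bv 2`. -/
def cellCmd : Cmd := .when (.and (reachEx (.bv 1) (.bv 2)) (reachEx (.bv 2) (.bv 0)))
  (.seta .reach (.add (.arr .rowN (.bv 1)) (.bv 0)) (.num 1))

/-- The transitive closure of the relation on the quantifiers. -/
def closureCmd : Cmd := .loop qs (.loop qs (.loop qs cellCmd))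

/-- The representatives of the quantifiers: a universal quantifier with edges in both directions, if
there is one. -/
def repCmd : Cmd :=
  .loop qs (.seq (.seta .rep (.bv 0) (.bv 0)) (.loop qs (.when
    (.and (.arr .kind (.bv 0)) (.and (reachEx (.bv 1) (.bv 0)) (reachEx (.bv 0) (.bv 1))))
    (.seta .rep (.bv 1) (.bv 0)))))

/-- The conditions that decide the instance at once: `bad` is the obstruction `Viol`, and `triv` the
existence of a least and a greatest element. -/
def checkCmd : Cmd :=
  .seq (.setv bad (.ex qs (.ex qs (.and (.not (.eq (.bv 1) (.bv 0))) (.and (.arr .kind (.bv 1))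
      (.and (reachEx (.bv 1) (.bv 0)) (.or (.arr .kind (.bv 0))
        (.and (.lt (.bv 0) (.bv 1)) (reachEx (.bv 0) (.bv 1))))))))))
    (.setv triv (.and (.ex size (.all size (leEx (.bv 1) (.bv 0))))
      (.ex size (.all size (leEx (.bv 0) (.bv 1))))))

/-- The condition for the element `bv 0` to be in the next level. -/
def levelEx : Ex :=
  .or (.all size (.or (.not (.and (leEx (.bv 0) (.bv 1)) (.not (.eq (.bv 0) (.bv 1)))))
      (.ex size (.and (.arr .cand (.bv 0)) (.and (leEx (.bv 0) (.bv 2))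
        (.not (leEx (.bv 0) (.bv 1))))))))
    (.all size (.or (.not (.and (leEx (.bv 1) (.bv 0)) (.not (.eq (.bv 0) (.bv 1)))))
      (.ex size (.and (.arr .cand (.bv 0)) (.and (leEx (.bv 2) (.bv 0))
        (.not (leEx (.bv 1) (.bv 0))))))))

/-- The candidates for the existential quantifiers. -/
def candCmd : Cmd :=
  .loop lv (.seq (.loop size (.seta .cand' (.bv 0) levelEx))
    (.loop size (.seta .cand (.bv 0) (.arr .cand' (.bv 0)))))

/-- The condition for the element `bv 0` to have other relations to the candidates than the elements
that are listed before. -/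
def repsEx : Ex :=
  .all size (.or (.not (.lt (.bv 0) (.bv 1))) (.ex size (.and (.arr .cand (.bv 0)) (.not (.and
    (.eq (leEx (.bv 0) (.bv 2)) (leEx (.bv 0) (.bv 1)))
    (.eq (leEx (.bv 2) (.bv 0)) (leEx (.bv 1) (.bv 0))))))))

/-- The candidates for the universal quantifiers. -/
def repsCmd : Cmd := .loop size (.seta .reps (.bv 0) repsEx)

/-- A number of steps that suffices for the game. -/
def budgetCmd : Cmd := block [
  .setv bud (.num 1),
  .loop qs (block [
    .setv bud' (.add (.sv size) (.num 2)),
    .loop size (.when (.arr .reps (.bv 0))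
      (.setv bud' (.add (.sv bud') (.add (.sv bud) (.num 2))))),
    .setv bud (.sv bud')]),
  .when (.or (.sv bad) (.sv triv)) (.setv bud (.num 0))]

/-- The condition to be achieved in the game. -/
def goalEx : Ex :=
  .all qs (.all qs (.or (.not (reachEx (.bv 1) (.bv 0)))
    (leEx (.arr .val (.arr .rep (.bv 1))) (.arr .val (.arr .rep (.bv 0))))))

/-- The condition for the present value of the present quantifier to be a candidate. -/
def memberEx : Ex :=
  .or (.and (.arr .kind (.sv dep)) (.arr .reps (.arr .val (.sv dep))))
    (.and (.not (.arr .kind (.sv dep))) (.arr .cand (.arr .val (.sv dep))))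

/-- One step of the evaluation of the game by backtracking. In mode `0` the game from quantifier
`dep` on is entered, in mode `1` the next value for this quantifier is tried, and in mode `2` the
game from quantifier `dep` on has been evaluated, with result `res`. -/
def stepCmd : Cmd :=
  .ite (.eq (.sv mode) (.num 0))
    (.ite (.eq (.sv dep) (.sv qs))
      (.seq (.setv res goalEx) (.setv mode (.num 2)))
      (block [.seta .val (.sv dep) (.num 0), .seta .acc (.sv dep) (.arr .kind (.sv dep)),
        .setv mode (.num 1)]))
  (.ite (.eq (.sv mode) (.num 1))
    (.ite (.eq (.arr .val (.sv dep)) (.sv size))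
      (.seq (.setv res (.arr .acc (.sv dep))) (.setv mode (.num 2)))
      (.ite memberEx
        (.seq (.setv dep (.add (.sv dep) (.num 1))) (.setv mode (.num 0)))
        (.seta .val (.sv dep) (.add (.arr .val (.sv dep)) (.num 1)))))
    (.when (.sv dep) (block [
      .setv dep (.sub (.sv dep) (.num 1)),
      .ite (.arr .kind (.sv dep))
        (.seta .acc (.sv dep) (.and (.arr .acc (.sv dep)) (.sv res)))
        (.seta .acc (.sv dep) (.or (.arr .acc (.sv dep)) (.sv res))),
      .seta .val (.sv dep) (.add (.arr .val (.sv dep)) (.num 1)),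
      .setv mode (.num 1)])))

/-- The truth value of the sentence. The double negation makes it `0` or `1`. -/
def answerCmd : Cmd :=
  .setv res (.not (.and (.not (.eq (.sv size) (.num 1)))
    (.not (.and (.not (.sv bad)) (.or (.sv triv) (.sv res))))))

/-- The input is read. -/
def readCmd : Cmd := block [rowsCmd, parseCmd, .setv lv (.add (.sv qs) (.num 1))]

/-- The game is prepared. -/
def prepareCmd : Cmd := block [closureCmd, repCmd, checkCmd, candCmd, repsCmd, budgetCmd]

/-- The game is evaluated. -/
def gameCmd : Cmd := .seq (.loop bud stepCmd) answerCmd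

/-- The length of the input is computed. -/
def lenCode : List Instr :=
  [.const (tmp 1) 1, .read (tmp 0) (sreg len), .jumpZero (tmp 0) 5,
    .add (sreg len) (sreg len) (tmp 1), .jump 1]

/-- A program that computes the length of the input, executes four commands, and outputs `res`. -/
def link (c₁ c₂ c₃ c₄ : Cmd) : Program :=
  lenCode ++ (c₁.code 0 5 ++ (c₂.code 0 (5 + c₁.len) ++ (c₃.code 0 (5 + c₁.len + c₂.len) ++
    (c₄.code 0 (5 + c₁.len + c₂.len + c₃.len) ++ [.copy 0 (sreg res)]))))

/-- The program. -/
def program : Program := link sizeCmd readCmd prepareCmd gameCmd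

end Algo

/-! ### The run of the program -/

section Run

open Algo

theorem letterAt_eq_zero {x : List Letter} {i : ℕ} : letterAt x i = 0 ↔ x.length ≤ i := by
  unfold letterAt
  rcases lt_or_ge i x.length with h | h
  · rw [List.getElem?_eq_getElem h]
    simp only [Option.elim_some, not_le.2 h, iff_false]
    cases x[i] <;> simp [Letter.code]
  · simp [h]

/-- The initial state. -/
def State.init (n : ℕ) : State :=
  { v := Function.update (fun _ => 0) .len n, a := fun _ _ => 0 }

theorem lenCode_spec {M : Program} (x : List Letter) (h : CodeAt M 0 lenCode) :
    ∃ ρ, ReachesIn M x ⟨0, fun _ => 0⟩ ⟨5, ρ⟩ (4 * x.length + 3) ∧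
      Rep (State.init x.length) [] ρ := by
  simp only [lenCode, codeAt_cons] at h
  obtain ⟨h0, h1, h2, h3, h4, -⟩ := h
  have loop : ∀ (k j : ℕ) (ρ : ℕ → ℕ), j + k = x.length → ρ (tmp 1) = 1 →
      Rep (State.init j) [] ρ →
      ∃ ρ', ReachesIn M x ⟨1, ρ⟩ ⟨5, ρ'⟩ (4 * k + 2) ∧ Rep (State.init x.length) [] ρ' := by
    intro k
    induction k with
    | zero =>
      intro j ρ hj h hR
      obtain rfl : j = x.length := by omega
      have hv : ρ (sreg .len) = x.length := hR.sv .len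
      refine ⟨Function.update ρ (tmp 0) 0, .head h1 (.head h2 (T := 0) ?_ le_rfl) (by omega),
        hR.update_tmp _ _⟩
      simp only [Instr.exec, Config.write, hv]
      simp [ReachesIn.refl]
    | succ k ih =>
      intro j ρ hj h hR
      have hv : ρ (sreg .len) = j := hR.sv .len
      have hz : letterAt x j ≠ 0 := by rw [ne_eq, letterAt_eq_zero]; omega
      have hR' := (hR.update_tmp 0 (letterAt x j)).setv .len (j + 1)
      have hs : (State.init j).setv .len (j + 1) = State.init (j + 1) := by
        simp [State.init, State.setv]
      rw [hs] at hR'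
      obtain ⟨ρ', r, R⟩ := ih (j + 1) _ (by omega)
        (by simp [tmp_ne_sreg, tmp_inj, h]) hR'
      refine ⟨ρ', .head h1 (.head h2 (T := 4 * k + 2 + 2) ?_ le_rfl) (by omega), R⟩
      simp only [Instr.exec, Config.write, hv, Function.update_self]
      change ReachesIn M x ⟨if letterAt x j = 0 then 5 else 3, _⟩ _ _
      rw [if_neg hz]
      refine .head h3 (.head h4 ?_ le_rfl) le_rfl
      simpa [Instr.exec, Config.write, sreg_ne_tmp, tmp_inj, h, hv, letterAt] using r
  obtain ⟨ρ, r, R⟩ := loop x.length 0 (Function.update (fun _ => 0) (tmp 1) 1) (by omega) (by simp)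
    (Rep.update_tmp ⟨fun i => by cases i <;> simp [State.init], fun _ _ => rfl,
      fun i hi => by simp at hi⟩ _ _)
  exact ⟨ρ, .head h0 r (by omega), R⟩

/-- The output of a linked program, and its running time, in terms of the bounds of the loops of the
four commands. -/
theorem link_spec (c₁ c₂ c₃ c₄ : Cmd) (hc₁ : ∀ i ∈ c₁.bnd, i ∉ c₁.modv)
    (hc₂ : ∀ i ∈ c₂.bnd, i ∉ c₂.modv) (hc₃ : ∀ i ∈ c₃.bnd, i ∉ c₃.modv)
    (hc₄ : ∀ i ∈ c₄.bnd, i ∉ c₄.modv) :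
    ∃ K D : ℕ, ∀ (x : List Letter) (N N' : ℕ) (s₁ s₂ s₃ s₄ : State), x.length ≤ N → N ≤ N' →
      s₁ = c₁.den x [] (State.init x.length) → s₂ = c₂.den x [] s₁ → s₃ = c₃.den x [] s₂ →
      s₄ = c₄.den x [] s₃ → (∀ i ∈ c₁.bnd, (State.init x.length).v i ≤ N) →
      (∀ i ∈ c₂.bnd, s₁.v i ≤ N) → (∀ i ∈ c₃.bnd, s₂.v i ≤ N) → (∀ i ∈ c₄.bnd, s₃.v i ≤ N') →
      ∃ t ≤ K * (N' + 1) ^ D, (link c₁ c₂ c₃ c₄).length ≤ ((link c₁ c₂ c₃ c₄).run x t).pc ∧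
        ((link c₁ c₂ c₃ c₄).run x t).reg 0 = s₄.v .res := by
  obtain ⟨K1, D1, h1⟩ := c₁.exists_cost_le
  obtain ⟨K2, D2, h2⟩ := c₂.exists_cost_le
  obtain ⟨K3, D3, h3⟩ := c₃.exists_cost_le
  obtain ⟨K4, D4, h4⟩ := c₄.exists_cost_le
  refine ⟨K1 + K2 + K3 + K4 + 8, D1 + D2 + D3 + D4 + 1, ?_⟩
  rintro x N N' _ _ _ _ hn hN rfl rfl rfl rfl hb1 hb2 hb3 hb4
  have hc : CodeAt (link c₁ c₂ c₃ c₄) 0 (link c₁ c₂ c₃ c₄) := fun i ins h => by simpa using h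
  have hlen : (link c₁ c₂ c₃ c₄).length = 5 + c₁.len + c₂.len + c₃.len + c₄.len + 1 := by
    simp [link, lenCode, Cmd.length_code]; omega
  conv at hc => arg 3; unfold link
  simp only [codeAt_append, Cmd.length_code, codeAt_cons] at hc
  obtain ⟨i0, i1, i2, i3, i4, i5, -⟩ := hc
  simp only [lenCode, List.length_cons, List.length_nil, Nat.zero_add, Nat.reduceAdd]
    at i1 i2 i3 i4 i5
  obtain ⟨ρ0, r0, R0⟩ := lenCode_spec x i0
  obtain ⟨ρ1, r1, R1⟩ := c₁.code_spec (x := x) (N := N) (β := []) i1 R0 hc₁ hb1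
  obtain ⟨ρ2, r2, R2⟩ := c₂.code_spec (x := x) (N := N) (β := []) i2 R1 hc₂ hb2
  obtain ⟨ρ3, r3, R3⟩ := c₃.code_spec (x := x) (N := N) (β := []) i3 R2 hc₃ hb3
  obtain ⟨ρ4, r4, R4⟩ := c₄.code_spec (x := x) (N := N') (β := []) i4 R3 hc₄ hb4
  obtain ⟨t, ht, he⟩ := r0.trans (r1.trans (r2.trans (r3.trans (r4.trans (.head i5 (.refl _ 0)
    le_rfl) le_rfl) le_rfl) le_rfl) le_rfl) le_rfl
  rw [← run_eq_iterate] at he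
  refine ⟨t, ht.trans ?_, ?_, ?_⟩
  · have e : ∀ D, D ≤ D1 + D2 + D3 + D4 + 1 → (N + 1) ^ D ≤ (N' + 1) ^ (D1 + D2 + D3 + D4 + 1) :=
      fun D hD => (Nat.pow_le_pow_left (by omega) D).trans (Nat.pow_le_pow_right (by omega) hD)
    have e1 := (h1 N).trans (Nat.mul_le_mul_left K1 (e D1 (by omega)))
    have e2 := (h2 N).trans (Nat.mul_le_mul_left K2 (e D2 (by omega)))
    have e3 := (h3 N).trans (Nat.mul_le_mul_left K3 (e D3 (by omega)))
    have e4 := (h4 N').trans (Nat.mul_le_mul_left K4 (Nat.pow_le_pow_right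
      (show 0 < N' + 1 by omega) (show D4 ≤ D1 + D2 + D3 + D4 + 1 by omega)))
    have e5 : N + 1 ≤ (N' + 1) ^ (D1 + D2 + D3 + D4 + 1) := by simpa using e 1 (by omega)
    have e6 : x.length + 1 ≤ N + 1 := by omega
    simp only [add_mul]; omega
  · rw [he, hlen]; simp [Instr.exec, Config.write]
  · rw [he]
    simpa [Instr.exec, Config.write] using R4.sv .res

end Run

open Algo

/-! ### Reading the input -/

section StateSimp

variable (s : State) (i j : Var) (b c : Arr) (k w : ℕ)

@[simp] theorem State.setv_v : (s.setv i w).v j = if j = i then w else s.v j := by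
  simp [State.setv, Function.update_apply]

@[simp] theorem State.setv_a : (s.setv i w).a = s.a := rfl

@[simp] theorem State.seta_v : (s.seta b k w).v = s.v := rfl

@[simp] theorem State.seta_a :
    (s.seta b k w).a c = if c = b then Function.update (s.a b) k w else s.a c := by
  simp only [State.seta, Function.update_apply]

end StateSimp

@[simp] theorem bv_zero (x : List Letter) (s : State) (i : ℕ) (β : List ℕ) :
    (Ex.bv 0).eval x s (i :: β) = i := rfl

@[simp] theorem bv_one (x : List Letter) (s : State) (i i' : ℕ) (β : List ℕ) :
    (Ex.bv 1).eval x s (i :: i' :: β) = i' := rfl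

@[simp] theorem bv_two (x : List Letter) (s : State) (i i' i'' : ℕ) (β : List ℕ) :
    (Ex.bv 2).eval x s (i :: i' :: i'' :: β) = i'' := rfl

theorem ite_eval_ne (x : List Letter) (s : State) (β : List ℕ) (e : Ex) (c d : State) :
    (if e.eval x s β ≠ 0 then c else d) = open Classical in if e.True x s β then c else d := by
  by_cases h : e.eval x s β = 0 <;> simp [Ex.True, h]

theorem true_sv (x : List Letter) (s : State) (β : List ℕ) (i : Var) :
    (Ex.sv i).True x s β ↔ s.v i ≠ 0 := Iff.rfl

theorem true_arr (x : List Letter) (s : State) (β : List ℕ) (b : Arr) (e : Ex) :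
    (Ex.arr b e).True x s β ↔ s.a b (e.eval x s β) ≠ 0 := Iff.rfl

theorem den_sizeCmd (x : List Letter) {m : ℕ} (hm : m < x.length) (h3 : letterAt x m = 3)
    (hlt : ∀ i < m, letterAt x i ≠ 3) (s : State) (hn : s.v .len = x.length)
    (hs : s.v .size = 0) : sizeCmd.den x [] s = s.setv .size m := by
  have key : iter (fun j s => Cmd.den x (.when
      (.all .len (.or (.lt (.bv 1) (.bv 0)) (.not (.eq (.inp (.bv 0)) (.num 3)))))
      (.setv .size (.add (.sv .size) (.num 1)))) [j] s) (s.v .len) s =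
      s.setv .size (min (s.v .len) m) := by
    refine iter_induction (fun j s' => s' = s.setv .size (min j m)) ?_ ?_
    · ext i j
      · by_cases hi : i = .size <;> simp [hi, hs]
      · rfl
    · rintro j _ hj rfl
      have hc : (∀ i < x.length, j < i ∨ letterAt x i ≠ 3) ↔ j < m := by
        constructor
        · intro h
          rcases h m hm with h | h
          exacts [h, absurd h3 h]
        · intro h i _
          by_cases hi : i ≤ j
          · exact .inr (hlt i (by omega))
          · exact .inl (by omega)
      simp only [Cmd.when, Cmd.den, ite_eval_ne]
      simp only [Ex.true_all, Ex.true_or, Ex.true_lt, Ex.true_not, Ex.true_eq, Ex.eval,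
        List.getD_cons_zero, List.getD_cons_succ, State.setv_v, reduceCtorEq, if_false,
        if_true, hn, hc]
      split_ifs with h
      · rw [min_eq_left (by omega), min_eq_left (by omega)]
        simp [State.setv]
      · rw [min_eq_right (by omega), min_eq_right (by omega)]
  rw [hn, min_eq_right hm.le] at key
  rw [← key, ← hn]; rfl

theorem den_rowsCmd (x : List Letter) (s : State) (h1 : s.a .rowM 0 = 0) (h2 : s.a .rowN 0 = 0) :
    ∀ i ≤ s.v .len, (rowsCmd.den x [] s).a .rowM i = i * (s.v .size + 1) ∧
      (rowsCmd.den x [] s).a .rowN i = i * s.v .len := by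
  refine (iter_induction (fun j (s' : State) => s'.v = s.v ∧ ∀ i ≤ j,
    s'.a .rowM i = i * (s.v .size + 1) ∧ s'.a .rowN i = i * s.v .len) ⟨rfl, ?_⟩ ?_).2
  · intro i hi
    obtain rfl : i = 0 := by omega
    simp [h1, h2]
  · rintro j s' hj ⟨hv, ha⟩
    refine ⟨by simp [Cmd.den, hv], fun i hi => ?_⟩
    obtain ⟨e1, e2⟩ := ha j le_rfl
    simp only [Cmd.den, Ex.eval, State.seta_a, State.seta_v, reduceCtorEq, if_false,
      if_true, Function.update_apply, hv, e1, e2, List.getD_cons_zero]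
    by_cases h : i = j + 1
    · subst h; simp [add_mul]
    · simpa [h] using ha i (by omega)

/-- One step of the search for the quantifier of the variable `y`. -/
def hop (nm par : ℕ → ℕ) (y c : ℕ) : ℕ := if c ≠ 0 ∧ nm (c - 1) ≠ y then par (c - 1) else c

theorem den_searchCmd (x : List Letter) (β : List ℕ) (s : State) :
    searchCmd.den x β s = s.setv .cur
      ((hop (s.a .name) (s.a .parent) (s.v .num))^[s.v .len] (s.v .scope)) := by
  have hlen : (s.setv .cur (s.v .scope)).v .len = s.v .len := by simp
  simp only [searchCmd, Cmd.den, Ex.eval]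
  rw [hlen]
  refine iter_induction (fun k s' => s' = s.setv .cur
    ((hop (s.a .name) (s.a .parent) (s.v .num))^[k] (s.v .scope))) rfl ?_
  rintro j _ - rfl
  rw [Function.iterate_succ_apply']
  generalize (hop (s.a .name) (s.a .parent) (s.v .num))^[j] (s.v .scope) = c
  simp only [Cmd.when, Cmd.den, ite_eval_ne]
  simp only [searchEx, Ex.true_and, Ex.true_not, Ex.true_eq, true_sv,
    Ex.eval, State.setv_v, State.setv_a, reduceCtorEq, if_false, if_true, hop]
  split_ifs <;> simp [State.setv]

/-- The effect of one letter of the sentence, given by its code. -/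
def letterStep (c : ℕ) (s : State) : State :=
  if c = 1 then s.setv .pw (s.v .pw + s.v .pw)
  else if c = 2 then (s.setv .num (s.v .num + s.v .pw)).setv .pw (s.v .pw + s.v .pw)
  else if c = 3 then sepCmd.den [] [] s
  else if c = 4 then s.setv .pend 0
  else if c = 5 then s.setv .pend 1
  else if c = 6 then (s.seta .stack (s.v .sp) (s.v .scope)).setv .sp (s.v .sp + 1)
  else if c = 7 then s.setv .pend 2
  else s.setv .pend 3

theorem den_letterCmd (x : List Letter) (j : ℕ) (s : State) :
    letterCmd.den x [j] s = letterStep (letterAt x j) s := by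
  have hsep : sepCmd.den x [j] s = sepCmd.den [] [] s := by
    simp only [sepCmd, Cmd.block, Cmd.den, den_searchCmd]; rfl
  simp only [letterCmd, letterStep, Cmd.den, ite_eval_ne]
  simp only [Ex.true_eq, Ex.eval,
    List.getD_cons_zero, hsep, State.setv_v, State.seta_v, reduceCtorEq, if_false]

theorem iter_foldl {α β : Type*} (f : β → α → α) (F : ℕ → α → α) (I : α → Prop) (o : ℕ) (l : List β)
    (h : ∀ i (hi : i < l.length) s, I s → F (o + i) s = f l[i] s ∧ I (F (o + i) s)) (s : α)
    (hs : I (iter F o s)) :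
    iter F (o + l.length) s = l.foldl (fun s b => f b s) (iter F o s) ∧
      I (iter F (o + l.length) s) := by
  induction l using List.reverseRecOn with
  | nil => exact ⟨rfl, hs⟩
  | append_singleton l b ih =>
    obtain ⟨ih1, ih2⟩ := ih fun i hi s hI => by
      have := h i (by simp; omega) s hI
      rwa [List.getElem_append_left hi] at this
    obtain ⟨h1, h2⟩ := h l.length (by simp) _ ih2
    rw [List.length_append, List.length_singleton, ← add_assoc, List.foldl_append, ← ih1]
    exact ⟨h1.trans (by simp), h2⟩

/-- The effect of a list of letters. -/
def lettersStep (l : List Letter) (s : State) : State :=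
  l.foldl (fun s a => letterStep a.code s) s

theorem lettersStep_append (l l' : List Letter) (s : State) :
    lettersStep (l ++ l') s = lettersStep l' (lettersStep l s) := List.foldl_append

theorem lettersStep_cons (a : Letter) (l : List Letter) (s : State) :
    lettersStep (a :: l) s = lettersStep l (letterStep a.code s) := rfl

theorem den_parseCmd (l l' : List Letter) (s : State) (hn : s.v .len = (l ++ l').length)
    (hl : s.a .rowM (s.v .size) = l.length) :
    parseCmd.den (l ++ l') [] s = lettersStep l' (s.setv .pw 1) := by
  change iter (fun j s => Cmd.den (l ++ l') (.ite (.lt (.bv 0) (.arr .rowM (.sv .size))) .skip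
    letterCmd) [j] s) ((s.setv .pw 1).v .len) (s.setv .pw 1) = _
  have hlen : (s.setv .pw 1).v .len = l.length + l'.length := by simp [hn]
  rw [hlen]
  -- the letters of the poset are skipped; the row table and the size do not change
  have hskip : iter (fun j s => Cmd.den (l ++ l') (.ite (.lt (.bv 0) (.arr .rowM (.sv .size))) .skip
      letterCmd) [j] s) l.length (s.setv .pw 1) = s.setv .pw 1 := by
    refine iter_induction (fun _ s' => s' = s.setv .pw 1) rfl ?_
    rintro j _ hj rfl
    simp only [Cmd.den, ite_eval_ne]
    simp [Ex.eval, hl, hj]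
  have := iter_foldl (fun a s => letterStep a.code s)
    (fun j s => Cmd.den (l ++ l') (.ite (.lt (.bv 0) (.arr .rowM (.sv .size))) .skip
      letterCmd) [j] s) (fun s => s.a .rowM (s.v .size) = l.length) l.length l' ?_ (s.setv .pw 1) ?_
  · rw [this.1, hskip]; rfl
  · intro i hi s' hs'
    have h1 : Cmd.den (l ++ l') (.ite (.lt (.bv 0) (.arr .rowM (.sv .size))) .skip
        letterCmd) [l.length + i] s' = letterCmd.den (l ++ l') [l.length + i] s' := by
      simp only [Cmd.den, ite_eval_ne]
      simp [Ex.eval, hs']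
    rw [h1]
    refine ⟨?_, ?_⟩
    · rw [den_letterCmd]
      congr 1
      simp [letterAt, hi]
    · rw [Cmd.den_a _ letterCmd (by decide), Cmd.den_v _ letterCmd (by decide), hs']
  · rw [hskip]; simpa using hl

/-! ### Parsing -/

/-- The search for the quantifier of the variable `y` from `c` on leads to `e`. -/
inductive Finds (nm par : ℕ → ℕ) (y : ℕ) : ℕ → ℕ → Prop
  | here {e : ℕ} : nm e = y → Finds nm par y (e + 1) e
  | up {c e : ℕ} : nm c ≠ y → par c ≤ c → Finds nm par y (par c) e → Finds nm par y (c + 1) e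

theorem Finds.lt {nm par : ℕ → ℕ} {y c e : ℕ} (h : Finds nm par y c e) : e < c := by
  induction h <;> omega

theorem Finds.hop_iterate {nm par : ℕ → ℕ} {y c e : ℕ} (h : Finds nm par y c e) :
    ∀ {n : ℕ}, c ≤ n → (hop nm par y)^[n] c = e + 1 := by
  induction h with
  | @here e h =>
    intro n _
    exact Function.iterate_fixed (by simp [hop, h]) n
  | @up c e h hp _ ih =>
    intro n hn
    obtain ⟨n, rfl⟩ : ∃ k, n = k + 1 := ⟨n - 1, by omega⟩
    rw [Function.iterate_succ_apply, show hop nm par y (c + 1) = par c by simp [hop, h]]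
    exact ih (by omega)

theorem Finds.congr {nm par nm' par' : ℕ → ℕ} {y c e q : ℕ} (h : Finds nm par y c e) (hc : c ≤ q)
    (h1 : ∀ i < q, nm' i = nm i) (h2 : ∀ i < q, par' i = par i) : Finds nm' par' y c e := by
  induction h with
  | @here e h => exact .here (by rw [h1 e (by omega), h])
  | @up c e h hp _ ih =>
    have := ih (by omega)
    rw [← h2 c (by omega)] at this hp
    exact .up (by rwa [h1 c (by omega)]) hp this

/-- The number with the given binary digits, least significant first. -/
def ofBits : List Bool → ℕ
  | [] => 0
  | b :: l => b.toNat + 2 * ofBits l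

theorem ofBits_bits (y : ℕ) : ofBits y.bits = y := by
  induction y using Nat.binaryRec' with
  | zero => simp [ofBits]
  | bit b n h ih =>
    rw [Nat.bits_append_bit n b h, ofBits, ih, Nat.bit_val]
    omega

theorem lettersStep_bits (l : List Bool) : ∀ (s : State) (a p : ℕ),
    ∃ p', lettersStep (l.map fun b => if b then Letter.one else Letter.zero)
      ((s.setv .num a).setv .pw p) = (s.setv .num (a + p * ofBits l)).setv .pw p' := by
  induction l with
  | nil => intro s a p; exact ⟨p, by simp [lettersStep, ofBits]⟩
  | cons b l ih =>
    intro s a p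
    rw [List.map_cons, lettersStep_cons]
    obtain ⟨p', hp'⟩ := ih s (a + p * b.toNat) (p + p)
    refine ⟨p', ?_⟩
    rw [show a + p * ofBits (b :: l) = a + p * b.toNat + (p + p) * ofBits l by
      simp only [ofBits]; ring, ← hp']
    congr 1
    cases b
    · ext i j
      · by_cases h : i = .pw
        · simp [letterStep, Letter.code, h]
        · by_cases h' : i = .num <;> simp [letterStep, Letter.code, h, h']
      · simp [letterStep, Letter.code]
    · ext i j
      · by_cases h : i = .pw
        · simp [letterStep, Letter.code, h]
        · by_cases h' : i = .num <;> simp [letterStep, Letter.code, h, h']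
      · simp [letterStep, Letter.code]

theorem lettersStep_encodeVar (y : ℕ) (s : State) (hn : s.v .num = 0) (hp : s.v .pw = 1) :
    ∃ p, lettersStep (encodeVar y) s = letterStep 3 ((s.setv .num y).setv .pw p) := by
  obtain ⟨p, h⟩ := lettersStep_bits y.bits s 0 1
  refine ⟨p, ?_⟩
  have hs : (s.setv .num 0).setv .pw 1 = s := by
    ext i j
    · by_cases h1 : i = .pw
      · simp [h1, hp]
      · by_cases h2 : i = .num <;> simp [h1, h2, hn]
    · rfl
  rw [hs, ofBits_bits] at h
  rw [encodeVar, lettersStep_append, h, zero_add, one_mul]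
  rfl

theorem CPFormula.Kinds.congr {k k' : ℕ → Prop} (φ : CPFormula) : ∀ {d : ℕ},
    (∀ i, i < d + φ.nq → (k i ↔ k' i)) → φ.Kinds k d → φ.Kinds k' d := by
  induction φ with
  | le | eq => intros; trivial
  | and φ ψ ihφ ihψ =>
    intro d h hk
    simp only [nq] at h
    exact ⟨ihφ (fun i hi => h i (by omega)) hk.1, ihψ (fun i hi => h i (by omega)) hk.2⟩
  | all x φ ih =>
    intro d h hk
    simp only [nq] at h
    exact ⟨(h d (by omega)).1 hk.1, ih (fun i hi => h i (by omega)) hk.2⟩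
  | ex x φ ih =>
    intro d h hk
    simp only [nq] at h
    exact ⟨fun hd => hk.1 ((h d (by omega)).2 hd), ih (fun i hi => h i (by omega)) hk.2⟩

theorem letterStep_quant {t : State} (h : t.v .pend < 2) :
    letterStep 3 t = ((((((t.seta .kind (t.v .qs) (1 - t.v .pend)).seta .name (t.v .qs)
      (t.v .num)).seta .parent (t.v .qs) (t.v .scope)).setv .qs (t.v .qs + 1)).setv .scope
      (t.v .qs + 1)).setv .num 0).setv .pw 1 := by
  simp only [letterStep, sepCmd, quantCmd, Cmd.block, Cmd.den, ite_eval_ne]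
  simp [Ex.eval, h]

theorem letterStep_first {t : State} {e : ℕ} (h : 2 ≤ t.v .pend) (h' : t.v .pend < 4)
    (he : (hop (t.a .name) (t.a .parent) (t.v .num))^[t.v .len] (t.v .scope) = e + 1) :
    letterStep 3 t = ((((t.setv .cur (e + 1)).setv .fst e).setv .pend (t.v .pend + 2)).setv
      .num 0).setv .pw 1 := by
  simp only [letterStep, sepCmd, Cmd.block, Cmd.den, ite_eval_ne, den_searchCmd, he]
  simp [Ex.eval, h', not_lt.2 h]

theorem letterStep_second {t : State} {e : ℕ} (h : 4 ≤ t.v .pend)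
    (he : (hop (t.a .name) (t.a .parent) (t.v .num))^[t.v .len] (t.v .scope) = e + 1) :
    letterStep 3 t = (((((if t.v .pend = 5 then
      ((t.setv .cur (e + 1)).seta .reach (t.a .rowN (t.v .fst) + e) 1).seta .reach
        (t.a .rowN e + t.v .fst) 1
      else (t.setv .cur (e + 1)).seta .reach (t.a .rowN (t.v .fst) + e) 1).setv .sp
      (t.v .sp - 1)).setv .scope (t.a .stack (t.v .sp - 1))).setv .num 0).setv .pw 1) := by
  simp only [letterStep, sepCmd, Cmd.block, Cmd.den, ite_eval_ne, den_searchCmd, he, atomCmd,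
    Cmd.when]
  by_cases h5 : t.v .pend = 5
  · simp [Ex.eval, h5]
  · simp [Ex.eval, h5, not_lt.2 h, show ¬ t.v .pend < 2 by omega]

/-- The states between the parts of the sentence: no digits are pending, and the tables are
filled. -/
structure Ready (n : ℕ) (s : State) : Prop where
  num : s.v .num = 0
  pw : s.v .pw = 1
  len : s.v .len = n
  rowN : ∀ i ≤ n, s.a .rowN i = i * n
  parent : ∀ i < s.v .qs, s.a .parent i ≤ i

/-- The state `s'` after parsing the formula `φ` in the state `s`, where `env` gives the quantifiers
that bind the free variables. A formula ends with an atom, so the parser has then already taken the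
next scope from the stack. -/
structure Parsed (n : ℕ) (φ : CPFormula) (env : ℕ → ℕ) (s s' : State) : Prop where
  ready : Ready n s'
  qs : s'.v .qs = s.v .qs + φ.nq
  sp : s'.v .sp = s.v .sp - 1
  scope : s'.v .scope = s'.a .stack (s'.v .sp)
  stack : ∀ i < s.v .sp, s'.a .stack i = s.a .stack i
  kind : ∀ i < s.v .qs, s'.a .kind i = s.a .kind i
  name : ∀ i < s.v .qs, s'.a .name i = s.a .name i
  parent : ∀ i < s.v .qs, s'.a .parent i = s.a .parent i
  kinds : φ.Kinds (fun i => s'.a .kind i ≠ 0) (s.v .qs)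
  reach : ∀ a < n, ∀ b < n, s'.a .reach (a * n + b) ≠ 0 ↔
    s.a .reach (a * n + b) ≠ 0 ∨ φ.Edge env (s.v .qs) a b

theorem mul_add_inj {n a b a' b' : ℕ} (hb : b < n) (hb' : b' < n) :
    a * n + b = a' * n + b' ↔ a = a' ∧ b = b' := by
  constructor
  · intro h
    have h2 := congrArg (· / n) h
    have hn : 0 < n := by omega
    simp only [Nat.add_comm (_ * n), Nat.add_mul_div_right _ _ hn, Nat.div_eq_of_lt hb,
      Nat.div_eq_of_lt hb', Nat.zero_add] at h2
    subst h2
    exact ⟨rfl, by omega⟩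
  · rintro ⟨rfl, rfl⟩; rfl

theorem Ready.setv {n : ℕ} {s : State} (h : Ready n s) (w : ℕ) : Ready n (s.setv .pend w) where
  num := by simp [h.num]
  pw := by simp [h.pw]
  len := by simp [h.len]
  rowN := h.rowN
  parent := by simpa using h.parent

/-- Parsing of the two variables of an atom. -/
theorem parsed_atom {n : ℕ} {s : State} (hs : Ready n s) (hsc : s.v .scope ≤ s.v .qs)
    (hq : s.v .qs ≤ n) {x y e f : ℕ} (w : ℕ) (hw : w = 2 ∨ w = 3)
    (hx : Finds (s.a .name) (s.a .parent) x (s.v .scope) e)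
    (hy : Finds (s.a .name) (s.a .parent) y (s.v .scope) f) :
    ∃ s', lettersStep (encodeVar x ++ encodeVar y) (s.setv .pend w) = s' ∧ Ready n s' ∧
      s'.v .qs = s.v .qs ∧ s'.v .sp = s.v .sp - 1 ∧ s'.v .scope = s.a .stack (s.v .sp - 1) ∧
      s'.a .stack = s.a .stack ∧ s'.a .kind = s.a .kind ∧ s'.a .name = s.a .name ∧
      s'.a .parent = s.a .parent ∧ ∀ a < n, ∀ b < n, s'.a .reach (a * n + b) ≠ 0 ↔
        s.a .reach (a * n + b) ≠ 0 ∨ (a = e ∧ b = f) ∨ (w = 3 ∧ a = f ∧ b = e) := by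
  have he : e < n := by have := hx.lt; omega
  have hf : f < n := by have := hy.lt; omega
  obtain ⟨p, hp⟩ := lettersStep_encodeVar x (s.setv .pend w) (hs.setv w).num (hs.setv w).pw
  rw [lettersStep_append, hp, letterStep_first (e := e) (by simp; omega) (by simp; omega)
    (by simpa using hx.hop_iterate (by rw [hs.len]; omega))]
  set s1 := State.setv _ .pw 1 with hs1
  obtain ⟨p', hp'⟩ := lettersStep_encodeVar y s1 (by simp [hs1]) (by simp [hs1])
  rw [hp', letterStep_second (e := f) (by simp [hs1]; omega)
    (by simpa [hs1] using hy.hop_iterate (by rw [hs.len]; omega))]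
  refine ⟨_, rfl, ⟨by simp, by simp, ?_, ?_, ?_⟩, ?_, ?_, ?_, ?_, ?_, ?_, ?_, ?_⟩
  all_goals
    rcases hw with rfl | rfl
    all_goals simp only [hs1, State.setv_v, State.setv_a, State.seta_v, State.seta_a, reduceCtorEq,
      if_false, if_true, Nat.reduceAdd, Nat.reduceEqDiff, hs.len]
  · exact hs.rowN
  · exact hs.rowN
  · exact hs.parent
  · exact hs.parent
  · intro a ha b hb
    simp only [hs.rowN e he.le, Function.update_apply, mul_add_inj hb hf, false_and, or_false]
    by_cases h : a = e ∧ b = f <;> simp [h]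
  · intro a ha b hb
    simp only [hs.rowN e he.le, hs.rowN f hf.le, Function.update_apply, mul_add_inj hb hf,
      mul_add_inj hb he, true_and]
    by_cases h : a = e ∧ b = f <;> by_cases h' : a = f ∧ b = e <;> simp [h, h']

/-- Parsing of a quantifier with its variable. -/
theorem parsed_quant {n : ℕ} {s : State} (hs : Ready n s) (hsc : s.v .scope ≤ s.v .qs) {x : ℕ}
    (w : ℕ) (hw : w < 2) :
    ∃ s', lettersStep (encodeVar x) (s.setv .pend w) = s' ∧ Ready n s' ∧
      s'.v .qs = s.v .qs + 1 ∧ s'.v .sp = s.v .sp ∧ s'.v .scope = s.v .qs + 1 ∧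
      s'.a .stack = s.a .stack ∧ s'.a .kind = Function.update (s.a .kind) (s.v .qs) (1 - w) ∧
      s'.a .name = Function.update (s.a .name) (s.v .qs) x ∧
      s'.a .parent = Function.update (s.a .parent) (s.v .qs) (s.v .scope) ∧
      s'.a .reach = s.a .reach := by
  obtain ⟨p, hp⟩ := lettersStep_encodeVar x (s.setv .pend w) (hs.setv w).num (hs.setv w).pw
  rw [hp, letterStep_quant (by simpa using hw)]
  refine ⟨_, rfl, ⟨by simp, by simp, by simp [hs.len], by simpa using hs.rowN, ?_⟩, ?_⟩
  · simp only [State.setv_v, State.setv_a, State.seta_v, State.seta_a, reduceCtorEq,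
      if_false, if_true, Function.update_apply]
    intro i hi
    by_cases h : i = s.v .qs
    · simpa [h] using hsc
    · simpa [h] using hs.parent i (by omega)
  · simp

theorem finds_update {s s' : State} {x y e : ℕ} (hname : s'.a .name = Function.update (s.a .name)
      (s.v .qs) x)
    (hparent : s'.a .parent = Function.update (s.a .parent) (s.v .qs) (s.v .scope))
    (hsc : s.v .scope ≤ s.v .qs) (hxy : y ≠ x)
    (h : Finds (s.a .name) (s.a .parent) y (s.v .scope) e) :
    Finds (s'.a .name) (s'.a .parent) y (s.v .qs + 1) e := by
  refine .up (by simp [hname, hxy.symm]) (by simpa [hparent] using hsc) ?_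
  rw [show s'.a .parent (s.v .qs) = s.v .scope by simp [hparent]]
  refine h.congr hsc (fun i hi => ?_) fun i hi => ?_
  · rw [hname, Function.update_of_ne hi.ne]
  · rw [hparent, Function.update_of_ne hi.ne]

/-- The parser is correct, for formulas whose free variables are found in the current scope. -/
theorem parsed_formula {n : ℕ} (φ : CPFormula) : ∀ {s : State} {env : ℕ → ℕ}, Ready n s →
    s.v .scope ≤ s.v .qs → s.v .qs + φ.nq ≤ n →
    (∀ y ∈ φ.freeVars, Finds (s.a .name) (s.a .parent) y (s.v .scope) (env y)) →
    Parsed n φ env s (lettersStep φ.encode s) := by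
  induction φ with
  | le x y =>
    intro s env hs hsc hq hF
    obtain ⟨s', h, h1, h2, h3, h4, h5, h6, h7, h8, h9⟩ := parsed_atom hs hsc hq 2 (.inl rfl)
      (hF x (by simp [CPFormula.freeVars])) (hF y (by simp [CPFormula.freeVars]))
    rw [CPFormula.encode, lettersStep_cons, show letterStep Letter.leSym.code s = s.setv .pend 2
      from rfl, h]
    exact ⟨h1, h2, h3, by rw [h4, h5, h3], by simp [h5], by simp [h6], by simp [h7], by simp [h8],
      trivial, fun a ha b hb => by simpa [CPFormula.Edge] using h9 a ha b hb⟩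
  | eq x y =>
    intro s env hs hsc hq hF
    obtain ⟨s', h, h1, h2, h3, h4, h5, h6, h7, h8, h9⟩ := parsed_atom hs hsc hq 3 (.inr rfl)
      (hF x (by simp [CPFormula.freeVars])) (hF y (by simp [CPFormula.freeVars]))
    rw [CPFormula.encode, lettersStep_cons, show letterStep Letter.eqSym.code s = s.setv .pend 3
      from rfl, h]
    exact ⟨h1, h2, h3, by rw [h4, h5, h3], by simp [h5], by simp [h6], by simp [h7], by simp [h8],
      trivial, fun a ha b hb => by simpa [CPFormula.Edge] using h9 a ha b hb⟩
  | and φ ψ ihφ ihψ =>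
    intro s env hs hsc hq hF
    simp only [CPFormula.nq] at hq
    rw [CPFormula.encode, lettersStep_cons, lettersStep_append]
    set s0 := letterStep Letter.andSym.code s with hs0
    have e0 : s0 = (s.seta .stack (s.v .sp) (s.v .scope)).setv .sp (s.v .sp + 1) := rfl
    have P1 : Parsed n φ env s0 (lettersStep φ.encode s0) := by
      refine ihφ ⟨by simp [e0, hs.num], by simp [e0, hs.pw], by simp [e0, hs.len],
        by simpa [e0] using hs.rowN, by simpa [e0] using hs.parent⟩ (by simpa [e0] using hsc)
        (by simp [e0]; omega) fun y hy => ?_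
      simpa [e0] using hF y (by simp [CPFormula.freeVars, hy])
    set s1 := lettersStep φ.encode s0
    have q1 : s1.v .qs = s.v .qs + φ.nq := by simpa [e0] using P1.qs
    have sp1 : s1.v .sp = s.v .sp := by simpa [e0] using P1.sp
    have sc1 : s1.v .scope = s.v .scope := by
      rw [P1.scope, sp1, P1.stack _ (by simp [e0])]; simp [e0]
    have k1 : ∀ i < s.v .qs, s1.a .kind i = s.a .kind i := by simpa [e0] using P1.kind
    have n1 : ∀ i < s.v .qs, s1.a .name i = s.a .name i := by simpa [e0] using P1.name
    have p1 : ∀ i < s.v .qs, s1.a .parent i = s.a .parent i := by simpa [e0] using P1.parent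
    have P2 : Parsed n ψ env s1 (lettersStep ψ.encode s1) := by
      refine ihψ P1.ready (by omega) (by omega) fun y hy => ?_
      rw [sc1]
      exact (hF y (by simp [CPFormula.freeVars, hy])).congr hsc n1 p1
    refine ⟨P2.ready, by rw [P2.qs, q1, CPFormula.nq]; omega, by rw [P2.sp, sp1], P2.scope,
      fun i hi => ?_, fun i hi => ?_, fun i hi => ?_, fun i hi => ?_, ⟨?_, ?_⟩, fun a ha b hb => ?_⟩
    · rw [P2.stack i (by omega), P1.stack i (by simp [e0]; omega)]
      simp [e0, hi.ne]
    · rw [P2.kind i (by omega), k1 i hi]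
    · rw [P2.name i (by omega), n1 i hi]
    · rw [P2.parent i (by omega), p1 i hi]
    · have := P1.kinds
      simp only [e0, State.setv_v, State.seta_v, reduceCtorEq, if_false] at this
      refine CPFormula.Kinds.congr φ (fun i hi => ?_) this
      rw [P2.kind i (by omega)]
    · rw [← q1]; exact P2.kinds
    · rw [P2.reach a ha b hb, P1.reach a ha b hb, q1]
      simp [e0, CPFormula.Edge, or_assoc]
  | all x φ ih =>
    intro s env hs hsc hq hF
    simp only [CPFormula.nq] at hq
    obtain ⟨s1, h, h1, h2, h3, h4, h5, h6, h7, h8, h9⟩ := parsed_quant (x := x) hs hsc 0 (by omega)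
    rw [CPFormula.encode, lettersStep_cons, lettersStep_append,
      show letterStep Letter.forallSym.code s = s.setv .pend 0 from rfl, h]
    have P := ih (s := s1) (env := Function.update env x (s.v .qs)) h1 (by omega) (by omega)
      fun y hy => by
        rw [h4]
        by_cases hxy : y = x
        · subst hxy
          rw [Function.update_self]
          exact .here (by simp [h7])
        · rw [Function.update_of_ne hxy]
          exact finds_update h7 h8 hsc hxy (hF y (Finset.mem_erase.2 ⟨hxy, hy⟩))
    refine ⟨P.ready, by rw [P.qs, h2, CPFormula.nq]; omega, by rw [P.sp, h3], P.scope,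
      fun i hi => by rw [P.stack i (by omega), h5],
      fun i hi => by rw [P.kind i (by omega), h6, Function.update_of_ne hi.ne],
      fun i hi => by rw [P.name i (by omega), h7, Function.update_of_ne hi.ne],
      fun i hi => by rw [P.parent i (by omega), h8, Function.update_of_ne hi.ne],
      ⟨?_, by rw [← h2]; exact P.kinds⟩, fun a ha b hb => ?_⟩
    · show (lettersStep φ.encode s1).a .kind (s.v .qs) ≠ 0
      rw [P.kind _ (by omega), h6]; simp
    · rw [P.reach a ha b hb, h9, h2]; rfl
  | ex x φ ih =>
    intro s env hs hsc hq hF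
    simp only [CPFormula.nq] at hq
    obtain ⟨s1, h, h1, h2, h3, h4, h5, h6, h7, h8, h9⟩ := parsed_quant (x := x) hs hsc 1 (by omega)
    rw [CPFormula.encode, lettersStep_cons, lettersStep_append,
      show letterStep Letter.existsSym.code s = s.setv .pend 1 from rfl, h]
    have P := ih (s := s1) (env := Function.update env x (s.v .qs)) h1 (by omega) (by omega)
      fun y hy => by
        rw [h4]
        by_cases hxy : y = x
        · subst hxy
          rw [Function.update_self]
          exact .here (by simp [h7])
        · rw [Function.update_of_ne hxy]
          exact finds_update h7 h8 hsc hxy (hF y (Finset.mem_erase.2 ⟨hxy, hy⟩))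
    refine ⟨P.ready, by rw [P.qs, h2, CPFormula.nq]; omega, by rw [P.sp, h3], P.scope,
      fun i hi => by rw [P.stack i (by omega), h5],
      fun i hi => by rw [P.kind i (by omega), h6, Function.update_of_ne hi.ne],
      fun i hi => by rw [P.name i (by omega), h7, Function.update_of_ne hi.ne],
      fun i hi => by rw [P.parent i (by omega), h8, Function.update_of_ne hi.ne],
      ⟨?_, by rw [← h2]; exact P.kinds⟩, fun a ha b hb => ?_⟩
    · show ¬ (lettersStep φ.encode s1).a .kind (s.v .qs) ≠ 0
      rw [P.kind _ (by omega), h6]; simp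
    · rw [P.reach a ha b hb, h9, h2]; rfl

/-! ### Preparation of the game -/

/-- The relation on the quantifiers that is stored in the state. -/
def State.rel (s : State) (a b : ℕ) : Prop := a < s.v .qs ∧ b < s.v .qs ∧
  s.a .reach (s.a .rowN a + b) ≠ 0

/-- The cells of the matrix of the relation are different. -/
def State.Cells (s : State) : Prop := ∀ a < s.v .qs, ∀ b < s.v .qs, ∀ a' < s.v .qs, ∀ b' < s.v .qs,
  s.a .rowN a + b = s.a .rowN a' + b' ↔ a = a' ∧ b = b'

theorem true_reachEx (x : List Letter) (s : State) (β : List ℕ) (i j : Ex) :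
    (reachEx i j).True x s β ↔ s.a .reach (s.a .rowN (i.eval x s β) + j.eval x s β) ≠ 0 := Iff.rfl

theorem rel_seta {s : State} (hs : s.Cells) {i j : ℕ} (hi : i < s.v .qs) (hj : j < s.v .qs)
    (a b : ℕ) : (s.seta .reach (s.a .rowN i + j) 1).rel a b ↔ s.rel a b ∨ (a = i ∧ b = j) := by
  simp only [State.rel, State.seta_v, State.seta_a, reduceCtorEq, if_false, if_true,
    Function.update_apply]
  by_cases hab : a < s.v .qs ∧ b < s.v .qs
  · simp only [hs a hab.1 b hab.2 i hi j hj]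
    by_cases h : a = i ∧ b = j <;> simp [hab, h, hi, hj]
  · constructor
    · rintro ⟨h1, h2, -⟩; exact absurd ⟨h1, h2⟩ hab
    · rintro (⟨h1, h2, -⟩ | ⟨rfl, rfl⟩)
      exacts [absurd ⟨h1, h2⟩ hab, absurd ⟨hi, hj⟩ hab]

open Classical in
theorem den_cellCmd (x : List Letter) {s : State} {i j k : ℕ} (hi : i < s.v .qs) (hj : j < s.v .qs)
    (hk : k < s.v .qs) : cellCmd.den x [j, i, k] s =
      if s.rel i k ∧ s.rel k j then s.seta .reach (s.a .rowN i + j) 1 else s := by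
  simp only [cellCmd, Cmd.when, Cmd.den, ite_eval_ne]
  simp only [Ex.true_and, true_reachEx, Ex.eval, List.getD_cons_zero, List.getD_cons_succ,
    State.rel, hi, hj, hk, true_and]

/-- One round of Warshall's algorithm. -/
theorem closure_round (x : List Letter) {s : State} (hs : s.Cells) {k : ℕ} (hk : k < s.v .qs) :
    ∃ s', Cmd.den x (.loop .qs (.loop .qs cellCmd)) [k] s = s' ∧ s'.v = s.v ∧
      (∀ c, c ≠ .reach → s'.a c = s.a c) ∧
      ∀ a b, s'.rel a b ↔ s.rel a b ∨ (s.rel a k ∧ s.rel k b) := by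
  have row : ∀ i < s.v .qs, ∀ s1 : State, (s1.v = s.v ∧ (∀ c, c ≠ .reach → s1.a c = s.a c) ∧
      ∀ a b, s1.rel a b ↔ s.rel a b ∨ (a < i ∧ s.rel a k ∧ s.rel k b)) →
      ∀ s2, iter (fun j s => cellCmd.den x [j, i, k] s) (s.v .qs) s1 = s2 →
      (s2.v = s.v ∧ (∀ c, c ≠ .reach → s2.a c = s.a c) ∧
      ∀ a b, s2.rel a b ↔ s.rel a b ∨ (a < i + 1 ∧ s.rel a k ∧ s.rel k b)) := by
    rintro i hi s1 ⟨hv, ha, hrel⟩ _ rfl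
    have := iter_induction (f := fun j s => cellCmd.den x [j, i, k] s) (n := s.v .qs) (s := s1)
      (fun j s2 => s2.v = s.v ∧ (∀ c, c ≠ .reach → s2.a c = s.a c) ∧
        ∀ a b, s2.rel a b ↔ s.rel a b ∨ ((a < i ∨ a = i ∧ b < j) ∧ s.rel a k ∧ s.rel k b))
      ⟨hv, ha, fun a b => by simp [hrel]⟩ ?_
    · refine ⟨this.1, this.2.1, fun a b => (this.2.2 a b).trans (or_congr_right ?_)⟩
      constructor
      · rintro ⟨h, h1, h2⟩; exact ⟨by omega, h1, h2⟩
      · rintro ⟨h, h1, h2⟩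
        have := h2.2.1
        exact ⟨by omega, h1, h2⟩
    · rintro j s2 hj ⟨hv, ha, hrel⟩
      rw [den_cellCmd x (by rwa [hv]) (by rwa [hv]) (by rwa [hv])]
      -- row and column `k` do not change in this round
      have e1 : s2.rel i k ↔ s.rel i k := by rw [hrel]; tauto
      have e2 : s2.rel k j ↔ s.rel k j := by rw [hrel]; tauto
      rw [e1, e2]
      split_ifs with hc
      · refine ⟨hv, fun c hc => by simp [hc, ha], fun a b => ?_⟩
        rw [rel_seta (by simpa [State.Cells, hv, ha] using hs) (by rwa [hv]) (by rwa [hv]), hrel,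
          or_assoc]
        refine or_congr_right ?_
        constructor
        · rintro (⟨h, h1⟩ | ⟨rfl, rfl⟩)
          exacts [⟨by omega, h1⟩, ⟨by omega, hc⟩]
        · rintro ⟨h, h1⟩
          by_cases h2 : a = i ∧ b = j
          exacts [.inr h2, .inl ⟨by omega, h1⟩]
      · refine ⟨hv, ha, fun a b => ?_⟩
        rw [hrel]
        refine or_congr_right ?_
        constructor
        · rintro ⟨h, h1⟩; exact ⟨by omega, h1⟩
        · rintro ⟨h, h1⟩
          refine ⟨?_, h1⟩
          by_contra hcon
          obtain ⟨rfl, rfl⟩ : a = i ∧ b = j := by omega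
          exact hc h1
  have := iter_induction (f := fun i s => Cmd.den x (.loop .qs cellCmd) [i, k] s) (n := s.v .qs)
    (s := s)
    (fun i s2 => s2.v = s.v ∧ (∀ c, c ≠ .reach → s2.a c = s.a c) ∧
        ∀ a b, s2.rel a b ↔ s.rel a b ∨ (a < i ∧ s.rel a k ∧ s.rel k b))
    ⟨rfl, fun _ _ => rfl, fun a b => by simp⟩ ?_
  · refine ⟨_, rfl, this.1, this.2.1, fun a b => (this.2.2 a b).trans (or_congr_right ?_)⟩
    exact ⟨fun h => h.2, fun h => ⟨h.1.1, h⟩⟩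
  · intro i s2 hi h2
    refine row i hi s2 h2 _ ?_
    rw [Cmd.den, h2.1]

/-- Warshall's algorithm: after `k` rounds, the relation is closed under paths through indices below
`k`. -/
theorem den_closureCmd (x : List Letter) {s : State} (hs : s.Cells) :
    ∃ s', closureCmd.den x [] s = s' ∧ s'.v = s.v ∧ (∀ c, c ≠ .reach → s'.a c = s.a c) ∧
      (∀ a b c, s'.rel a b → s'.rel b c → s'.rel a c) ∧ (∀ a b, s.rel a b → s'.rel a b) ∧
      ∀ a b, s'.rel a b → Relation.TransGen s.rel a b := by
  have := iter_induction (f := fun k s => Cmd.den x (.loop .qs (.loop .qs cellCmd)) [k] s)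
    (n := s.v .qs) (s := s) (fun k s' => s'.v = s.v ∧ (∀ c, c ≠ .reach → s'.a c = s.a c) ∧
      (∀ a, ∀ b < k, ∀ c, s'.rel a b → s'.rel b c → s'.rel a c) ∧
      (∀ a b, s.rel a b → s'.rel a b) ∧ ∀ a b, s'.rel a b → Relation.TransGen s.rel a b)
    ⟨rfl, fun _ _ => rfl, by simp, by simp, fun a b h => .single h⟩ ?_
  · obtain ⟨h1, h2, h3, h4, h5⟩ := this
    exact ⟨_, rfl, h1, h2, fun a b c hab => h3 a b (h1 ▸ hab.2.1) c hab, h4, h5⟩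
  · rintro k s1 hk ⟨h1, h2, h3, h4, h5⟩
    obtain ⟨s2, he, g1, g2, g3⟩ := closure_round x (s := s1) (k := k)
      (by simpa [State.Cells, h1, h2] using hs) (by simpa [h1] using hk)
    simp only [he]
    refine ⟨g1.trans h1, fun c hc => (g2 c hc).trans (h2 c hc), fun a b hb c => ?_,
      fun a b h => (g3 a b).2 (.inl (h4 a b h)), fun a b h => ?_⟩
    · simp only [g3]
      rcases Nat.lt_succ_iff_lt_or_eq.1 hb with hb | rfl
      · have ha := h3 a b hb c
        have hb1 := h3 a b hb k
        have hb2 := h3 k b hb c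
        tauto
      · tauto
    · rcases (g3 a b).1 h with h | ⟨h, h'⟩
      exacts [h5 _ _ h, (h5 _ _ h).trans (h5 _ _ h')]

theorem den_repCmd (x : List Letter) (s : State) :
    ∃ s', repCmd.den x [] s = s' ∧ s'.v = s.v ∧ (∀ c, c ≠ .rep → s'.a c = s.a c) ∧
      IsRep (fun i => s.a .kind i ≠ 0) s.rel (s.v .qs) (s'.a .rep) := by
  set r := s.v .qs with hr
  let cond : ℕ → ℕ → Prop := fun i y => s.a .kind y ≠ 0 ∧ s.rel i y ∧ s.rel y i
  have := iter_induction (f := fun i s => Cmd.den x (.seq (.seta .rep (.bv 0) (.bv 0)) (.loop .qs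
    (.when (.and (.arr .kind (.bv 0)) (.and (reachEx (.bv 1) (.bv 0)) (reachEx (.bv 0) (.bv 1))))
    (.seta .rep (.bv 1) (.bv 0))))) [i] s) (n := r) (s := s)
    (fun k s' => s'.v = s.v ∧ (∀ c, c ≠ .rep → s'.a c = s.a c) ∧
      ∀ i < k, (s'.a .rep i = i ∧ ∀ y < r, ¬ cond i y) ∨ cond i (s'.a .rep i))
    ⟨rfl, fun _ _ => rfl, by simp⟩ ?_
  · refine ⟨_, rfl, this.1, this.2.1, fun i hi => (this.2.2 i hi).imp (fun h => ⟨h.1, ?_⟩) id⟩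
    exact fun y h1 h2 h3 => absurd ⟨h1, h2, h3⟩ (h.2 y h2.2.1)
  · rintro i s1 hi ⟨hv, ha, hrep⟩
    have inner := iter_induction (f := fun y s => Cmd.den x (
      .when (.and (.arr .kind (.bv 0)) (.and (reachEx (.bv 1) (.bv 0)) (reachEx (.bv 0) (.bv 1))))
      (.seta .rep (.bv 1) (.bv 0))) [y, i] s) (n := r) (s := s1.seta .rep i i)
      (fun k s' => s'.v = s.v ∧ (∀ c, c ≠ .rep → s'.a c = s.a c) ∧
        (∀ i' < i, s'.a .rep i' = s1.a .rep i') ∧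
        ((s'.a .rep i = i ∧ ∀ y < k, ¬ cond i y) ∨ cond i (s'.a .rep i)))
      ⟨hv, fun c hc => by simp [hc, ha], fun i' hi' => by simp [hi'.ne], .inl (by simp)⟩ ?_
    · simp only [Cmd.den, Ex.eval, List.getD_cons_zero]
      rw [show (s1.seta .rep i i).v .qs = r by simp [hv, hr]]
      refine ⟨inner.1, inner.2.1, fun i' hi' => ?_⟩
      rcases Nat.lt_succ_iff_lt_or_eq.1 hi' with h | rfl
      · rw [inner.2.2.1 i' h]; exact hrep i' h
      · exact inner.2.2.2
    · rintro y s2 hy ⟨hv2, ha2, h3, h4⟩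
      simp only [Cmd.when, Cmd.den, ite_eval_ne]
      simp only [Ex.true_and, true_reachEx, true_arr, Ex.eval, List.getD_cons_zero,
        List.getD_cons_succ, ha2 .kind (by simp), ha2 .reach (by simp), ha2 .rowN (by simp)]
      have hcond : (s.a .kind y ≠ 0 ∧ s.a .reach (s.a .rowN i + y) ≠ 0 ∧
          s.a .reach (s.a .rowN y + i) ≠ 0) ↔ cond i y := by
        simp [cond, State.rel, ← hr, hi, hy]
      split_ifs with hc <;> rw [hcond] at hc
      · refine ⟨hv2, fun c hc => by simp [hc, ha2], fun i' hi' => by simp [hi'.ne, h3 i' hi'],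
          .inr (by simpa using hc)⟩
      · refine ⟨hv2, ha2, h3, h4.imp_left fun h => ⟨h.1, fun y' hy' => ?_⟩⟩
        rcases Nat.lt_succ_iff_lt_or_eq.1 hy' with h' | rfl
        exacts [h.2 y' h', hc]

/-- The elements of `P` are `el 0`, …, `el (m - 1)`, where `m` is the size in the state `s`, and `x`
begins with the matrix of their order. -/
structure Listed {P : Type*} [PartialOrder P] (x : List Letter) (s : State) (el : ℕ → P) :
    Prop where
  surj : ∀ p, ∃ i < s.v .size, el i = p
  inj : ∀ i < s.v .size, ∀ j < s.v .size, el i = el j → i = j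
  le : ∀ i < s.v .size, ∀ j < s.v .size, letterAt x (s.a .rowM i + j) = 2 ↔ el i ≤ el j

section Listed

variable {P : Type*} [PartialOrder P] {x : List Letter} {s : State} {el : ℕ → P}

theorem true_leEx (β : List ℕ) (e f : Ex) : (leEx e f).True x s β ↔
    letterAt x (s.a .rowM (e.eval x s β) + f.eval x s β) = 2 := by
  simp [leEx, Ex.eval]

theorem Listed.of_eq {s' : State} (h : Listed x s el) (h1 : s'.v .size = s.v .size)
    (h2 : s'.a .rowM = s.a .rowM) : Listed x s' el :=
  ⟨by rw [h1]; exact h.surj, by rw [h1]; exact h.inj, by rw [h1, h2]; exact h.le⟩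

theorem Listed.forall_iff (h : Listed x s el) {A : ℕ → Prop} {B : P → Prop}
    (hAB : ∀ i < s.v .size, A i ↔ B (el i)) : (∀ i < s.v .size, A i) ↔ ∀ p, B p := by
  refine ⟨fun hA p => ?_, fun hB i hi => (hAB i hi).2 (hB _)⟩
  obtain ⟨i, hi, rfl⟩ := h.surj p
  exact (hAB i hi).1 (hA i hi)

theorem Listed.exists_iff (h : Listed x s el) {A : ℕ → Prop} {B : P → Prop}
    (hAB : ∀ i < s.v .size, A i ↔ B (el i)) : (∃ i < s.v .size, A i) ↔ ∃ p, B p := by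
  refine ⟨fun ⟨i, hi, hA⟩ => ⟨_, (hAB i hi).1 hA⟩, fun ⟨p, hp⟩ => ?_⟩
  obtain ⟨i, hi, rfl⟩ := h.surj p
  exact ⟨i, hi, (hAB i hi).2 hp⟩

theorem den_checkCmd (h : Listed x s el) :
    ∃ s', checkCmd.den x [] s = s' ∧ s'.a = s.a ∧ (∀ i, i ≠ .bad → i ≠ .triv → s'.v i = s.v i) ∧
      (s'.v .bad ≠ 0 ↔ Viol (fun i => s.a .kind i ≠ 0) s.rel) ∧
      (s'.v .triv ≠ 0 ↔ (∃ p : P, ∀ q, p ≤ q) ∧ ∃ p : P, ∀ q, q ≤ p) := by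
  refine ⟨_, rfl, rfl, fun i h1 h2 => Cmd.den_v x checkCmd (by simp [checkCmd, Cmd.modv, h1, h2])
    [] s, ?_, ?_⟩
  · simp only [checkCmd, Cmd.den, State.setv_v, reduceCtorEq, if_false, if_true]
    rw [show ∀ e : Ex, (e.eval x s [] ≠ 0) = e.True x s [] from fun _ => rfl]
    simp only [Ex.true_ex, Ex.true_and, Ex.true_not, Ex.true_or, Ex.true_eq, Ex.true_lt, bv_one,
      bv_zero, true_arr, true_reachEx, Viol, State.rel]
    refine exists_congr fun y => ⟨?_, ?_⟩
    · rintro ⟨hy, z, hz, h⟩; exact ⟨z, by tauto⟩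
    · rintro ⟨z, h⟩; exact ⟨by tauto, z, by tauto⟩
  · simp only [checkCmd, Cmd.den, State.setv_v, reduceCtorEq, if_false, if_true]
    set s0 := s.setv .bad _
    have h0 : Listed x s0 el := h.of_eq rfl rfl
    rw [show ∀ e : Ex, (e.eval x s0 [] ≠ 0) = e.True x s0 [] from fun _ => rfl]
    simp only [Ex.true_ex, Ex.true_and, Ex.true_all, bv_one, bv_zero, true_leEx]
    refine and_congr (h0.exists_iff fun i hi => h0.forall_iff fun j hj => h0.le i hi j hj)
      (h0.exists_iff fun i hi => h0.forall_iff fun j hj => h0.le j hj i hi)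

theorem true_levelEx (h : Listed x s el) {t : ℕ}
    (hc : ∀ p < s.v .size, s.a .cand p ≠ 0 ↔ el p ∈ lvl P t) {p : ℕ} (hp : p < s.v .size) :
    levelEx.True x s [p] ↔ el p ∈ lvl P (t + 1) := by
  simp only [levelEx, Ex.true_ex, Ex.true_and, Ex.true_not, Ex.true_or, Ex.true_eq, Ex.true_all,
    bv_zero, bv_one, bv_two, true_leEx, true_arr]
  refine or_congr (h.forall_iff fun q hq => ?_) (h.forall_iff fun q hq => ?_)
  · rw [h.exists_iff (B := fun s => s ∈ lvl P t ∧ s ≤ el p ∧ ¬ s ≤ el q) fun i hi => by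
      rw [hc i hi, h.le i hi p hp, h.le i hi q hq], h.le q hq p hp, ← imp_iff_not_or,
      lt_iff_le_and_ne, ne_eq]
    exact imp_congr_left (and_congr_right fun _ =>
      not_congr ⟨fun h => h ▸ rfl, fun h' => h.inj _ hq _ hp h'⟩)
  · rw [h.exists_iff (B := fun s => s ∈ lvl P t ∧ el p ≤ s ∧ ¬ el q ≤ s) fun i hi => by
      rw [hc i hi, h.le p hp i hi, h.le q hq i hi], h.le p hp q hq, ← imp_iff_not_or,
      lt_iff_le_and_ne, ne_eq]
    exact imp_congr_left (and_congr_right fun _ =>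
      not_congr ⟨fun h => h ▸ rfl, fun h' => (h.inj _ hp _ hq h').symm⟩)

/-- A loop that fills an array. -/
theorem iter_seta (b : Arr) (F : ℕ → State → State) (f : ℕ → ℕ) (s : State) (n : ℕ)
    (h : ∀ j s', j < n → s'.v = s.v → (∀ c, c ≠ b → s'.a c = s.a c) → F j s' = s'.seta b j (f j)) :
    (iter F n s).v = s.v ∧ (∀ c, c ≠ b → (iter F n s).a c = s.a c) ∧
      ∀ j < n, (iter F n s).a b j = f j := by
  refine iter_induction (fun k (s' : State) => s'.v = s.v ∧ (∀ c, c ≠ b → s'.a c = s.a c) ∧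
    ∀ j < k, s'.a b j = f j) ⟨rfl, fun _ _ => rfl, by simp⟩ ?_
  rintro j s' hj ⟨h1, h2, h3⟩
  rw [h j s' hj h1 h2]
  refine ⟨h1, fun c hc => by simp [hc, h2], fun i hi => ?_⟩
  by_cases hij : i = j
  · simp [hij]
  · simp [hij, h3 i (by omega)]

theorem den_candCmd (h : Listed x s el) (h0 : ∀ p, s.a .cand p = 0) :
    ∃ s', candCmd.den x [] s = s' ∧ s'.v = s.v ∧
      (∀ c, c ≠ .cand → c ≠ .cand' → s'.a c = s.a c) ∧
      ∀ p < s.v .size, s'.a .cand p ≠ 0 ↔ el p ∈ lvl P (s.v .lv) := by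
  refine ⟨_, rfl, ?_⟩
  rw [candCmd, Cmd.den]
  refine iter_induction (fun t (s' : State) => s'.v = s.v ∧
      (∀ c, c ≠ Arr.cand → c ≠ Arr.cand' → s'.a c = s.a c) ∧
      ∀ p < s.v .size, s'.a .cand p ≠ 0 ↔ el p ∈ lvl P t) ⟨rfl, by simp, by simp [h0, lvl]⟩ ?_
  rintro t s1 - ⟨hv, ha, hc⟩
  have hl1 : Listed x s1 el := h.of_eq (by rw [hv]) (ha _ (by simp) (by simp))
  simp only [Cmd.den]
  have A := iter_seta .cand' (fun j s => s.seta .cand' ((Ex.bv 0).eval x s [j, t])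
    (levelEx.eval x s [j, t])) (fun j => levelEx.eval x s1 [j]) s1 (s1.v .size) ?_
  · set s2 := iter (fun j s => s.seta .cand' ((Ex.bv 0).eval x s [j, t])
      (levelEx.eval x s [j, t])) (s1.v .size) s1
    obtain ⟨A1, A2, A3⟩ := A
    have B := iter_seta .cand (fun j s => s.seta .cand ((Ex.bv 0).eval x s [j, t])
      ((Ex.arr .cand' (.bv 0)).eval x s [j, t])) (fun j => s2.a .cand' j) s2 (s2.v .size)
      fun j s' _ h1 h2 => by simp [Ex.eval, h2]
    obtain ⟨B1, B2, B3⟩ := B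
    refine ⟨by rw [B1, A1, hv], fun c h1 h2 => by rw [B2 c h1, A2 c h2, ha c h1 h2],
      fun p hp => ?_⟩
    rw [← hv] at hp hc
    rw [B3 p (by rwa [A1]), A3 p hp]
    exact true_levelEx hl1 hc hp
  · intro j s' _ h1 h2
    have : levelEx.eval x s' [j, t] = levelEx.eval x s1 [j] := by
      simp [levelEx, leEx, Ex.eval, Ex.not, Ex.and, Ex.or, Ex.lt, Ex.eq, Ex.ex, h1, h2]
    simp [this]

/-- The elements `p` and `q` have the same relations to the elements of `B`. -/
def SameType (B : Set P) (p q : P) : Prop := ∀ s ∈ B, (s ≤ q ↔ s ≤ p) ∧ (q ≤ s ↔ p ≤ s)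

theorem true_eq_iff {e f : Ex} {β : List ℕ} (he : ∃ e', e = Ex.not e') (hf : ∃ f', f = Ex.not f') :
    (e.eq f).True x s β ↔ (e.True x s β ↔ f.True x s β) := by
  obtain ⟨e, rfl⟩ := he
  obtain ⟨f, rfl⟩ := hf
  simp [Ex.True, Ex.eq, Ex.not, Ex.lt, Ex.eval]; omega

theorem den_repsCmd (h : Listed x s el) {B : Set P}
    (hc : ∀ p < s.v .size, s.a .cand p ≠ 0 ↔ el p ∈ B) :
    ∃ s', repsCmd.den x [] s = s' ∧ s'.v = s.v ∧ (∀ c, c ≠ .reps → s'.a c = s.a c) ∧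
      ∀ p < s.v .size, s'.a .reps p ≠ 0 ↔ ∀ q < p, ¬ SameType B (el p) (el q) := by
  have A := iter_seta .reps (fun j s => s.seta .reps ((Ex.bv 0).eval x s [j])
      (repsEx.eval x s [j])) (fun j => repsEx.eval x s [j]) s (s.v .size) ?_
  · refine ⟨_, rfl, A.1, A.2.1, fun p hp => ?_⟩
    refine (iff_of_eq (congrArg (· ≠ 0) (A.2.2 p hp))).trans ?_
    change repsEx.True x s [p] ↔ _
    have hle : ∀ e f : Ex, ∃ e', leEx e f = Ex.not e' := fun e f => ⟨_, rfl⟩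
    simp only [repsEx, Ex.true_ex, Ex.true_and, Ex.true_not, Ex.true_or, Ex.true_lt, Ex.true_all,
      true_eq_iff (hle _ _) (hle _ _), bv_zero, bv_one, bv_two, true_leEx, true_arr]
    have key : ∀ q < s.v .size, (∃ i < s.v .size, s.a .cand i ≠ 0 ∧
        ¬ ((letterAt x (s.a .rowM i + p) = 2 ↔ letterAt x (s.a .rowM i + q) = 2) ∧
        (letterAt x (s.a .rowM p + i) = 2 ↔ letterAt x (s.a .rowM q + i) = 2))) ↔
        ¬ SameType B (el p) (el q) := by
      intro q hq
      rw [h.exists_iff (B := fun s => s ∈ B ∧ ¬ ((s ≤ el p ↔ s ≤ el q) ∧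
        (el p ≤ s ↔ el q ≤ s))) fun i hi => by
        rw [hc i hi, h.le i hi p hp, h.le i hi q hq, h.le p hp i hi, h.le q hq i hi]]
      simp only [SameType, not_forall, exists_prop]
      refine exists_congr fun t => and_congr_right fun _ => not_congr ?_
      rw [Iff.comm, @Iff.comm (t ≤ el p)]
      tauto
    constructor
    · intro H q hq
      exact (key q (hq.trans hp)).1 ((H q (hq.trans hp)).resolve_left (not_not.2 hq))
    · intro H q hq
      by_cases hqp : q < p
      exacts [.inr ((key q hq).2 (H q hqp)), .inl hqp]
  · intro j s' _ h1 h2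
    have : repsEx.eval x s' [j] = repsEx.eval x s [j] := by
      simp [repsEx, leEx, Ex.eval, Ex.not, Ex.and, Ex.or, Ex.lt, Ex.eq, Ex.ex, h1, h2]
    simp [this]

/-- A bound for the number of steps of the game with `j` quantifiers, for `m` elements of which `c`
are candidates. -/
def budget (m c : ℕ) : ℕ → ℕ
  | 0 => 1
  | j + 1 => m + 2 + c * (budget m c j + 2)

theorem den_budgetCmd (x : List Letter) (s : State) :
    ∃ s', budgetCmd.den x [] s = s' ∧ s'.a = s.a ∧
      (∀ i, i ≠ .bud → i ≠ .bud' → s'.v i = s.v i) ∧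
      s'.v .bud = if s.v .bad ≠ 0 ∨ s.v .triv ≠ 0 then 0 else
        budget (s.v .size) (Nat.count (fun p => s.a .reps p ≠ 0) (s.v .size)) (s.v .qs) := by
  set m := s.v .size with hm
  set c := Nat.count (fun p => s.a .reps p ≠ 0) m with hc
  refine ⟨_, rfl, ?_, fun i h1 h2 => Cmd.den_v x budgetCmd
    (by simp [budgetCmd, Cmd.block, Cmd.when, Cmd.modv, h1, h2]) [] s, ?_⟩
  · funext b; exact Cmd.den_a x budgetCmd (by simp [budgetCmd, Cmd.block, Cmd.when, Cmd.moda]) [] s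
  let body : Cmd := .block [
    .setv .bud' (.add (.sv .size) (.num 2)),
    .loop .size (.when (.arr .reps (.bv 0))
      (.setv .bud' (.add (.sv .bud') (.add (.sv .bud) (.num 2))))),
    .setv .bud (.sv .bud')]
  have outer : (∀ i, i ≠ .bud → i ≠ .bud' → (Cmd.den x (.loop .qs body) [] (s.setv .bud 1)).v i =
      s.v i) ∧ (Cmd.den x (.loop .qs body) [] (s.setv .bud 1)).v .bud = budget m c (s.v .qs) := by
    refine ⟨fun i h1 h2 => by
      rw [Cmd.den_v x _ (by simp [body, Cmd.block, Cmd.when, Cmd.modv, h1, h2])]; simp [h1], ?_⟩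
    rw [Cmd.den, show (s.setv .bud 1).v .qs = s.v .qs by simp]
    refine (iter_induction (fun j (s' : State) => s'.v .size = m ∧ s'.a .reps = s.a .reps ∧
      s'.v .bud = budget m c j) (by simp [budget, hm]) ?_).2.2
    rintro j s1 - ⟨h1, h2, h3⟩
    have inner := iter_induction (f := fun p s => Cmd.den x (.when (.arr .reps (.bv 0))
      (.setv .bud' (.add (.sv .bud') (.add (.sv .bud) (.num 2))))) [p, j] s) (n := m)
      (s := s1.setv .bud' (m + 2)) (fun p s' => s'.v .size = m ∧ s'.a .reps = s.a .reps ∧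
      s'.v .bud = budget m c j ∧ s'.v .bud' = m + 2 +
        Nat.count (fun p => s.a .reps p ≠ 0) p * (budget m c j + 2))
      (by simp [h1, h2, h3]) ?_
    · simp only [body, Cmd.block, Cmd.den, Ex.eval, h1]
      rw [show (s1.setv .bud' (m + 2)).v .size = m by simp [h1]]
      refine ⟨by simpa using inner.1, inner.2.1, ?_⟩
      simpa [budget] using inner.2.2.2
    · rintro p s' - ⟨g1, g2, g3, g4⟩
      simp only [Cmd.when, Cmd.den, ite_eval_ne]
      simp only [true_arr, Ex.eval, List.getD_cons_zero, g2, Nat.count_succ]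
      split_ifs with hp
      · refine ⟨by simpa using g1, g2, by simpa using g3, ?_⟩
        simp only [State.setv_v, if_true, g3, g4]
        ring
      · exact ⟨g1, g2, g3, by simpa using g4⟩
  have e : budgetCmd.den x [] s = Cmd.den x (.when (.or (.sv .bad) (.sv .triv))
    (.setv .bud (.num 0))) [] (Cmd.den x (.loop .qs body) [] (s.setv .bud 1)) := rfl
  rw [e]
  simp only [Cmd.when, Cmd.den.eq_5, ite_eval_ne]
  simp only [Ex.true_or, true_sv, outer.1 .bad (by simp) (by simp),
    outer.1 .triv (by simp) (by simp)]
  split_ifs with h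
  · simp [Cmd.den, Ex.eval]
  · rw [Cmd.den, outer.2]

end Listed

/-! ### The encoding -/

section Encoding

variable {P : Type*} [PartialOrder P] {m : ℕ} (e : Fin m ≃ P)

theorem letterAt_append_left {l l' : List Letter} {i : ℕ} (h : i < l.length) :
    letterAt (l ++ l') i = letterAt l i := by
  simp [letterAt, List.getElem?_append_left h]

theorem letterAt_append_right {l l' : List Letter} (i : ℕ) :
    letterAt (l ++ l') (l.length + i) = letterAt l' i := by
  simp [letterAt, List.getElem?_append_right]

/-- Letters of a concatenation of blocks of the same length. -/
theorem letterAt_flatMap {α : Type*} (f : α → List Letter) {k : ℕ} (hf : ∀ a, (f a).length = k)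
    (l : List α) {i j : ℕ} (hi : i < l.length) (hj : j < k) :
    letterAt (l.flatMap f) (i * k + j) = letterAt (f l[i]) j := by
  induction l generalizing i with
  | nil => simp at hi
  | cons a l ih =>
    rw [List.flatMap_cons]
    cases i with
    | zero =>
      rw [Nat.zero_mul, Nat.zero_add, letterAt_append_left (by rw [hf]; exact hj)]
      simp
    | succ i =>
      rw [show (i + 1) * k + j = (f a).length + (i * k + j) by rw [hf]; ring,
        letterAt_append_right, ih (by simpa using hi)]
      simp

open Classical in
/-- A row of the matrix of the order. -/
noncomputable def row (i : Fin m) : List Letter :=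
  ((List.finRange m).map fun j => if e i ≤ e j then Letter.one else Letter.zero) ++ [Letter.sep]

theorem length_row (i : Fin m) : (row e i).length = m + 1 := by simp [row]

theorem encodePoset_eq : encodePoset e = (List.finRange m).flatMap (row e) := rfl

theorem length_encodePoset : (encodePoset e).length = m * (m + 1) := by
  rw [encodePoset_eq, List.length_flatMap]
  simp [length_row]

theorem letterAt_encodePoset (l : List Letter) {i j : ℕ} (hi : i < m) (hj : j < m + 1) :
    letterAt (encodePoset e ++ l) (i * (m + 1) + j) = letterAt (row e ⟨i, hi⟩) j := by
  rw [letterAt_append_left, encodePoset_eq, letterAt_flatMap _ (length_row e) _ (by simpa) hj]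
  · simp
  · rw [length_encodePoset]
    calc i * (m + 1) + j < i * (m + 1) + (m + 1) := by omega
      _ = (i + 1) * (m + 1) := by ring
      _ ≤ m * (m + 1) := Nat.mul_le_mul_right _ hi

open Classical in
theorem letterAt_row (i : Fin m) {j : ℕ} (hj : j < m) :
    letterAt (row e i) j = if e i ≤ e ⟨j, hj⟩ then 2 else 1 := by
  rw [row, letterAt_append_left (by simpa), letterAt]
  have : (List.finRange m)[j]? = some ⟨j, hj⟩ := by
    rw [List.getElem?_eq_getElem (by simpa)]; simp
  rw [List.getElem?_map, this]
  split_ifs <;> simp [*, Letter.code]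

theorem letterAt_row_sep (i : Fin m) : letterAt (row e i) m = 3 := by
  have := letterAt_append_right (l := (List.finRange m).map fun j =>
    open Classical in if e i ≤ e j then Letter.one else Letter.zero) (l' := [Letter.sep]) 0
  rw [List.length_map, List.length_finRange, Nat.add_zero] at this
  exact this

end Encoding

/-! ### Evaluation of the game by backtracking -/

theorem game_congr_lt {P : Type*} {AU AE : Set P} {kind : ℕ → Prop} {M : (ℕ → P) → Prop} {r : ℕ}
    (hM : ∀ g g', (∀ t < r, g t = g' t) → M g → M g') {j i : ℕ} {g g' : ℕ → P} (hj : i + j = r)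
    (h : ∀ t < i, g t = g' t) : Game AU AE kind M j i g ↔ Game AU AE kind M j i g' := by
  have upd : ∀ (i : ℕ) (g g' : ℕ → P) (a : P), (∀ t < i, g t = g' t) →
      ∀ t < i + 1, update g i a t = update g' i a t := by
    intro i g g' a h t ht
    by_cases hti : t = i
    · simp [hti]
    · simp [hti, h t (by omega)]
  have := fun g g' : ℕ → P => Game.transfer (AU := AU) (AE := AE) (AU' := AU) (AE' := AE)
    (kind := kind) (M := M) (r := r) (fun i g g' => ∀ t < i, g t = g' t)
    (fun i g g' _ _ h a ha => ⟨a, ha, upd i g g' a h⟩)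
    (fun i g g' _ _ h a ha => ⟨a, ha, upd i g g' a h⟩) hM j i g g' hj
  exact ⟨this g g' h, this g' g fun t ht => (h t ht).symm⟩

section Backtracking

variable {x : List Letter} {s s₀ : State}

/-- The condition to be achieved, in terms of the state. -/
def goal (x : List Letter) (s : State) (g : ℕ → ℕ) : Prop :=
  ∀ a b, s.rel a b → letterAt x (s.a .rowM (g (s.a .rep a)) + g (s.a .rep b)) = 2

theorem goal_congr (hrep : ∀ i < s.v .qs, s.a .rep i < s.v .qs) {g g' : ℕ → ℕ}
    (h : ∀ t < s.v .qs, g t = g' t) (hg : goal x s g) : goal x s g' := by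
  intro a b hab
  rw [← h _ (hrep a hab.1), ← h _ (hrep b hab.2.1)]
  exact hg a b hab

/-- The state `s` differs from `s₀` only in the variables and arrays of the backtracking. -/
structure Frame (s₀ s : State) : Prop where
  v : ∀ i, i ≠ .mode → i ≠ .dep → i ≠ .res → s.v i = s₀.v i
  a : ∀ c, c ≠ .val → c ≠ .acc → s.a c = s₀.a c

/-- One step of the backtracking. -/
def btStep (x : List Letter) (s : State) : State := stepCmd.den x [] s

theorem btStep_leaf (hf : Frame s₀ s) (h0 : s.v .mode = 0) (hd : s.v .dep = s₀.v .qs) :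
    ∃ w, btStep x s = (s.setv .res w).setv .mode 2 ∧ (w ≠ 0 ↔ goal x s₀ (s.a .val)) := by
  have hq : s.v .dep = s.v .qs := by rw [hd, hf.v _ (by simp) (by simp) (by simp)]
  refine ⟨goalEx.eval x s [], ?_, ?_⟩
  · simp only [btStep, stepCmd, Cmd.den, ite_eval_ne]
    simp [Ex.eval, h0, hq]
  · change goalEx.True x s [] ↔ _
    simp only [goalEx, Ex.true_all, Ex.true_or, Ex.true_not, true_reachEx, true_leEx, Ex.eval,
      List.getD_cons_zero, List.getD_cons_succ, hf.v .qs (by simp) (by simp) (by simp),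
      hf.a .reach (by simp) (by simp), hf.a .rowM (by simp) (by simp),
      hf.a .rowN (by simp) (by simp), hf.a .rep (by simp) (by simp), goal, State.rel,
      ← imp_iff_not_or]
    exact ⟨fun h a b hab => h a hab.1 b hab.2.1 hab.2.2, fun h a ha b hb hab => h a b ⟨ha, hb, hab⟩⟩

theorem btStep_enter (hf : Frame s₀ s) (h0 : s.v .mode = 0) (hd : s.v .dep ≠ s₀.v .qs) :
    btStep x s = ((s.seta .val (s.v .dep) 0).seta .acc (s.v .dep)
      (s₀.a .kind (s.v .dep))).setv .mode 1 := by
  have hq : s.v .dep ≠ s.v .qs := by rwa [hf.v .qs (by simp) (by simp) (by simp)]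
  simp only [btStep, stepCmd, Cmd.block, Cmd.den, ite_eval_ne]
  simp [Ex.eval, h0, hq, hf.a .kind (by simp) (by simp)]

theorem btStep_done (hf : Frame s₀ s) (h1 : s.v .mode = 1)
    (hd : s.a .val (s.v .dep) = s₀.v .size) :
    btStep x s = (s.setv .res (s.a .acc (s.v .dep))).setv .mode 2 := by
  have hq : s.a .val (s.v .dep) = s.v .size := by rw [hd, hf.v .size (by simp) (by simp) (by simp)]
  simp only [btStep, stepCmd, Cmd.block, Cmd.den, ite_eval_ne]
  simp [Ex.eval, h1, hq]

/-- The value `p` is to be tried for quantifier `d`. -/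
def Tried (s₀ : State) (d p : ℕ) : Prop :=
  (s₀.a .kind d ≠ 0 ∧ s₀.a .reps p ≠ 0) ∨ (¬ s₀.a .kind d ≠ 0 ∧ s₀.a .cand p ≠ 0)

theorem true_memberEx (hf : Frame s₀ s) (β : List ℕ) :
    memberEx.True x s β ↔ Tried s₀ (s.v .dep) (s.a .val (s.v .dep)) := by
  simp only [memberEx, Ex.true_or, Ex.true_and, Ex.true_not, true_arr, Ex.eval, Tried,
    hf.a .kind (by simp) (by simp), hf.a .reps (by simp) (by simp), hf.a .cand (by simp) (by simp)]

theorem btStep_try (hf : Frame s₀ s) (h1 : s.v .mode = 1)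
    (hd : s.a .val (s.v .dep) ≠ s₀.v .size) (ht : Tried s₀ (s.v .dep) (s.a .val (s.v .dep))) :
    btStep x s = (s.setv .dep (s.v .dep + 1)).setv .mode 0 := by
  have hq : s.a .val (s.v .dep) ≠ s.v .size := by rwa [hf.v .size (by simp) (by simp) (by simp)]
  rw [← true_memberEx (x := x) hf []] at ht
  simp only [btStep, stepCmd, Cmd.block, Cmd.den, ite_eval_ne]
  simp [Ex.eval, h1, hq, ht]

theorem btStep_skip (hf : Frame s₀ s) (h1 : s.v .mode = 1)
    (hd : s.a .val (s.v .dep) ≠ s₀.v .size) (ht : ¬ Tried s₀ (s.v .dep) (s.a .val (s.v .dep))) :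
    btStep x s = s.seta .val (s.v .dep) (s.a .val (s.v .dep) + 1) := by
  have hq : s.a .val (s.v .dep) ≠ s.v .size := by rwa [hf.v .size (by simp) (by simp) (by simp)]
  rw [← true_memberEx (x := x) hf []] at ht
  simp only [btStep, stepCmd, Cmd.block, Cmd.den, ite_eval_ne]
  simp [Ex.eval, h1, hq, ht]

theorem btStep_pop (hf : Frame s₀ s) (h2 : s.v .mode = 2) {d : ℕ} (hd : s.v .dep = d + 1) :
    ∃ w, btStep x s = (((s.setv .dep d).seta .acc d w).seta .val d (s.a .val d + 1)).setv .mode 1 ∧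
      (w ≠ 0 ↔ if s₀.a .kind d ≠ 0 then s.a .acc d ≠ 0 ∧ s.v .res ≠ 0
        else s.a .acc d ≠ 0 ∨ s.v .res ≠ 0) := by
  by_cases hk : s₀.a .kind d ≠ 0
  · refine ⟨(Ex.and (.arr .acc (.sv .dep)) (.sv .res)).eval x (s.setv .dep d) [], ?_, ?_⟩
    · simp only [btStep, stepCmd, Cmd.when, Cmd.block, Cmd.den, ite_eval_ne]
      simp [true_sv, Ex.eval, h2, hd, hk, hf.a .kind (by simp) (by simp)]
    · change Ex.True _ _ _ _ ↔ _
      simp [true_sv, true_arr, Ex.eval, hk]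
  · refine ⟨(Ex.or (.arr .acc (.sv .dep)) (.sv .res)).eval x (s.setv .dep d) [], ?_, ?_⟩
    · simp only [btStep, stepCmd, Cmd.when, Cmd.block, Cmd.den, ite_eval_ne]
      simp [true_sv, Ex.eval, h2, hd, hk, hf.a .kind (by simp) (by simp)]
    · change Ex.True _ _ _ _ ↔ _
      simp [true_sv, true_arr, Ex.eval, hk]

theorem btStep_final (h2 : s.v .mode = 2) (hd : s.v .dep = 0) : btStep x s = s := by
  simp only [btStep, stepCmd, Cmd.when, Cmd.block, Cmd.den, ite_eval_ne]
  simp [true_sv, Ex.eval, h2, hd]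

/-- The game that is evaluated, in terms of the state. -/
def stateGame (x : List Letter) (s₀ : State) : ℕ → ℕ → (ℕ → ℕ) → Prop :=
  Game {p | p < s₀.v .size ∧ s₀.a .reps p ≠ 0} {p | p < s₀.v .size ∧ s₀.a .cand p ≠ 0}
    (fun i => s₀.a .kind i ≠ 0) (goal x s₀)

/-- The number of candidates for the universal quantifiers that are listed before `p`. -/
def State.count (s : State) (p : ℕ) : ℕ := Nat.count (fun p => s.a .reps p ≠ 0) p

/-- The state `s'` after the evaluation of the game from quantifier `d` on, with truth value `A`,
which was begun in the state `s`. -/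
structure Evaluated (s₀ : State) (d : ℕ) (s s' : State) (A : Prop) : Prop where
  frame : Frame s₀ s'
  mode : s'.v .mode = 2
  dep : s'.v .dep = d
  val : ∀ i < d, s'.a .val i = s.a .val i
  acc : ∀ i < d, s'.a .acc i = s.a .acc i
  res : s'.v .res ≠ 0 ↔ A

/-- The values from `p` on are tried for quantifier `d`. -/
theorem evaluated_from (hrep : ∀ i < s₀.v .qs, s₀.a .rep i < s₀.v .qs)
    (hsub : ∀ p < s₀.v .size, s₀.a .cand p ≠ 0 → s₀.a .reps p ≠ 0) {d j T : ℕ}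
    (hd : d + 1 + j = s₀.v .qs)
    (ih : ∀ s, Frame s₀ s → s.v .mode = 0 → s.v .dep = d + 1 →
      ∃ t ≤ T, Evaluated s₀ (d + 1) s ((btStep x)^[t] s) (stateGame x s₀ j (d + 1) (s.a .val))) :
    ∀ (k p : ℕ) (s : State), p + k = s₀.v .size → Frame s₀ s → s.v .mode = 1 → s.v .dep = d →
      s.a .val d = p → ∃ t, t + s₀.count p * (T + 2) + p ≤
        s₀.count (s₀.v .size) * (T + 2) + s₀.v .size + 1 ∧
        Evaluated s₀ d s ((btStep x)^[t] s) (if s₀.a .kind d ≠ 0 then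
          s.a .acc d ≠ 0 ∧ ∀ q, p ≤ q → q < s₀.v .size → Tried s₀ d q →
            stateGame x s₀ j (d + 1) (update (s.a .val) d q)
          else s.a .acc d ≠ 0 ∨ ∃ q, p ≤ q ∧ q < s₀.v .size ∧ Tried s₀ d q ∧
            stateGame x s₀ j (d + 1) (update (s.a .val) d q)) := by
  have hcongr : ∀ {g g' : ℕ → ℕ}, (∀ t < d + 1, g t = g' t) →
      (stateGame x s₀ j (d + 1) g ↔ stateGame x s₀ j (d + 1) g') :=
    game_congr_lt (r := s₀.v .qs) (fun g g' h => goal_congr hrep h) hd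
  intro k
  induction k with
  | zero =>
    intro p s hp hf h1 hdep hv
    obtain rfl : p = s₀.v .size := hp
    refine ⟨1, by omega, ?_⟩
    rw [Function.iterate_one, btStep_done hf h1 (by rw [hdep, hv]), hdep]
    refine ⟨⟨fun i h1 h2 h3 => by simp [h1, h3, hf.v i h1 h2 h3], hf.a⟩, by simp, by simp [hdep],
      by simp, by simp, ?_⟩
    simp only [State.setv_v, reduceCtorEq, if_false, if_true]
    split_ifs
    · exact ⟨fun h => ⟨h, fun q h1 h2 => by omega⟩, fun h => h.1⟩
    · exact ⟨fun h => .inl h, fun h => h.resolve_right fun ⟨q, h1, h2, _⟩ => by omega⟩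
  | succ k ihk =>
    intro p s hp hf h1 hdep hv
    have hne : s.a .val (s.v .dep) ≠ s₀.v .size := by rw [hdep, hv]; omega
    have hcount : s₀.count (p + 1) = s₀.count p + if s₀.a .reps p ≠ 0 then 1 else 0 :=
      Nat.count_succ _ _
    -- a quantification over the values from `p` on
    have hsplit : ∀ q, p ≤ q ↔ q = p ∨ p + 1 ≤ q := fun q => by omega
    by_cases ht : Tried s₀ d p
    · have hr : s₀.a .reps p ≠ 0 := ht.elim (fun h => h.2) fun h => hsub p (by omega) h.2
      have e1 := btStep_try (x := x) hf h1 hne (by rw [hdep, hv]; exact ht)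
      set s1 := btStep x s
      have f1 : Frame s₀ s1 :=
        ⟨fun i h1 h2 h3 => by simp [e1, h1, h2, hf.v i h1 h2 h3], fun c h1 h2 => by
          simp [e1, hf.a c h1 h2]⟩
      obtain ⟨t1, ht1, E⟩ := ih s1 f1 (by simp [e1]) (by simp [e1, hdep])
      set s2 := (btStep x)^[t1] s1
      obtain ⟨w, e3, hw⟩ := btStep_pop (x := x) E.frame E.mode E.dep
      set s3 := btStep x s2
      have f3 : Frame s₀ s3 :=
        ⟨fun i h1 h2 h3 => by simp [e3, h1, h2, E.frame.v i h1 h2 h3], fun c h1 h2 => by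
          simp [e3, h1, h2, E.frame.a c h1 h2]⟩
      have hv2 : s2.a .val d = p := by rw [E.val d (by omega)]; simp [e1, hv]
      obtain ⟨t, ht, E'⟩ := ihk (p + 1) s3 (by omega) f3 (by simp [e3]) (by simp [e3])
        (by simp [e3, hv2])
      refine ⟨t + (1 + (t1 + 1)), ?_, ?_⟩
      · rw [hcount, if_pos hr, add_mul, one_mul] at ht
        omega
      · have hval : ∀ i < d, s3.a .val i = s.a .val i := fun i hi => by
          have : i ≠ d := by omega
          simp [e3, this, E.val i (by omega), e1]
        have hacc : ∀ i < d, s3.a .acc i = s.a .acc i := fun i hi => by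
          have : i ≠ d := by omega
          simp [e3, this, E.acc i (by omega), e1]
        have it : (btStep x)^[t + (1 + (t1 + 1))] s = (btStep x)^[t] s3 := by
          rw [Function.iterate_add_apply, Function.iterate_add_apply (btStep x) 1,
            Function.iterate_add_apply (btStep x) t1, Function.iterate_one]
        rw [it]
        refine ⟨E'.frame, E'.mode, E'.dep, fun i hi => (E'.val i hi).trans (hval i hi),
          fun i hi => (E'.acc i hi).trans (hacc i hi), E'.res.trans ?_⟩
        have a3 : s3.a .acc d = w := by simp [e3]
        have a2 : s2.a .acc d = s.a .acc d := by rw [E.acc d (by omega)]; simp [e1]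
        have g1 : s2.v .res ≠ 0 ↔ stateGame x s₀ j (d + 1) (update (s.a .val) d p) := by
          rw [E.res]
          refine hcongr fun t ht => ?_
          simp only [e1, State.setv_a]
          by_cases h : t = d
          · simp [h, hv]
          · simp [h]
        have g3 : ∀ q, stateGame x s₀ j (d + 1) (update (s3.a .val) d q) ↔
            stateGame x s₀ j (d + 1) (update (s.a .val) d q) := fun q => by
          refine hcongr fun t ht => ?_
          by_cases h : t = d
          · simp [h]
          · simp [h, hval t (by omega)]
        simp only [a3, hw, a2, g1, g3]
        split_ifs with hk
        · constructor
          · rintro ⟨⟨h1, h2⟩, h3⟩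
            refine ⟨h1, fun q hq hq' hT => ?_⟩
            rcases (hsplit q).1 hq with rfl | hq
            exacts [h2, h3 q hq hq' hT]
          · rintro ⟨h1, h2⟩
            exact ⟨⟨h1, h2 p le_rfl (by omega) ‹_›⟩, fun q hq => h2 q (by omega)⟩
        · constructor
          · rintro ((h | h) | ⟨q, hq, h⟩)
            exacts [.inl h, .inr ⟨p, le_rfl, by omega, ‹_›, h⟩, .inr ⟨q, by omega, h⟩]
          · rintro (h | ⟨q, hq, hq', hT, h⟩)
            · exact .inl (.inl h)
            · rcases (hsplit q).1 hq with rfl | hq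
              exacts [.inl (.inr h), .inr ⟨q, hq, hq', hT, h⟩]
    · have e1 := btStep_skip (x := x) hf h1 hne (by rw [hdep, hv]; exact ht)
      rw [hdep, hv] at e1
      set s1 := btStep x s
      have f1 : Frame s₀ s1 :=
        ⟨fun i h1 h2 h3 => by simp [e1, hf.v i h1 h2 h3], fun c h1 h2 => by
          simp [e1, h1, hf.a c h1 h2]⟩
      obtain ⟨t, ht', E⟩ := ihk (p + 1) s1 (by omega) f1 (by simp [e1, h1]) (by simp [e1, hdep])
        (by simp [e1])
      refine ⟨t + 1, ?_, ?_⟩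
      · have := Nat.mul_le_mul_right (T + 2) (show s₀.count p ≤ s₀.count (p + 1) by omega)
        omega
      · rw [Function.iterate_succ_apply]
        refine ⟨E.frame, E.mode, E.dep, fun i hi => (E.val i hi).trans (by simp [e1, hi.ne]),
          fun i hi => (E.acc i hi).trans (by simp [e1]), E.res.trans ?_⟩
        have a1 : s1.a .acc d = s.a .acc d := by simp [e1]
        have g1 : ∀ q, update (s1.a .val) d q = update (s.a .val) d q := fun q => by simp [e1]
        simp only [a1, g1]
        split_ifs with hk
        · refine and_congr_right fun _ => forall_congr' fun q => ?_
          constructor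
          · intro h hq hq' hT
            rcases (hsplit q).1 hq with rfl | hq
            exacts [absurd hT ht, h hq hq' hT]
          · exact fun h hq => h (by omega)
        · refine or_congr_right (exists_congr fun q => ?_)
          constructor
          · rintro ⟨h, h'⟩; exact ⟨by omega, h'⟩
          · rintro ⟨hq, hq', hT, h⟩
            rcases (hsplit q).1 hq with rfl | hq
            exacts [absurd hT ht, ⟨hq, hq', hT, h⟩]

/-- The backtracking evaluates the game within the budget. -/
theorem evaluated (hrep : ∀ i < s₀.v .qs, s₀.a .rep i < s₀.v .qs)
    (hsub : ∀ p < s₀.v .size, s₀.a .cand p ≠ 0 → s₀.a .reps p ≠ 0) :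
    ∀ (j d : ℕ) (s : State), d + j = s₀.v .qs → Frame s₀ s → s.v .mode = 0 → s.v .dep = d →
      ∃ t ≤ budget (s₀.v .size) (s₀.count (s₀.v .size)) j,
        Evaluated s₀ d s ((btStep x)^[t] s) (stateGame x s₀ j d (s.a .val)) := by
  intro j
  induction j with
  | zero =>
    intro d s hd hf h0 hdep
    obtain ⟨w, e, hw⟩ := btStep_leaf (x := x) hf h0 (by omega)
    refine ⟨1, le_rfl, ?_⟩
    rw [Function.iterate_one, e]
    exact ⟨⟨fun i h1 h2 h3 => by simp [h1, h3, hf.v i h1 h2 h3], hf.a⟩, by simp, by simp [hdep],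
      by simp, by simp, by simpa [stateGame, Game] using hw⟩
  | succ j ih =>
    intro d s hd hf h0 hdep
    have e1 := btStep_enter (x := x) hf h0 (by omega)
    rw [hdep] at e1
    set s1 := btStep x s
    have f1 : Frame s₀ s1 :=
      ⟨fun i h1 h2 h3 => by simp [e1, h1, hf.v i h1 h2 h3], fun c h1 h2 => by
        simp [e1, h1, h2, hf.a c h1 h2]⟩
    obtain ⟨t, ht, E⟩ := evaluated_from hrep hsub (by omega)
      (fun s hf h0 hdep => ih (d + 1) s (by omega) hf h0 hdep) (s₀.v .size) 0 s1 (by omega) f1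
      (by simp [e1]) (by simp [e1, hdep]) (by simp [e1])
    refine ⟨t + 1, ?_, ?_⟩
    · rw [budget]
      simp only [State.count, Nat.count_zero] at ht ⊢
      omega
    · rw [Function.iterate_succ_apply]
      refine ⟨E.frame, E.mode, E.dep, fun i hi => (E.val i hi).trans (by simp [e1, hi.ne]),
        fun i hi => (E.acc i hi).trans (by simp [e1, hi.ne]), E.res.trans ?_⟩
      have a1 : s1.a .acc d = s₀.a .kind d := by simp [e1]
      have g1 : ∀ q, update (s1.a .val) d q = update (s.a .val) d q := fun q => by simp [e1]
      simp only [a1, g1, stateGame, Game, Set.mem_ofPred_eq, Tried]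
      by_cases hk : s₀.a .kind d = 0
      · simp [hk, and_assoc]
      · simp [hk]

theorem den_loop_stepCmd (hrep : ∀ i < s.v .qs, s.a .rep i < s.v .qs)
    (hsub : ∀ p < s.v .size, s.a .cand p ≠ 0 → s.a .reps p ≠ 0) (h0 : s.v .mode = 0)
    (hd : s.v .dep = 0)
    (hb : s.v .bud = budget (s.v .size) (s.count (s.v .size)) (s.v .qs)) :
    (Cmd.den x (.loop .bud stepCmd) [] s).v .res ≠ 0 ↔
      stateGame x s (s.v .qs) 0 (s.a .val) := by
  have hit : ∀ n, iter (fun j s => stepCmd.den x [j] s) n s = (btStep x)^[n] s := by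
    intro n
    induction n with
    | zero => rfl
    | succ n ih => rw [Function.iterate_succ_apply', ← ih]; rfl
  obtain ⟨t, ht, E⟩ := evaluated (x := x) hrep hsub (s.v .qs) 0 s (by omega)
    ⟨fun _ _ _ _ => rfl, fun _ _ _ => rfl⟩ h0 hd
  rw [Cmd.den, hit, hb, ← Nat.sub_add_cancel ht, Function.iterate_add_apply,
    Function.iterate_fixed (btStep_final E.mode E.dep)]
  exact E.res

end Backtracking

/-! ### Correctness -/

theorem CPFormula.nq_le_size (φ : CPFormula) : φ.nq ≤ φ.size := by
  unfold CPFormula.size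
  induction φ with
  | le | eq => exact Nat.zero_le _
  | and φ ψ ihφ ihψ => simp only [nq, encode, List.length_cons, List.length_append]; omega
  | all x φ ih | ex x φ ih => simp only [nq, encode, List.length_cons, List.length_append]; omega

theorem CPFormula.size_pos (φ : CPFormula) : 1 ≤ φ.size := by
  cases φ <;> simp [CPFormula.size, CPFormula.encode]

namespace Instance

variable (I : Instance.{u})

/-- The elements of the poset, extended arbitrarily to all indices. -/
noncomputable def el (i : ℕ) : I.carrier :=
  if h : i < I.card then I.listing ⟨i, h⟩ else Classical.arbitrary _

theorem el_of_lt {i : ℕ} (h : i < I.card) : I.el i = I.listing ⟨i, h⟩ := dif_pos h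

theorem card_pos : 0 < I.card := (I.listing.symm (Classical.arbitrary _)).pos

theorem size_eq : I.size = I.card * (I.card + 1) + I.sentence.size := by
  simp [size, encode, length_encodePoset, CPFormula.size]

theorem card_le_size : I.card + 1 ≤ I.size := by
  have := I.sentence.size_pos
  rw [I.size_eq]
  nlinarith

theorem nq_le_size : I.sentence.nq ≤ I.size := by
  have := I.sentence.nq_le_size
  rw [I.size_eq]
  omega

theorem letterAt_encode {i j : ℕ} (hi : i < I.card) (hj : j < I.card) :
    letterAt I.encode (i * (I.card + 1) + j) = open Classical in
      if I.el i ≤ I.el j then 2 else 1 := by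
  rw [encode, letterAt_encodePoset _ _ hi (by omega), letterAt_row _ _ hj, I.el_of_lt hi,
    I.el_of_lt hj]

theorem listed {s : State} (h1 : s.v .size = I.card)
    (h2 : ∀ i < I.card, s.a .rowM i = i * (I.card + 1)) : Listed I.encode s I.el where
  surj p := ⟨I.listing.symm p, by rw [h1]; exact (I.listing.symm p).isLt, by
    rw [I.el_of_lt (I.listing.symm p).isLt]; simp⟩
  inj i hi j hj h := by
    rw [h1] at hi hj
    rw [I.el_of_lt hi, I.el_of_lt hj] at h
    simpa using h
  le i hi j hj := by
    rw [h1] at hi hj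
    rw [h2 i hi, I.letterAt_encode hi hj]
    split_ifs <;> simp [*]

/-- The state after reading the input. -/
structure Loaded (s : State) : Prop where
  listed : Listed I.encode s I.el
  size : s.v .size = I.card
  qs : s.v .qs = I.sentence.nq
  lv : s.v .lv = I.sentence.nq + 1
  mode : s.v .mode = 0
  dep : s.v .dep = 0
  cand : ∀ p, s.a .cand p = 0
  cells : s.Cells
  kinds : I.sentence.Kinds (fun i => s.a .kind i ≠ 0) 0
  rel : ∀ a b, s.rel a b ↔ I.sentence.Edge (fun _ => 0) 0 a b

theorem den_sizeCmd_init :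
    sizeCmd.den I.encode [] (State.init I.size) = (State.init I.size).setv .size I.card := by
  have hm := I.card_pos
  have h0 : ∀ j, j < I.card + 1 → letterAt I.encode j =
      letterAt (row I.listing ⟨0, hm⟩) j := fun j hj => by
    have := letterAt_encodePoset I.listing I.sentence.encode hm hj
    rwa [Nat.zero_mul, Nat.zero_add] at this
  refine den_sizeCmd I.encode I.card_le_size ?_ (fun i hi => ?_) _ (by simp [State.init, size])
    (by simp [State.init])
  · rw [h0 _ (by omega), letterAt_row_sep]
  · rw [h0 _ (by omega), letterAt_row _ _ hi]
    split_ifs <;> simp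

theorem loaded : I.Loaded (readCmd.den I.encode [] ((State.init I.size).setv .size I.card)) := by
  set s1 := (State.init I.size).setv .size I.card with hs1
  have hcard := I.card_le_size
  have hnq := I.nq_le_size
  have e : readCmd.den I.encode [] s1 = Cmd.den I.encode (.setv .lv (.add (.sv .qs) (.num 1))) []
      (parseCmd.den I.encode [] (rowsCmd.den I.encode [] s1)) := rfl
  have hrows := den_rowsCmd I.encode s1 rfl rfl
  have hv : ∀ i, (rowsCmd.den I.encode [] s1).v i = s1.v i :=
    fun i => Cmd.den_v _ rowsCmd (by simp [rowsCmd, Cmd.modv]) _ _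
  have ha : ∀ c, c ≠ .rowM → c ≠ .rowN → (rowsCmd.den I.encode [] s1).a c = s1.a c :=
    fun c h1 h2 => Cmd.den_a _ rowsCmd (by simp [rowsCmd, Cmd.moda, h1, h2]) _ _
  set s2 := rowsCmd.den I.encode [] s1
  have hlen1 : s1.v .len = I.size := by simp [hs1, State.init]
  have hsize1 : s1.v .size = I.card := by simp [hs1]
  rw [hlen1, hsize1] at hrows
  have hp : parseCmd.den I.encode [] s2 = lettersStep I.sentence.encode (s2.setv .pw 1) :=
    den_parseCmd (encodePoset I.listing) I.sentence.encode s2 (by rw [hv, hlen1]; rfl)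
      (by rw [hv, hsize1, (hrows _ (by omega)).1, length_encodePoset])
  have v0 : ∀ i, i ≠ .len → i ≠ .size → s2.v i = 0 := fun i h1 h2 => by
    rw [hv]; simp [hs1, h2, State.init, h1]
  have hP := parsed_formula (n := I.size) I.sentence (s := s2.setv .pw 1) (env := fun _ => 0)
    ⟨by simp [v0], by simp, by simp [hv, hlen1], fun i hi => (hrows i hi).2, by simp [v0]⟩
    (by simp [v0]) (by simpa [v0] using hnq)
    (fun y hy => by rw [I.isSentence] at hy; simp at hy)
  rw [← hp] at hP
  have va3 : ∀ c, c ∉ parseCmd.moda → (parseCmd.den I.encode [] s2).a c = s2.a c :=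
    fun c hc => Cmd.den_a _ _ hc _ _
  have vv3 : ∀ c, c ∉ parseCmd.modv → (parseCmd.den I.encode [] s2).v c = s2.v c :=
    fun c hc => Cmd.den_v _ _ hc _ _
  rw [e]
  set s3 := parseCmd.den I.encode [] s2
  have hq : s3.v .qs = I.sentence.nq := by rw [hP.qs]; simp [v0]
  have e4 : Cmd.den I.encode (.setv .lv (.add (.sv .qs) (.num 1))) [] s3 =
      s3.setv .lv (I.sentence.nq + 1) := by rw [← hq]; rfl
  rw [e4]
  have hsize : s3.v .size = I.card := by rw [vv3 _ (by decide), hv, hsize1]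
  have hedge : ∀ a b, I.sentence.Edge (fun _ => 0) 0 a b → a < I.sentence.nq ∧ b < I.sentence.nq :=
      fun a b hab => by
    have := I.sentence.edge_range hab
    simp only [show I.sentence.freeVars = ∅ from I.isSentence, Finset.notMem_empty, false_and,
      exists_false, false_or, Nat.zero_add] at this
    exact ⟨this.1.2, this.2.2⟩
  refine ⟨I.listed (by simpa using hsize) fun i hi => ?_, by simpa using hsize, by simpa using hq,
    by simp, ?_, ?_, fun p => ?_, ?_, ?_, fun a b => ?_⟩
  · rw [State.setv_a, va3 _ (by decide), (hrows i (by omega)).1]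
  · simp only [State.setv_v, reduceCtorEq, if_false]
    rw [vv3 _ (by decide), v0 _ (by simp) (by simp)]
  · simp only [State.setv_v, reduceCtorEq, if_false]
    rw [vv3 _ (by decide), v0 _ (by simp) (by simp)]
  · rw [State.setv_a, va3 _ (by decide), ha _ (by simp) (by simp)]; rfl
  · intro a ha b hb a' ha' b' hb'
    simp only [State.setv_v, reduceCtorEq, if_false, hq] at ha hb ha' hb'
    rw [State.setv_a, hP.ready.rowN _ (by omega), hP.ready.rowN _ (by omega),
      mul_add_inj (by omega) (by omega)]
  · have := hP.kinds
    simpa [v0] using this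
  · simp only [State.rel, State.setv_v, State.setv_a, reduceCtorEq, if_false, hq]
    have hr : ∀ (ha : a < I.sentence.nq) (hb : b < I.sentence.nq),
        s3.a .reach (s3.a .rowN a + b) ≠ 0 ↔ I.sentence.Edge (fun _ => 0) 0 a b := fun h1 h2 => by
      rw [hP.ready.rowN _ (by omega), hP.reach a (by omega) b (by omega)]
      simp [v0, ha, hs1, State.init]
    constructor
    · rintro ⟨h1, h2, h⟩; exact (hr h1 h2).1 h
    · intro h
      obtain ⟨h1, h2⟩ := hedge a b h
      exact ⟨h1, h2, (hr h1 h2).2 h⟩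

/-- The state after the preparation of the game. -/
structure Prepared (s : State) : Prop where
  listed : Listed I.encode s I.el
  size : s.v .size = I.card
  qs : s.v .qs = I.sentence.nq
  mode : s.v .mode = 0
  dep : s.v .dep = 0
  kinds : I.sentence.Kinds (fun i => s.a .kind i ≠ 0) 0
  trans : ∀ a b c, s.rel a b → s.rel b c → s.rel a c
  edge : ∀ a b, I.sentence.Edge (fun _ => 0) 0 a b → s.rel a b
  path : ∀ a b, s.rel a b → Relation.TransGen (I.sentence.Edge (fun _ => 0) 0) a b
  rep : IsRep (fun i => s.a .kind i ≠ 0) s.rel I.sentence.nq (s.a .rep)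
  bad : s.v .bad ≠ 0 ↔ Viol (fun i => s.a .kind i ≠ 0) s.rel
  triv : s.v .triv ≠ 0 ↔ (∃ p : I.carrier, ∀ q, p ≤ q) ∧ ∃ p : I.carrier, ∀ q, q ≤ p
  cand : ∀ p < I.card, s.a .cand p ≠ 0 ↔ I.el p ∈ lvl I.carrier (I.sentence.nq + 1)
  reps : ∀ p < I.card, s.a .reps p ≠ 0 ↔
    ∀ q < p, ¬ SameType (lvl I.carrier (I.sentence.nq + 1)) (I.el p) (I.el q)
  bud : s.v .bud = if s.v .bad ≠ 0 ∨ s.v .triv ≠ 0 then 0 else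
    budget I.card (s.count I.card) I.sentence.nq

variable {I}

theorem Loaded.prepared {s : State} (h : I.Loaded s) :
    I.Prepared (prepareCmd.den I.encode [] s) := by
  have e : prepareCmd.den I.encode [] s = budgetCmd.den I.encode [] (repsCmd.den I.encode []
    (candCmd.den I.encode [] (checkCmd.den I.encode [] (repCmd.den I.encode []
      (closureCmd.den I.encode [] s))))) := rfl
  rw [e]
  obtain ⟨s1, e1, v1, a1, tr1, ed1, pa1⟩ := den_closureCmd I.encode h.cells
  obtain ⟨s2, e2, v2, a2, rep2⟩ := den_repCmd I.encode s1
  have l2 : Listed I.encode s2 I.el := h.listed.of_eq (by rw [v2, v1])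
    (by rw [a2 _ (by simp), a1 _ (by simp)])
  obtain ⟨s3, e3, a3, v3, bad3, triv3⟩ := den_checkCmd l2
  have l3 : Listed I.encode s3 I.el := l2.of_eq (v3 _ (by simp) (by simp)) (by rw [a3])
  obtain ⟨s4, e4, v4, a4, cand4⟩ := den_candCmd l3 fun p => by
    rw [a3, a2 _ (by simp), a1 _ (by simp), h.cand]
  have l4 : Listed I.encode s4 I.el := l3.of_eq (by rw [v4]) (a4 _ (by simp) (by simp))
  obtain ⟨s5, e5, v5, a5, reps5⟩ := den_repsCmd l4 (by rw [v4]; exact cand4)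
  obtain ⟨s6, e6, a6, v6, bud6⟩ := den_budgetCmd I.encode s5
  rw [e1, e2, e3, e4, e5, e6]
  have vv : ∀ i, i ≠ .bud → i ≠ .bud' → i ≠ .bad → i ≠ .triv → s6.v i = s.v i :=
    fun i h1 h2 h3 h4 => by rw [v6 i h1 h2, v5, v4, v3 i h3 h4, v2, v1]
  have aa : ∀ c, c ≠ .reach → c ≠ .rep → c ≠ .cand → c ≠ .cand' → c ≠ .reps → s6.a c = s.a c :=
    fun c h1 h2 h3 h4 h5 => by rw [a6, a5 c h5, a4 c h3 h4, a3, a2 c h2, a1 c h1]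
  have kind6 : s6.a .kind = s.a .kind := aa _ (by simp) (by simp) (by simp) (by simp) (by simp)
  have kind2 : s2.a .kind = s6.a .kind := by rw [kind6, a2 _ (by simp), a1 _ (by simp)]
  have kind1 : s1.a .kind = s6.a .kind := by rw [kind6, a1 _ (by simp)]
  have hsize : s6.v .size = I.card := by
    rw [vv _ (by simp) (by simp) (by simp) (by simp), h.size]
  have hqs : s6.v .qs = I.sentence.nq := by
    rw [vv _ (by simp) (by simp) (by simp) (by simp), h.qs]
  have reach2 : s6.a .reach = s2.a .reach := by
    rw [a6, a5 _ (by simp), a4 _ (by simp) (by simp), a3]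
  have rowN2 : s6.a .rowN = s2.a .rowN := by
    rw [a6, a5 _ (by simp), a4 _ (by simp) (by simp), a3]
  have rel2 : s2.rel = s6.rel := by
    funext a b
    simp only [State.rel, reach2, rowN2, hqs]
    rw [v2, v1, h.qs]
  have rel1 : s1.rel = s6.rel := by
    rw [← rel2]
    funext a b
    simp only [State.rel, v2, a2 .reach (by simp), a2 .rowN (by simp)]
  have hrel : ∀ a b, s.rel a b ↔ I.sentence.Edge (fun _ => 0) 0 a b := h.rel
  rw [rel1] at tr1 ed1 pa1
  rw [rel1, kind1, v1, h.qs] at rep2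
  rw [rel2, kind2] at bad3
  have hrel' : s.rel = I.sentence.Edge (fun _ => 0) 0 := funext fun a => funext fun b =>
    propext (h.rel a b)
  have hbad : s6.v .bad = s3.v .bad := by rw [v6 _ (by simp) (by simp), v5, v4]
  have htriv : s6.v .triv = s3.v .triv := by rw [v6 _ (by simp) (by simp), v5, v4]
  have size3 : s3.v .size = I.card := by rw [v3 _ (by simp) (by simp), v2, v1, h.size]
  have lv3 : s3.v .lv = I.sentence.nq + 1 := by rw [v3 _ (by simp) (by simp), v2, v1, h.lv]
  rw [size3, lv3] at cand4
  rw [v4, size3, lv3] at reps5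
  refine ⟨h.listed.of_eq (by rw [hsize, h.size]) (aa _ (by simp) (by simp) (by simp) (by simp)
      (by simp)), hsize, hqs, by rw [vv _ (by simp) (by simp) (by simp) (by simp), h.mode],
    by rw [vv _ (by simp) (by simp) (by simp) (by simp), h.dep], by rw [kind6]; exact h.kinds,
    tr1, fun a b hab => ed1 a b ((h.rel a b).2 hab), by rw [← hrel']; exact pa1, ?_,
    by rw [hbad]; exact bad3, by rw [htriv]; exact triv3, ?_, ?_, ?_⟩
  · rw [show s6.a .rep = s2.a .rep by rw [a6, a5 _ (by simp), a4 _ (by simp) (by simp), a3]]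
    exact rep2
  · rw [a6, a5 _ (by simp)]; exact cand4
  · rw [a6]; exact reps5
  · rw [bud6, hbad, htriv, v5, v4, State.count, a6, size3, ← hqs, v6 .qs (by simp) (by simp), v5,
      v4]

variable {s : State}

theorem Prepared.rel_lt (h : I.Prepared s) (a b : ℕ) (hab : s.rel a b) :
    a < I.sentence.nq ∧ b < I.sentence.nq := by
  rw [← h.qs]; exact ⟨hab.1, hab.2.1⟩

/-- The sentence is a game for the prepared relation. -/
theorem Prepared.isYes_iff (h : I.Prepared s) (g : ℕ → I.carrier) :
    I.IsYes ↔ Game .univ .univ (fun i => s.a .kind i ≠ 0) (Holds s.rel) I.sentence.nq 0 g := by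
  have hfv : I.sentence.freeVars = ∅ := I.isSentence
  rw [← game_congr (holds_closure h.edge h.path),
    ← I.sentence.sat_iff_game g (fun x hx => by simp [hfv] at hx) h.kinds]
  refine ⟨fun hs => hs _, fun hs v => (CPFormula.sat_congr _ fun x hx => ?_).1 hs⟩
  simp [hfv] at hx

theorem Prepared.reps_of_cand (h : I.Prepared s) {p : ℕ} (hp : p < I.card) (hc : s.a .cand p ≠ 0) :
    s.a .reps p ≠ 0 := by
  rw [h.cand p hp] at hc
  rw [h.reps p hp]
  intro q hq hT
  have := hT _ hc
  have heq : I.el q = I.el p := le_antisymm (this.2.2 le_rfl) (this.1.2 le_rfl)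
  have := h.listed.inj q (by rw [h.size]; omega) p (by rw [h.size]; omega) heq
  omega

/-- Every element has the same relations to `B` as some chosen representative. -/
theorem Prepared.exists_reps (h : I.Prepared s) (p : I.carrier) :
    ∃ i < I.card, s.a .reps i ≠ 0 ∧ SameType (lvl I.carrier (I.sentence.nq + 1)) p (I.el i) := by
  obtain ⟨i, hi, rfl⟩ := h.listed.surj p
  rw [h.size] at hi
  induction i using Nat.strong_induction_on with
  | _ i ih =>
    by_cases hr : s.a .reps i ≠ 0
    · exact ⟨i, hi, hr, fun s _ => ⟨Iff.rfl, Iff.rfl⟩⟩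
    · rw [h.reps i hi] at hr
      push Not at hr
      obtain ⟨q, hq, hT⟩ := hr
      obtain ⟨j, hj, hj', hT'⟩ := ih q hq (by omega)
      exact ⟨j, hj, hj', fun s hs => ⟨(hT' s hs).1.trans (hT s hs).1,
        (hT' s hs).2.trans (hT s hs).2⟩⟩

/-- The game of the algorithm as a game on the poset. -/
theorem Prepared.stateGame_iff (h : I.Prepared s) (g : ℕ → ℕ) (g' : ℕ → I.carrier) :
    stateGame I.encode s I.sentence.nq 0 g ↔
      Game {p | ∃ i < I.card, s.a .reps i ≠ 0 ∧ I.el i = p} (lvl I.carrier (I.sentence.nq + 1))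
        (fun i => s.a .kind i ≠ 0)
        (fun g => ∀ a b, s.rel a b → g (s.a .rep a) ≤ g (s.a .rep b)) I.sentence.nq 0 g' := by
  have hrep := fun {i} => rep_lt (r := I.sentence.nq) (i := i) h.rel_lt h.rep
  have hle : ∀ (g : ℕ → ℕ) (g' : ℕ → I.carrier),
      (∀ t < I.sentence.nq, g t < I.card ∧ I.el (g t) = g' t) →
      (goal I.encode s g ↔ ∀ a b, s.rel a b → g' (s.a .rep a) ≤ g' (s.a .rep b)) := by
    intro g g' hI
    refine forall_congr' fun a => forall_congr' fun b => imp_congr_right fun hab => ?_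
    obtain ⟨ha, ha'⟩ := hI _ (hrep (h.rel_lt a b hab).1)
    obtain ⟨hb, hb'⟩ := hI _ (hrep (h.rel_lt a b hab).2)
    rw [h.listed.le _ (by rwa [h.size]) _ (by rwa [h.size]), ha', hb']
  have upd : ∀ (i a : ℕ) (g : ℕ → ℕ) (g' : ℕ → I.carrier),
      (∀ t < i, g t < I.card ∧ I.el (g t) = g' t) → a < I.card →
      ∀ t < i + 1, update g i a t < I.card ∧ I.el (update g i a t) = update g' i (I.el a) t := by
    intro i a g g' hI ha t ht
    by_cases hti : t = i
    · subst hti; simpa using ha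
    · simpa [hti] using hI t (by omega)
  have surj : ∀ p, ∃ i < I.card, I.el i = p := by rw [← h.size]; exact h.listed.surj
  constructor
  · refine Game.transfer (r := I.sentence.nq)
      (fun i g g' => ∀ t < i, g t < I.card ∧ I.el (g t) = g' t) ?_ ?_
      (fun g g' hI => (hle g g' hI).1) _ _ _ _ (Nat.zero_add _) (by simp)
    · rintro i g g' - - hI _ ⟨a, ha, hr, rfl⟩
      exact ⟨a, ⟨by rwa [h.size], hr⟩, upd i a g g' hI ha⟩
    · rintro i g g' - - hI a ⟨ha, hc⟩
      rw [h.size] at ha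
      exact ⟨I.el a, (h.cand a ha).1 hc, upd i a g g' hI ha⟩
  · refine Game.transfer (r := I.sentence.nq)
      (fun i g' g => ∀ t < i, g t < I.card ∧ I.el (g t) = g' t) ?_ ?_
      (fun g' g hI => (hle g g' hI).2) _ _ _ _ (Nat.zero_add _) (by simp)
    · rintro i g' g - - hI a ⟨ha, hr⟩
      rw [h.size] at ha
      exact ⟨I.el a, ⟨a, ha, hr, rfl⟩, upd i a g g' hI ha⟩
    · rintro i g' g - - hI p hp
      obtain ⟨a, ha, rfl⟩ := surj p
      exact ⟨a, ⟨by rwa [h.size], (h.cand a ha).2 hp⟩, upd i a g g' hI ha⟩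

theorem Prepared.res_iff (h : I.Prepared s) (hbad : s.v .bad = 0) (htriv : s.v .triv = 0) :
    (Cmd.den I.encode (.loop .bud stepCmd) [] s).v .res ≠ 0 ↔ I.IsYes := by
  have : Finite I.carrier := Finite.of_equiv _ I.listing
  have hv : ¬ Viol (fun i => s.a .kind i ≠ 0) s.rel := by rw [← h.bad]; simpa using hbad
  rw [den_loop_stepCmd (by rw [h.qs]; exact fun i hi => rep_lt h.rel_lt h.rep hi)
    (by rw [h.size]; exact fun p hp => h.reps_of_cand hp) h.mode h.dep
    (by rw [h.bud, h.size, h.qs]; simp [hbad, htriv]), h.qs,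
    h.stateGame_iff _ (fun _ => I.el 0), h.isYes_iff (fun _ => I.el 0)]
  constructor
  · refine restrict_universal h.trans h.rel_lt hv h.rep fun p => ?_
    obtain ⟨i, hi, hr, hT⟩ := h.exists_reps p
    exact ⟨_, ⟨i, hi, hr, rfl⟩, hT⟩
  · exact restrict_existential h.trans h.rel_lt hv h.rep

/-- The output of the algorithm. -/
theorem Prepared.output (h : I.Prepared s) : (gameCmd.den I.encode [] s).v .res =
    open Classical in if I.IsYes then 1 else 0 := by
  have : Finite I.carrier := Finite.of_equiv _ I.listing
  have e : gameCmd.den I.encode [] s =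
    answerCmd.den I.encode [] (Cmd.den I.encode (.loop .bud stepCmd) [] s) := rfl
  have hres := h.res_iff
  have hv : ∀ i, i ∉ (Cmd.loop .bud stepCmd).modv →
      (Cmd.den I.encode (.loop .bud stepCmd) [] s).v i = s.v i :=
    fun i hi => Cmd.den_v _ _ hi _ _
  rw [e]
  set s' := Cmd.den I.encode (.loop .bud stepCmd) [] s
  have hbad : s'.v .bad = s.v .bad := hv _ (by decide)
  have htriv : s'.v .triv = s.v .triv := hv _ (by decide)
  have hsize : s'.v .size = I.card := (hv _ (by decide)).trans h.size
  have key : (s'.v .size = 1 ∨ (s'.v .bad = 0 ∧ (s'.v .triv ≠ 0 ∨ s'.v .res ≠ 0))) ↔ I.IsYes := by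
    rw [hbad, htriv, hsize]
    by_cases h1 : I.card = 1
    · have : Subsingleton I.carrier := by
        rw [← I.listing.subsingleton_congr, h1]; infer_instance
      simp only [h1, true_or, true_iff]
      rw [h.isYes_iff (fun _ => I.el 0)]
      exact (game_congr (fun g => iff_of_true trivial fun a b _ =>
        (Subsingleton.elim (g a) (g b)).le) _ _ _).1 (game_true _ _ _)
    · have : Nontrivial I.carrier := by
        have := I.card_pos
        have : Nontrivial (Fin I.card) := Fin.nontrivial_iff_two_le.2 (by omega)
        exact I.listing.symm.nontrivial
      simp only [h1, false_or]
      by_cases hb : s.v .bad = 0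
      · simp only [hb, true_and]
        by_cases ht : s.v .triv = 0
        · simp [ht, ← hres hb ht]
        · obtain ⟨⟨bot, hbot⟩, top, htop⟩ := h.triv.1 ht
          have hv : ¬ Viol (fun i => s.a .kind i ≠ 0) s.rel := by rw [← h.bad]; simpa using hb
          refine iff_of_true (.inl ht) ((h.isYes_iff (fun _ => I.el 0)).2 ?_)
          exact game_of_bot_top h.trans h.rel_lt hv h.rep hbot htop _
      · simp only [hb, false_and, false_iff]
        rw [h.isYes_iff (fun _ => I.el 0)]
        exact not_game_of_viol h.rel_lt (h.bad.1 hb) _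
  rw [← key]
  simp only [answerCmd, Cmd.den, Ex.not, Ex.and, Ex.or, Ex.eq, Ex.lt, Ex.eval,
    State.setv_v, if_true]
  split_ifs with hc <;> omega

end Instance

/-! ### Running time -/

theorem budget_add_two_le (m c j : ℕ) : budget m c j + 2 ≤ (m + 4) * (c + 2) ^ j := by
  induction j with
  | zero => simp [budget]
  | succ j ih =>
    rw [budget, pow_succ]
    have h1 := Nat.mul_le_mul_left c ih
    have h2 : m + 4 ≤ (m + 4) * (c + 2) ^ j := Nat.le_mul_of_pos_right _ (by positivity)
    calc m + 2 + c * (budget m c j + 2) + 2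
        ≤ (m + 4) * (c + 2) ^ j + c * ((m + 4) * (c + 2) ^ j) := by omega
      _ ≤ (m + 4) * ((c + 2) ^ j * (c + 2)) := by
        rw [show (m + 4) * ((c + 2) ^ j * (c + 2)) = (m + 4) * (c + 2) ^ j +
          c * ((m + 4) * (c + 2) ^ j) + (m + 4) * (c + 2) ^ j by ring]
        omega

theorem iterExp_pos {w : ℕ} (hw : 1 ≤ w) (i x : ℕ) : 1 ≤ iterExp w (i + 1) x :=
  Nat.one_le_pow _ _ hw

theorem iterExp_mono {w w' x x' : ℕ} (hw : 1 ≤ w) (hww' : w ≤ w') (hx : x ≤ x') :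
    ∀ i, iterExp w i x ≤ iterExp w' i x'
  | 0 => hx
  | i + 1 => (Nat.pow_le_pow_left hww' _).trans
    (Nat.pow_le_pow_right (by omega) (iterExp_mono hw hww' hx i))

/-- The number of plays is bounded by a tower of height `4`. -/
theorem pow_card_le_iterExp {w r k D b c : ℕ} (hw : 2 ≤ w) (hr : r ≤ k) (hk : 1 ≤ k)
    (hb : b + 1 ≤ w ^ (3 * (w + 1) ^ (r + 1))) (hc : c ≤ (b + 1) ^ (2 * w)) :
    (c + 2) ^ (r * D) ≤ iterExp w 4 ((D + 9) * k) := by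
  have hlt : ∀ y, y ≤ w ^ y := fun y => (Nat.lt_pow_self hw).le
  have h1 : c + 2 ≤ w ^ (6 * w * (w + 1) ^ (r + 1) + 2) := by
    have h2 : c ≤ w ^ (6 * w * (w + 1) ^ (r + 1)) := by
      refine hc.trans ((Nat.pow_le_pow_left hb _).trans ?_)
      rw [← pow_mul]
      exact Nat.pow_le_pow_right (by omega) (le_of_eq (by ring))
    have h3 : 1 ≤ w ^ (6 * w * (w + 1) ^ (r + 1)) := Nat.one_le_pow _ _ (by omega)
    rw [pow_add]
    have h4 : 4 ≤ w ^ 2 := Nat.pow_le_pow_left hw 2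
    have h5 := Nat.mul_le_mul_left (w ^ (6 * w * (w + 1) ^ (r + 1))) h4
    omega
  refine (Nat.pow_le_pow_left h1 _).trans ?_
  rw [← pow_mul]
  refine Nat.pow_le_pow_right (by omega) ?_
  -- the exponent is at most `w ^ ((D + 9) * k)`
  have h2 : (w + 1) ^ (r + 1) ≤ w ^ (2 * (r + 1)) := by
    rw [pow_mul]
    exact Nat.pow_le_pow_left (by nlinarith) _
  have h3 : 6 * w * (w + 1) ^ (r + 1) + 2 ≤ w ^ (2 * r + 6) := by
    have h4 : 6 * w * (w + 1) ^ (r + 1) ≤ 6 * w * w ^ (2 * (r + 1)) := Nat.mul_le_mul_left _ h2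
    have h5 : 1 ≤ w * w ^ (2 * (r + 1)) := Nat.mul_pos (by omega) (Nat.pow_pos (by omega))
    have h6 : 8 ≤ w ^ 3 := Nat.pow_le_pow_left hw 3
    have h7 := Nat.mul_le_mul_right (w * w ^ (2 * (r + 1))) h6
    calc 6 * w * (w + 1) ^ (r + 1) + 2 ≤ 8 * (w * w ^ (2 * (r + 1))) := by
          rw [mul_assoc] at h4 ⊢; rw [mul_assoc 6 w (w ^ _)] at h4; omega
      _ ≤ w ^ 3 * (w * w ^ (2 * (r + 1))) := h7
      _ = w ^ (2 * r + 6) := by ring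
  have h4 : (6 * w * (w + 1) ^ (r + 1) + 2) * (r * D) ≤ w ^ ((D + 9) * k) := by
    calc (6 * w * (w + 1) ^ (r + 1) + 2) * (r * D) ≤ w ^ (2 * r + 6) * (w ^ r * w ^ D) :=
          Nat.mul_le_mul h3 (Nat.mul_le_mul (hlt r) (hlt D))
      _ = w ^ (2 * r + 6 + (r + D)) := by rw [← pow_add, ← pow_add]
      _ ≤ w ^ ((D + 9) * k) := by
        refine Nat.pow_le_pow_right (by omega) ?_
        have : D ≤ D * k := Nat.le_mul_of_pos_right _ hk
        rw [add_mul]; omega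
  exact h4.trans ((hlt _).trans (Nat.pow_le_pow_right (by omega) (hlt _)))

namespace Instance

variable {I : Instance.{u}} {s : State}

/-- The number of steps of the game, with exponent `D`. -/
theorem Prepared.bud_le (h : I.Prepared s) (D : ℕ) :
    (I.size + 2 + s.v .bud) ^ D ≤
      10 ^ D * iterExp (width I.carrier) 4 ((D + 9) * I.sentence.size) * I.size ^ D := by
  have : Finite I.carrier := Finite.of_equiv _ I.listing
  have hn := I.card_le_size
  set n := I.size
  by_cases hb : s.v .bud = 0
  · have h1 := iterExp_pos (one_le_width (P := I.carrier)) 3 ((D + 9) * I.sentence.size)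
    calc (n + 2 + s.v .bud) ^ D ≤ (10 * n) ^ D := Nat.pow_le_pow_left (by omega) D
      _ = 10 ^ D * 1 * n ^ D := by rw [mul_pow, mul_one]
      _ ≤ _ := Nat.mul_le_mul_right _ (Nat.mul_le_mul_left _ h1)
  · have hbud := h.bud
    split_ifs at hbud with hc
    · exact absurd hbud hb
    · have hw : 2 ≤ width I.carrier := by
        by_contra hw
        exact hc (.inr (h.triv.2 (exists_bot_top_of_width_le_one (by omega))))
      set B := lvl I.carrier (I.sentence.nq + 1)
      have hcount : s.count I.card ≤ (B.ncard + 1) ^ (2 * width I.carrier) := by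
        have hR := card_types_le (P := I.carrier) (B := B)
          (R := I.el '' {p | p < I.card ∧ s.a .reps p ≠ 0}) ?_
        · refine le_trans (le_of_eq ?_) hR
          rw [Set.InjOn.ncard_image, State.count, Nat.count_eq_card_filter_range,
            ← Set.ncard_coe_finset]
          · congr 1
            ext p; simp
          · rintro p ⟨hp, -⟩ q ⟨hq, -⟩ heq
            exact h.listed.inj p (by rwa [h.size]) q (by rwa [h.size]) heq
        · rintro _ ⟨p, ⟨hp, hrp⟩, rfl⟩ _ ⟨q, ⟨hq, hrq⟩, rfl⟩ hT
          rcases lt_trichotomy p q with hpq | rfl | hpq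
          · exact absurd hT ((h.reps q hq).1 hrq p hpq)
          · rfl
          · exact absurd (fun s hs => ⟨(hT s hs).1.symm, (hT s hs).2.symm⟩)
              ((h.reps p hp).1 hrp q hpq)
      have hpow := pow_card_le_iterExp (D := D) hw I.sentence.nq_le_size I.sentence.size_pos
        (card_lvl_le hw (I.sentence.nq + 1)) hcount
      have h1 := budget_add_two_le I.card (s.count I.card) I.sentence.nq
      rw [← hbud] at h1
      set q := (s.count I.card + 2) ^ I.sentence.nq with hq
      have hq1 : 1 ≤ q := Nat.one_le_pow _ _ (by omega)
      have h2 : n + 2 + s.v .bud ≤ 10 * n * q := by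
        have h3 : n ≤ n * q := Nat.le_mul_of_pos_right _ hq1
        have h4 : (I.card + 4) * q ≤ (n + 3) * q := Nat.mul_le_mul_right _ (by omega)
        have h5 : q ≤ n * q := Nat.le_mul_of_pos_left _ (by omega)
        rw [add_mul n] at h4
        rw [mul_assoc 10 n q]; omega
      calc (n + 2 + s.v .bud) ^ D ≤ (10 * n * q) ^ D := Nat.pow_le_pow_left h2 D
        _ = 10 ^ D * (s.count I.card + 2) ^ (I.sentence.nq * D) * n ^ D := by
          rw [hq, mul_pow, mul_pow, ← pow_mul]; ring
        _ ≤ _ := Nat.mul_le_mul_right _ (Nat.mul_le_mul_left _ hpow)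

end Instance

/-- The program decides every instance, in the time that is claimed. -/
theorem program_decides : ∃ C c d : ℕ, ∀ I : Instance.{u},
    program.DecidesWithin I.encode I.IsYes
      (C * iterExp (width I.carrier) 4 (c * I.sentence.size) * I.size ^ d) := by
  obtain ⟨K, D, h⟩ := link_spec sizeCmd readCmd prepareCmd gameCmd (by decide) (by decide)
    (by decide) (by decide)
  refine ⟨K * 10 ^ D, D + 9, D, fun I => ?_⟩
  have hL := I.loaded
  have hP := hL.prepared
  have hn := I.card_le_size
  have hq := I.nq_le_size
  obtain ⟨t, ht, hpc, hres⟩ := h I.encode (I.size + 1)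
    (I.size + 1 + (prepareCmd.den I.encode [] (readCmd.den I.encode []
      ((State.init I.size).setv .size I.card))).v .bud) _ _ _ _ (Nat.le_succ _)
    (Nat.le_add_right _ _) I.den_sizeCmd_init.symm rfl rfl rfl
    (fun i hi => by
      have : ∀ i ∈ sizeCmd.bnd, i = .len := by decide
      rw [this i hi]; simp [State.init, Instance.size])
    (fun i hi => by
      have : ∀ i ∈ readCmd.bnd, i = .len := by decide
      rw [this i hi]; simp [State.init])
    (fun i hi => by
      have : ∀ i ∈ prepareCmd.bnd, i = .qs ∨ i = .size ∨ i = .lv := by decide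
      rcases this i hi with rfl | rfl | rfl
      · rw [hL.qs]; omega
      · rw [hL.size]; omega
      · rw [hL.lv]; omega)
    (fun i hi => by
      have : ∀ i ∈ gameCmd.bnd, i = .qs ∨ i = .bud := by decide
      rcases this i hi with rfl | rfl
      · rw [hP.qs]; omega
      · omega)
  refine ⟨t, ht.trans ?_, hpc, fun hy => ?_, fun hy => ?_⟩
  · refine (Nat.mul_le_mul_left K ((Nat.pow_le_pow_left (le_of_eq ?_) D).trans
      (hP.bud_le D))).trans (le_of_eq ?_) <;> ring
  · exact hres.trans (by rw [hP.output, if_pos hy])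
  · exact hres.trans (by rw [hP.output, if_neg hy])

theorem primrec_pow : Primrec₂ ((· ^ ·) : ℕ → ℕ → ℕ) := by
  refine (Primrec₂.unpaired'.1 Nat.Primrec.pow)

theorem computable_bound (C c : ℕ) : Computable fun κ : ℕ => C * iterExp κ 4 (c * κ) := by
  refine Primrec.to_comp ?_
  have hid : Primrec fun κ : ℕ => κ := Primrec.id
  have h0 : Primrec fun κ : ℕ => c * κ := Primrec.nat_mul.comp (.const c) hid
  exact Primrec.nat_mul.comp (.const C) (primrec_pow.comp hid (primrec_pow.comp hid
    (primrec_pow.comp hid (primrec_pow.comp hid h0))))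

end PosetMC

theorem mainTheorem1 :
    (∃ (M : PosetMC.Program) (C c d : ℕ), ∀ I : PosetMC.Instance.{u},
      M.DecidesWithin I.encode I.IsYes
        (C * PosetMC.iterExp (PosetMC.width I.carrier) 4 (c * I.sentence.size) * I.size ^ d)) ∧
    PosetMC.IsFPT.{u} (fun I => PosetMC.width I.carrier + I.sentence.size) := by
  obtain ⟨C, c, d, h⟩ := PosetMC.program_decides.{u}
  refine ⟨⟨PosetMC.Algo.program, C, c, d, h⟩, PosetMC.Algo.program,
    fun κ => C * PosetMC.iterExp κ 4 (c * κ), Polynomial.X ^ d, PosetMC.computable_bound C c,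
    fun I => ?_⟩
  have : Finite I.carrier := Finite.of_equiv _ I.listing
  obtain ⟨t, ht, h'⟩ := h I
  refine ⟨t, ht.trans ?_, h'⟩
  rw [Polynomial.eval_pow, Polynomial.eval_X]
  exact Nat.mul_le_mul_right _ (Nat.mul_le_mul_left _ (PosetMC.iterExp_mono PosetMC.one_le_width
    (Nat.le_add_right _ _) (Nat.mul_le_mul_left _ (Nat.le_add_left _ _)) 4))
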